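/- Let $N\in\mathbb N$ and $\mathcal H=\ell^2(\mathbb Z^2)\otimes\mathbb C^N$. For a bounded operator $A$ on $\mathcal H$ and $x,y\in\mathbb Z^2$ let $A_{xy}=\langle\delta_x,A\,\delta_y\rangle$ be its $N\times N$ matrix element. Let $H$ be a Hamiltonian, i.e. a bounded self-adjoint operator on $\mathcal H$ such that for every sufficiently large $\alpha\in\mathbb N$ there is $C_\alpha<\infty$ with $\|H_{xy}\|\le C_\alpha(1+\|x-y\|)^{-\alpha}$ for all $x,y\in\mathbb Z^2$. Let $\Delta\subseteq\mathbb R$ be an interval with more than one point, and let $B_1(\Delta)$ be the set of Borel functions $f$ on $\mathbb R$ that are constant on $(-\infty,\inf\Delta]$ and on $[\sup\Delta,\infty)$ and satisfy $|f(t)|\le 1$ for all $t\in\mathbb R$. Assume that $H$ is mobility-gapped on $\Delta$, i.e. 1. there is $\nu\in\mathbb N$ such that for every sufficiently large $m\in\mathbb N$ there is $C_m<\infty$ with $$\|f(H)_{xy}\|\le C_m(1+\|x-y\|)^{-m}(1+\|x\|)^{\nu}\qquad\text{for all } f\in B_1(\Delta),\ x,y\in\mathbb Z^2;$$ 2. every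 eigenvalue of $H$ in $\Delta$ has finite multiplicity. Let $P_\mu=\chi_{(-\infty,\mu)}(H)$, $P_\mu^\perp=\mathbb 1-P_\mu$, let $U=\exp(\mathrm i\arg(X_1+\mathrm iX_2))$ be the operator of multiplication by $e^{\mathrm i\arg(x_1+\mathrm ix_2)}$ (and by $1$ at $x=0$), and let $F_\mu=P_\mu UP_\mu+P_\mu^\perp$. Then: * ($\mathbb Z$-index) For every $\mu\in\Delta$ the operator $F_\mu$ is Fredholm, and $\operatorname{index}F_\mu=\dim\ker F_\mu-\dim\ker F_\mu^*\in\mathbb Z$ does not depend on $\mu\in\Delta$. * ($\mathbb Z_2$-index) Let $\Theta$ be a fermionic time-reversal symmetry, i.e. an antiunitary, conjugate-linear map on $\mathcal H$ with $\Theta^2=-\mathbb 1$ that commutes with the position operators $X_1,X_2$. If $[H,\Theta]=0$, then for every $\mu\in\Delta$ the operator $F_\mu$ is $\Theta$-odd, i.e. $F_\mu=-\Theta F_\mu^*\Theta$, and $\operatorname{index}_2F_\mu=\dim\ker F_\mu \bmod 2\in\mathbb Z_2$ does not depend on $\mu\in\Delta$. -/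

import Mathlib

open MeasureTheory Filter Topology
open scoped InnerProductSpace ENNReal CompactlySupported

namespace MobilityGap

noncomputable section

/-! ### Borel functional calculus of a bounded self-adjoint operator -/

section BorelCalculus

variable {E : Type*} [NormedAddCommGroup E] [InnerProductSpace ℂ E] [CompleteSpace E]

/-- The positive linear functional `g ↦ ⟪ψ, g(H) ψ⟫` on continuous compactly supported functions,
`g(H)` being the continuous functional calculus. -/
def spectralFunctional (H : E →L[ℂ] E) (ψ : E) : C_c(ℝ, ℝ) →ₚ[ℝ] ℝ :=
  PositiveLinearMap.mk₀
    { toFun := fun g => (⟪ψ, cfc (g : ℝ → ℝ) H ψ⟫_ℂ).re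
      map_add' := fun g h => by
        have : cfc (⇑(g + h)) H = cfc (⇑g) H + cfc (⇑h) H :=
          cfc_add H g h g.continuous.continuousOn h.continuous.continuousOn
        rw [this, add_apply, inner_add_right, Complex.add_re]
      map_smul' := fun c g => by
        have : cfc (⇑(c • g)) H = c • cfc (⇑g) H :=
          cfc_smul c g H g.continuous.continuousOn
        rw [this, smul_apply, inner_smul_right_eq_smul, Complex.smul_re]
        rfl }
    (fun g hg => by
      have h0 : 0 ≤ cfc (⇑g) H := cfc_nonneg fun x _ => hg x
      have h1 := (ContinuousLinearMap.nonneg_iff_isPositive _).1 h0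
      exact (Complex.le_def.1 (h1.inner_nonneg_right ψ)).1)

/-- The spectral measure of `H` at the vector `ψ`: the measure with
`∫ g ∂(spectralMeasure H ψ) = ⟪ψ, g(H) ψ⟫` for continuous `g`. -/
def spectralMeasure (H : E →L[ℂ] E) (ψ : E) : Measure ℝ :=
  RealRMK.rieszMeasure (spectralFunctional H ψ)

theorem integral_spectralMeasure (H : E →L[ℂ] E) (ψ : E) (g : C_c(ℝ, ℝ)) :
    ((∫ t, g t ∂(spectralMeasure H ψ) : ℝ) : ℂ) = ⟪ψ, cfc (g : ℝ → ℝ) H ψ⟫_ℂ := by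
  have h1 : ∫ t, g t ∂(spectralMeasure H ψ) = (⟪ψ, cfc (g : ℝ → ℝ) H ψ⟫_ℂ).re :=
    RealRMK.integral_rieszMeasure (spectralFunctional H ψ) g
  have hs : IsSelfAdjoint (cfc (g : ℝ → ℝ) H) := IsSelfAdjoint.cfc
  have h2 : (starRingEnd ℂ) ⟪ψ, cfc (g : ℝ → ℝ) H ψ⟫_ℂ = ⟪ψ, cfc (g : ℝ → ℝ) H ψ⟫_ℂ := by
    rw [inner_conj_symm]
    exact (ContinuousLinearMap.isSelfAdjoint_iff_isSymmetric.1 hs) ψ ψ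
  rw [h1]
  exact Complex.conj_eq_iff_re.1 h2

theorem spectralMeasure_univ_le (H : E →L[ℂ] E) (ψ : E) :
    spectralMeasure H ψ Set.univ ≤ ENNReal.ofReal (‖ψ‖ ^ 2) := by
  have hreg : (spectralMeasure H ψ).Regular := by
    unfold spectralMeasure; infer_instance
  rw [isOpen_univ.measure_eq_iSup_isCompact]
  refine iSup₂_le fun K _ => iSup_le fun hK => ?_
  obtain ⟨f, hf1, -, hf3, hf4⟩ := exists_continuous_one_zero_of_isCompact
    hK (isClosed_empty (X := ℝ)) (Set.disjoint_empty K)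
  let g : C_c(ℝ, ℝ) := ⟨f, hf3⟩
  refine (RealRMK.rieszMeasure_le_of_eq_one (spectralFunctional H ψ) (f := g)
    (fun x => (hf4 x).1) hK (fun x hx => hf1 hx)).trans (ENNReal.ofReal_le_ofReal ?_)
  have hn : ‖cfc (g : ℝ → ℝ) H‖ ≤ 1 := norm_cfc_le zero_le_one fun x _ => by
    rw [Real.norm_eq_abs, abs_le]
    exact ⟨(by norm_num : (-1 : ℝ) ≤ 0).trans (hf4 x).1, (hf4 x).2⟩
  calc (⟪ψ, cfc (g : ℝ → ℝ) H ψ⟫_ℂ).re ≤ ‖⟪ψ, cfc (g : ℝ → ℝ) H ψ⟫_ℂ‖ := Complex.re_le_norm _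
    _ ≤ ‖ψ‖ * ‖cfc (g : ℝ → ℝ) H ψ‖ := norm_inner_le_norm _ _
    _ ≤ ‖ψ‖ * (1 * ‖ψ‖) := by
        gcongr
        exact ContinuousLinearMap.le_of_opNorm_le _ hn ψ
    _ = ‖ψ‖ ^ 2 := by ring

instance isFiniteMeasure_spectralMeasure (H : E →L[ℂ] E) (ψ : E) :
    IsFiniteMeasure (spectralMeasure H ψ) :=
  ⟨(spectralMeasure_univ_le H ψ).trans_lt ENNReal.ofReal_lt_top⟩

theorem norm_integral_spectralMeasure_le (H : E →L[ℂ] E) (ψ : E) {f : ℝ → ℂ} {C : ℝ}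
    (hC : ∀ t, ‖f t‖ ≤ C) : ‖∫ t, f t ∂(spectralMeasure H ψ)‖ ≤ C * ‖ψ‖ ^ 2 := by
  have hC0 : 0 ≤ C := (norm_nonneg _).trans (hC 0)
  refine (norm_integral_le_of_norm_le_const (Eventually.of_forall hC)).trans ?_
  gcongr
  exact ENNReal.toReal_le_of_le_ofReal (by positivity) (spectralMeasure_univ_le H ψ)

/-- On finitely many vectors, the quadratic form of a bounded Borel function is approximated by
that of an operator. -/
theorem exists_approx (H : E →L[ℂ] E) {f : ℝ → ℂ} (hf : Measurable f) {C : ℝ}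
    (hC : ∀ t, ‖f t‖ ≤ C) (s : Finset E) {ε : ℝ} (hε : 0 < ε) :
    ∃ A : E →L[ℂ] E, ∀ v ∈ s, ‖⟪v, A v⟫_ℂ - ∫ t, f t ∂(spectralMeasure H v)‖ ≤ ε := by
  classical
  let ν : Measure ℝ := ∑ v ∈ s, spectralMeasure H v
  have hint : ∀ (μ : Measure ℝ) [IsFiniteMeasure μ], Integrable f μ := fun μ _ =>
    Integrable.of_bound hf.aestronglyMeasurable C (Eventually.of_forall hC)
  obtain ⟨g, hg1, hg2, hg3, hg4⟩ :=
    (hint ν).exists_hasCompactSupport_integral_sub_le hε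
  let gr : C_c(ℝ, ℝ) := ⟨⟨fun t => (g t).re, Complex.continuous_re.comp hg3⟩,
    hg1.comp_left (g := Complex.re) rfl⟩
  let gi : C_c(ℝ, ℝ) := ⟨⟨fun t => (g t).im, Complex.continuous_im.comp hg3⟩,
    hg1.comp_left (g := Complex.im) rfl⟩
  refine ⟨cfc (gr : ℝ → ℝ) H + Complex.I • cfc (gi : ℝ → ℝ) H, fun v hv => ?_⟩
  have hle : spectralMeasure H v ≤ ν :=
    Finset.single_le_sum (f := fun v => spectralMeasure H v) (fun _ _ => Measure.zero_le _) hv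
  have hgv : Integrable g (spectralMeasure H v) := hg4.mono_measure hle
  have hq : ⟪v, (cfc (gr : ℝ → ℝ) H + Complex.I • cfc (gi : ℝ → ℝ) H) v⟫_ℂ
      = ∫ t, g t ∂(spectralMeasure H v) := by
    rw [add_apply, inner_add_right, smul_apply,
      inner_smul_right, ← integral_spectralMeasure, ← integral_spectralMeasure,
      ← integral_re_add_im hgv, mul_comm]
    rfl
  rw [hq, ← integral_sub hgv (hint _)]
  refine (norm_integral_le_integral_norm _).trans (le_trans ?_ hg2)
  simp_rw [norm_sub_rev (g _)]
  exact integral_mono_measure hle (Eventually.of_forall fun _ => norm_nonneg _)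
    ((hint ν).sub hg4).norm

/-- For every bounded Borel function `f` there is exactly one bounded operator with the quadratic
form `ψ ↦ ∫ f ∂(spectralMeasure H ψ)`. -/
theorem existsUnique_borelCalculus (H : E →L[ℂ] E) {f : ℝ → ℂ} (hf : Measurable f) {C : ℝ}
    (hC : ∀ t, ‖f t‖ ≤ C) :
    ∃! T : E →L[ℂ] E, ∀ ψ, ⟪ψ, T ψ⟫_ℂ = ∫ t, f t ∂(spectralMeasure H ψ) := by
  classical
  have hC0 : 0 ≤ C := (norm_nonneg _).trans (hC 0)
  set q : E → ℂ := fun ψ => ∫ t, f t ∂(spectralMeasure H ψ) with hqdef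
  have hqle : ∀ ψ, ‖q ψ‖ ≤ C * ‖ψ‖ ^ 2 := fun ψ => norm_integral_spectralMeasure_le H ψ hC
  have hA : ∀ i : Finset E × ℕ, ∃ A : E →L[ℂ] E, ∀ v ∈ i.1,
      ‖⟪v, A v⟫_ℂ - q v‖ ≤ 1 / ((i.2 : ℝ) + 1) := fun i =>
    exists_approx H hf hC i.1 (by positivity)
  choose A hA using hA
  have hlim : ∀ v, Tendsto (fun i => ⟪v, A i v⟫_ℂ) atTop (𝓝 (q v)) := by
    intro v
    rw [tendsto_iff_norm_sub_tendsto_zero]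
    have h1 : Tendsto (fun i : Finset E × ℕ => 1 / ((i.2 : ℝ) + 1)) atTop (𝓝 0) :=
      tendsto_one_div_add_atTop_nhds_zero_nat.comp
        (by rw [← prod_atTop_atTop_eq]; exact tendsto_snd)
    refine squeeze_zero' (Eventually.of_forall fun _ => norm_nonneg _) ?_ h1
    filter_upwards [eventually_ge_atTop (({v} : Finset E), 0)] with i hi
    exact hA i v (hi.1 (Finset.mem_singleton_self v))
  let B : E → E → ℂ := fun x y =>
    (q (x + y) - q (x - y) - Complex.I * q (x + Complex.I • y)
      + Complex.I * q (x - Complex.I • y)) / 4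
  have hB : ∀ x y, Tendsto (fun i => ⟪x, A i y⟫_ℂ) atTop (𝓝 (B x y)) := by
    intro x y
    have := ((((hlim (x + y)).sub (hlim (x - y))).sub
      ((hlim (x + Complex.I • y)).const_mul Complex.I)).add
      ((hlim (x - Complex.I • y)).const_mul Complex.I)).div_const 4
    refine this.congr fun i => ?_
    simp only [map_add, map_sub, map_smul, inner_add_left, inner_add_right, inner_sub_left,
      inner_sub_right, inner_smul_left, inner_smul_right, Complex.conj_I]
    ring_nf
    simp only [Complex.I_sq]
    ring
  have hBq : ∀ x, B x x = q x := fun x => tendsto_nhds_unique (hB x x) (hlim x)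
  have hadd : ∀ x y z, B x (y + z) = B x y + B x z := fun x y z =>
    tendsto_nhds_unique (hB x (y + z))
      (((hB x y).add (hB x z)).congr fun i => by rw [map_add, inner_add_right])
  have hsmul : ∀ (c : ℂ) x y, B x (c • y) = c * B x y := fun c x y =>
    tendsto_nhds_unique (hB x (c • y))
      (((hB x y).const_mul c).congr fun i => by rw [map_smul, inner_smul_right])
  have hadd' : ∀ x y z, B (x + y) z = B x z + B y z := fun x y z =>
    tendsto_nhds_unique (hB (x + y) z)
      (((hB x z).add (hB y z)).congr fun i => by rw [inner_add_left])
  have hsmul' : ∀ (c : ℂ) x y, B (c • x) y = (starRingEnd ℂ) c * B x y := fun c x y =>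
    tendsto_nhds_unique (hB (c • x) y)
      (((hB x y).const_mul _).congr fun i => by rw [inner_smul_left])
  have hbd1 : ∀ x y, ‖x‖ ≤ 1 → ‖y‖ ≤ 1 → ‖B x y‖ ≤ 4 * C := by
    intro x y hx hy
    have hq4 : ∀ v, ‖v‖ ≤ 2 → ‖q v‖ ≤ 4 * C := fun v hv => (hqle v).trans (by
      have : ‖v‖ ^ 2 ≤ 2 ^ 2 := by gcongr
      nlinarith)
    have hIy : ‖Complex.I • y‖ ≤ 1 := by simpa [norm_smul] using hy
    have h1 := hq4 (x + y) ((norm_add_le _ _).trans (by linarith))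
    have h2 := hq4 (x - y) ((norm_sub_le _ _).trans (by linarith))
    have h3 := hq4 (x + Complex.I • y) ((norm_add_le _ _).trans (by linarith))
    have h4 := hq4 (x - Complex.I • y) ((norm_sub_le _ _).trans (by linarith))
    have h5 : ‖q (x + y) - q (x - y) - Complex.I * q (x + Complex.I • y)
        + Complex.I * q (x - Complex.I • y)‖ ≤ ‖q (x + y)‖ + ‖q (x - y)‖
          + ‖q (x + Complex.I • y)‖ + ‖q (x - Complex.I • y)‖ := by
      refine (norm_add_le _ _).trans ?_
      rw [norm_mul, Complex.norm_I, one_mul]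
      gcongr
      refine (norm_sub_le _ _).trans ?_
      rw [norm_mul, Complex.norm_I, one_mul]
      gcongr
      exact norm_sub_le _ _
    simp only [B, norm_div]
    rw [div_le_iff₀ (by norm_num)]
    norm_num
    linarith
  have hbd : ∀ x y, ‖B x y‖ ≤ 4 * C * ‖x‖ * ‖y‖ := by
    intro x y
    rcases eq_or_ne x 0 with rfl | hx
    · have : B 0 y = 0 := by simpa using hsmul' 0 0 y
      simp [this]
    rcases eq_or_ne y 0 with rfl | hy
    · have : B x 0 = 0 := by simpa using hsmul 0 x 0
      simp [this]
    have hx' : 0 < ‖x‖ := norm_pos_iff.2 hx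
    have hy' : 0 < ‖y‖ := norm_pos_iff.2 hy
    have key := hbd1 (((‖x‖⁻¹ : ℝ) : ℂ) • x) (((‖y‖⁻¹ : ℝ) : ℂ) • y)
      (by simp [norm_smul, hx'.ne']) (by simp [norm_smul, hy'.ne'])
    rw [hsmul, hsmul'] at key
    simp only [norm_mul, RCLike.norm_conj, Complex.norm_real, norm_inv, norm_norm] at key
    rw [inv_mul_le_iff₀ hy', inv_mul_le_iff₀ hx'] at key
    linarith
  let L : E →ₗ⋆[ℂ] E →ₗ[ℂ] ℂ := LinearMap.mk₂'ₛₗ (starRingEnd ℂ) (RingHom.id ℂ) B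
    hadd' hsmul' hadd hsmul
  let S := InnerProductSpace.continuousLinearMapOfBilin (L.mkContinuous₂ (4 * C) hbd)
  have hS : ∀ x y, ⟪x, (ContinuousLinearMap.adjoint S) y⟫_ℂ = B x y := fun x y => by
    rw [ContinuousLinearMap.adjoint_inner_right]
    exact InnerProductSpace.continuousLinearMapOfBilin_apply _ x y
  refine ⟨ContinuousLinearMap.adjoint S, fun ψ => (hS ψ ψ).trans (hBq ψ), fun T hT => ?_⟩
  have h : (T : E →ₗ[ℂ] E) = (ContinuousLinearMap.adjoint S : E →L[ℂ] E) := by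
    refine (ext_inner_map _ _).1 fun ψ => ?_
    have : ⟪ψ, T ψ⟫_ℂ = ⟪ψ, (ContinuousLinearMap.adjoint S) ψ⟫_ℂ := by
      rw [hT, hS, hBq]
    have h := congrArg (starRingEnd ℂ) this
    rwa [inner_conj_symm, inner_conj_symm] at h
  exact ContinuousLinearMap.coe_injective h

open Classical in
/-- The operator `f(H)` for a bounded Borel function `f`: the one whose quadratic form is
`ψ ↦ ∫ f ∂(spectralMeasure H ψ)` (it exists and is unique by `existsUnique_borelCalculus`). -/
def borelCalculus (H : E →L[ℂ] E) (f : ℝ → ℂ) : E →L[ℂ] E :=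
  if h : ∃ T : E →L[ℂ] E, ∀ ψ, ⟪ψ, T ψ⟫_ℂ = ∫ t, f t ∂(spectralMeasure H ψ) then h.choose else 0

theorem inner_borelCalculus (H : E →L[ℂ] E) {f : ℝ → ℂ} (hf : Measurable f) {C : ℝ}
    (hC : ∀ t, ‖f t‖ ≤ C) (ψ : E) :
    ⟪ψ, borelCalculus H f ψ⟫_ℂ = ∫ t, f t ∂(spectralMeasure H ψ) := by
  have h := (existsUnique_borelCalculus H hf hC).exists
  rw [borelCalculus, dif_pos h]
  exact h.choose_spec ψ

/-- The Fermi projection `P_μ = χ_{(-∞,μ)}(H)`. -/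
def fermiProjection (H : E →L[ℂ] E) (μ : ℝ) : E →L[ℂ] E :=
  borelCalculus H ((Set.Iio μ).indicator 1)

end BorelCalculus

/-! ### Tight-binding operators on the lattice `ℤ²` -/

/-- The Hilbert space `ℓ²(ℤ²) ⊗ ℂᴺ`. -/
abbrev BulkSpace (N : ℕ) : Type :=
  lp (fun _ : ℤ × ℤ => EuclideanSpace ℂ (Fin N)) 2

variable {N : ℕ}

/-- The matrix element `A_{xy} = ⟨δ_x, A δ_y⟩`, an operator on `ℂᴺ`; its norm is the operator
norm. -/
def matrixElement (A : BulkSpace N →L[ℂ] BulkSpace N) (x y : ℤ × ℤ) :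
    EuclideanSpace ℂ (Fin N) →L[ℂ] EuclideanSpace ℂ (Fin N) :=
  lp.evalCLM ℂ (fun _ : ℤ × ℤ => EuclideanSpace ℂ (Fin N)) 2 x ∘L A ∘L
    lp.singleContinuousLinearMap ℂ (fun _ : ℤ × ℤ => EuclideanSpace ℂ (Fin N)) 2 y

/-- `A` is local: its matrix elements decay faster than any power of `‖x - y‖`. -/
def IsLocal (A : BulkSpace N →L[ℂ] BulkSpace N) : Prop :=
  ∀ᶠ α : ℕ in atTop, ∃ C : ℝ, ∀ x y : ℤ × ℤ, ‖matrixElement A x y‖ ≤ C * ((1 + ‖x - y‖) ^ α)⁻¹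

/-- All operators in the family `S` are weakly local, with the same exponent `ν` and the same
constants `C_m`. -/
def IsUniformlyWeaklyLocal (S : Set (BulkSpace N →L[ℂ] BulkSpace N)) : Prop :=
  ∃ ν : ℕ, ∀ᶠ m : ℕ in atTop, ∃ C : ℝ, ∀ A ∈ S, ∀ x y : ℤ × ℤ,
    ‖matrixElement A x y‖ ≤ C * ((1 + ‖x - y‖) ^ m)⁻¹ * (1 + ‖x‖) ^ ν

/-- A Hamiltonian is a self-adjoint local operator. -/
structure IsHamiltonian (H : BulkSpace N →L[ℂ] BulkSpace N) : Prop where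
  isSelfAdjoint : IsSelfAdjoint H
  isLocal : IsLocal H

/-- The Borel functions `f` with `|f| ≤ 1` that are constant on `(-∞, inf Δ]` and on
`[sup Δ, ∞)`. These two half-lines are the sets of lower and of upper bounds of `Δ`. -/
def borelUnit (Δ : Set ℝ) : Set (ℝ → ℂ) :=
  {f | Measurable f ∧ (∀ t, ‖f t‖ ≤ 1) ∧
    (∀ s ∈ lowerBounds Δ, ∀ t ∈ lowerBounds Δ, f s = f t) ∧
    (∀ s ∈ upperBounds Δ, ∀ t ∈ upperBounds Δ, f s = f t)}

/-- The Hamiltonian `H` is mobility-gapped on `Δ`. -/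
structure IsMobilityGapped (H : BulkSpace N →L[ℂ] BulkSpace N) (Δ : Set ℝ) : Prop where
  isHamiltonian : IsHamiltonian H
  uniformlyWeaklyLocal : IsUniformlyWeaklyLocal (borelCalculus H '' borelUnit Δ)
  finite_multiplicity : ∀ E ∈ Δ, FiniteDimensional ℂ
    (Module.End.eigenspace (H : BulkSpace N →ₗ[ℂ] BulkSpace N) (E : ℂ))

/-- The flux insertion operator `U = exp(i arg(X₁ + i X₂))`. At the origin `Complex.arg 0 = 0`, so
`U` acts there as the identity. -/
def fluxInsertion (N : ℕ) : BulkSpace N →L[ℂ] BulkSpace N :=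
  lp.mapCLM 2
    (fun x : ℤ × ℤ =>
      Complex.exp (Complex.I * (Complex.arg ((x.1 : ℂ) + Complex.I * (x.2 : ℂ)) : ℂ)) •
        ContinuousLinearMap.id ℂ (EuclideanSpace ℂ (Fin N)))
    (K := 1) zero_le_one
    (fun x => by
      rw [norm_smul, mul_comm Complex.I, Complex.norm_exp_ofReal_mul_I, one_mul]
      exact ContinuousLinearMap.norm_id_le)

/-- The operator `P_μ U P_μ + P_μ^⊥`. -/
def bulkOperator (H : BulkSpace N →L[ℂ] BulkSpace N) (μ : ℝ) : BulkSpace N →L[ℂ] BulkSpace N :=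
  fermiProjection H μ ∘L fluxInsertion N ∘L fermiProjection H μ + (1 - fermiProjection H μ)

/-! ### Indices -/

/-- The Fredholm index `dim ker F - dim ker F*`. -/
def fredholmIndex (F : BulkSpace N →L[ℂ] BulkSpace N) : ℤ :=
  (Module.finrank ℂ F.ker : ℤ) - (Module.finrank ℂ (ContinuousLinearMap.adjoint F).ker : ℤ)

/-- The `ℤ₂`-index `dim ker F mod 2`. -/
def fredholmIndexTwo (F : BulkSpace N →L[ℂ] BulkSpace N) : ZMod 2 :=
  (Module.finrank ℂ F.ker : ZMod 2)

/-- A fermionic time-reversal symmetry: an antiunitary `Θ` with `Θ² = -1` that commutes with the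
position operators `X_j` (whenever `ψ` is in the domain of `X_j`, so is `Θ ψ`, and
`X_j Θ ψ = Θ X_j ψ`). -/
structure IsTimeReversal (Θ : BulkSpace N →ₗ⋆[ℂ] BulkSpace N) : Prop where
  inner_map : ∀ ψ φ, ⟪Θ ψ, Θ φ⟫_ℂ = ⟪φ, ψ⟫_ℂ
  sq_eq_neg : ∀ ψ, Θ (Θ ψ) = -ψ
  comm_position_one : ∀ ψ φ : BulkSpace N, (∀ x : ℤ × ℤ, φ x = (x.1 : ℂ) • ψ x) →
    ∀ x : ℤ × ℤ, Θ φ x = (x.1 : ℂ) • Θ ψ x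
  comm_position_two : ∀ ψ φ : BulkSpace N, (∀ x : ℤ × ℤ, φ x = (x.2 : ℂ) • ψ x) →
    ∀ x : ℤ × ℤ, Θ φ x = (x.2 : ℂ) • Θ ψ x

/-- `H` is time-reversal invariant: `[H, Θ] = 0`. -/
def IsTimeReversalInvariant (Θ : BulkSpace N →ₗ⋆[ℂ] BulkSpace N)
    (H : BulkSpace N →L[ℂ] BulkSpace N) : Prop :=
  ∀ ψ, H (Θ ψ) = Θ (H ψ)

/-- `F` is `Θ`-odd: `F = -Θ F* Θ`. -/
def IsThetaOdd (Θ : BulkSpace N →ₗ⋆[ℂ] BulkSpace N) (F : BulkSpace N →L[ℂ] BulkSpace N) : Prop :=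
  ∀ ψ, F ψ = -Θ (ContinuousLinearMap.adjoint F (Θ ψ))

end

end MobilityGap

/-!
The Hilbert space is `ℓ²(ℤ²) ⊗ ℂᴺ`; "compact" below means: norm limit of operators of finite rank
(`IsFiniteRankLimit`), which is all that is needed of compactness.

**Fredholm property.** The phase `U_x` of the flux insertion varies by `O(‖x - y‖ / ‖y‖)`, while
the matrix elements of `f(H)`, `f` in `B₁(Δ)` (`borelUnit Δ`), decay rapidly off the diagonal with a
polynomial loss. Since `f(H)` is also a contraction, a power of the matrix elements of `[f(H), U]`
beats the loss, and the Schur test shows that `[f(H), U]` is small away from a finite set of sites,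
uniformly in `f ∈ B₁(Δ)` (`IsUniformlyWeaklyLocal.exists_commutator_le`). Hence `[P_μ, U]` is
compact and `P_μ U* P_μ + P_μ^⊥` is a parametrix of `F_μ`.

**Constancy of the indices.** For `μ < μ'` in `Δ` let `Q = χ_{(μ,μ')}(H)`. Then `P_μ'` is
`P_μ + Q` up to the finite-rank projection `χ_{μ}(H)`, and as `[P_μ, U]` is compact, `F_μ'` is up to
a compact operator the direct sum of `P_μ U P_μ` on the range of `P_μ`, of `Q U Q` on the range of
`Q`, and of the identity. The range of `Q` may be infinite-dimensional, so the point is that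
`Q U Q` contributes nothing. Let `v` be the Cayley transform of `H` and let `D` be a weak limit point
of the averages of `v^j Q U Q v^{-j}` over `|j| < n`. Then `D` commutes with `H`
(`exists_commuting_mean`). As `t ↦ v(t)^j χ_{(μ,μ')}(t)` lies in `B₁(Δ)`, the *uniform* commutator
bound shows that `Q U Q - D` is compact. So `D` is Fredholm on the range of `Q`, and its kernel and
cokernel are finite-dimensional and `H`-invariant, hence spanned by eigenvectors of `H` with
eigenvalues in `(μ,μ')`. Finite multiplicity puts both in one finite-dimensional space on
which `D` and `D*` act, so that the index of `D` is zero (`finrank_ker_of_commute`). This is the only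
place where the assumption on the eigenvalues is used in full strength.

**The parity.** If `Θ H = H Θ`, then `D` is `Θ`-odd like `U`, and so are all operators involved. An
odd operator of finite rank has even rank, because `⟪Θ ψ, A φ⟫` is an alternating form
(`IsOddPair.even_finrank_range`). Applied on the finite-dimensional space above, this shows that
`ker D` is even-dimensional.

**Stability.** Invariance of the index and, for odd operators, of the parity of the dimension of the
kernel under compact perturbations is obtained by reduction to a finite-rank operator, whose rank
measures the drop of the dimension of the kernel (`exists_finite_rank_reduction`).
-/

namespace MobilityGap

/-! ### Norm limits of finite-rank operators and Fredholm operators -/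

section FiniteRankLimit

variable {E : Type*} [NormedAddCommGroup E] [InnerProductSpace ℂ E]

local postfix:1000 "†" => ContinuousLinearMap.adjoint

/-- `K` is a norm limit of finite-rank operators. On a Hilbert space these are exactly the compact
operators; only the description as a limit is used. -/
def IsFiniteRankLimit (K : E →L[ℂ] E) : Prop :=
  ∀ ε : ℝ, 0 < ε → ∃ R : E →L[ℂ] E, R.toLinearMap.HasFiniteRange ∧ ‖K - R‖ ≤ ε

theorem IsFiniteRankLimit.of_hasFiniteRange {R : E →L[ℂ] E} (hR : R.toLinearMap.HasFiniteRange) :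
    IsFiniteRankLimit R :=
  fun ε hε => ⟨R, hR, by simpa using hε.le⟩

theorem IsFiniteRankLimit.add {K L : E →L[ℂ] E} (hK : IsFiniteRankLimit K)
    (hL : IsFiniteRankLimit L) : IsFiniteRankLimit (K + L) := fun ε hε => by
  obtain ⟨R, hR, hKR⟩ := hK (ε / 2) (by positivity)
  obtain ⟨S, hS, hLS⟩ := hL (ε / 2) (by positivity)
  refine ⟨R + S, hR.add hS, ?_⟩
  rw [add_sub_add_comm]
  exact (norm_add_le _ _).trans (by linarith)

theorem IsFiniteRankLimit.mul_left {K : E →L[ℂ] E} (hK : IsFiniteRankLimit K) (A : E →L[ℂ] E) :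
    IsFiniteRankLimit (A * K) := fun ε hε => by
  obtain ⟨R, hR, hKR⟩ := hK (ε / (‖A‖ + 1)) (by positivity)
  refine ⟨A * R, hR.comp_left A.toLinearMap, ?_⟩
  rw [← mul_sub]
  refine (norm_mul_le _ _).trans ?_
  calc ‖A‖ * ‖K - R‖ ≤ (‖A‖ + 1) * (ε / (‖A‖ + 1)) := by gcongr; linarith
    _ = ε := by field_simp

theorem IsFiniteRankLimit.mul_right {K : E →L[ℂ] E} (hK : IsFiniteRankLimit K) (A : E →L[ℂ] E) :
    IsFiniteRankLimit (K * A) := fun ε hε => by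
  obtain ⟨R, hR, hKR⟩ := hK (ε / (‖A‖ + 1)) (by positivity)
  refine ⟨R * A, hR.comp_right A.toLinearMap, ?_⟩
  rw [← sub_mul]
  refine (norm_mul_le _ _).trans ?_
  calc ‖K - R‖ * ‖A‖ ≤ (ε / (‖A‖ + 1)) * (‖A‖ + 1) := by gcongr; linarith
    _ = ε := by field_simp

theorem IsFiniteRankLimit.smul {K : E →L[ℂ] E} (hK : IsFiniteRankLimit K) (c : ℂ) :
    IsFiniteRankLimit (c • K) := by
  simpa using hK.mul_left (c • (1 : E →L[ℂ] E))

theorem IsFiniteRankLimit.neg {K : E →L[ℂ] E} (hK : IsFiniteRankLimit K) :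
    IsFiniteRankLimit (-K) := by
  simpa using hK.smul (-1)

theorem IsFiniteRankLimit.sub {K L : E →L[ℂ] E} (hK : IsFiniteRankLimit K)
    (hL : IsFiniteRankLimit L) : IsFiniteRankLimit (K - L) := by
  simpa [sub_eq_add_neg] using hK.add hL.neg

theorem exists_parametrix {F : E →L[ℂ] E} (hF : F.IsFredholm) :
    ∃ G : E →L[ℂ] E, (G * F - 1).toLinearMap.HasFiniteRange ∧
      (F * G - 1).toLinearMap.HasFiniteRange := by
  obtain ⟨G, h₁, h₂⟩ := hF.exists_isQuasiInverse
  exact ⟨G, LinearMap.hasNoetherianRange_iff_hasFiniteRange.1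
    (LinearMap.FiniteRangeSetoid.equiv_iff_hasNoetherianRange.1 h₁),
    LinearMap.hasNoetherianRange_iff_hasFiniteRange.1
    (LinearMap.FiniteRangeSetoid.equiv_iff_hasNoetherianRange.1 h₂)⟩

theorem isFredholm_of_mul_eq_one_add {F A B R S : E →L[ℂ] E} (hR : R.toLinearMap.HasFiniteRange)
    (hS : S.toLinearMap.HasFiniteRange) (hA : A * F = 1 + R) (hB : F * B = 1 + S) :
    F.IsFredholm := by
  refine ContinuousLinearMap.IsFredholm.of_isQuasiInverse (v := A) ?_
  -- a left and a right quasi-inverse agree up to finite rank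
  have hAB : A = B + (R * B - A * S) := by
    have h : A * F * B = A * (F * B) := mul_assoc _ _ _
    rw [hA, hB, add_mul, mul_add, one_mul, mul_one] at h
    rw [← add_sub_assoc, h]; abel
  have hFA : F * A = 1 + (S + F * (R * B - A * S)) := by
    conv_lhs => rw [hAB]
    rw [mul_add, hB, add_assoc]
  have hRB : (R * B - A * S).toLinearMap.HasFiniteRange :=
    (hR.comp_right B.toLinearMap).sub (hS.comp_left A.toLinearMap)
  constructor
  · refine LinearMap.FiniteRangeSetoid.equiv_iff_hasNoetherianRange.2 ?_
    have : A.toLinearMap ∘ₗ F.toLinearMap - LinearMap.id = R.toLinearMap := by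
      have := congrArg ContinuousLinearMap.toLinearMap (sub_eq_iff_eq_add'.2 hA)
      exact this
    rw [this]
    exact LinearMap.hasNoetherianRange_iff_hasFiniteRange.2 hR
  · refine LinearMap.FiniteRangeSetoid.equiv_iff_hasNoetherianRange.2 ?_
    have : F.toLinearMap ∘ₗ A.toLinearMap - LinearMap.id =
        (S + F * (R * B - A * S)).toLinearMap := by
      have := congrArg ContinuousLinearMap.toLinearMap (sub_eq_iff_eq_add'.2 hFA)
      exact this
    rw [this]
    exact LinearMap.hasNoetherianRange_iff_hasFiniteRange.2
      (hS.add (hRB.comp_left F.toLinearMap))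

variable [CompleteSpace E]

theorem hasFiniteRange_adjoint {R : E →L[ℂ] E} (hR : R.toLinearMap.HasFiniteRange) :
    (R†).toLinearMap.HasFiniteRange := by
  have hfd : FiniteDimensional ℂ R.range :=
    Submodule.fg_iff_finiteDimensional _ |>.1 (LinearMap.hasFiniteRange_iff_range.1 hR)
  have h : R.range.starProjection * R = R := by
    ext x
    exact Submodule.starProjection_eq_self_iff.2 (LinearMap.mem_range_self _ x)
  have h2 : R† = R† * R.range.starProjection := by
    conv_lhs => rw [← h]
    change star (_ * _) = _
    rw [star_mul, (isSelfAdjoint_starProjection R.range).star_eq]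
    rfl
  rw [h2]
  refine LinearMap.HasFiniteRange.comp_left ?_ _
  refine LinearMap.hasFiniteRange_iff_range.2 ((Submodule.fg_iff_finiteDimensional _).2 ?_)
  rw [Submodule.range_starProjection]
  exact hfd

theorem IsFiniteRankLimit.adjoint {K : E →L[ℂ] E} (hK : IsFiniteRankLimit K) :
    IsFiniteRankLimit (K†) := fun ε hε => by
  obtain ⟨R, hR, hKR⟩ := hK ε hε
  refine ⟨R†, hasFiniteRange_adjoint hR, ?_⟩
  rwa [← map_sub, LinearIsometryEquiv.norm_map]

theorem IsFiniteRankLimit.exists_isUnit {K : E →L[ℂ] E} (hK : IsFiniteRankLimit K) :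
    ∃ (u : (E →L[ℂ] E)ˣ) (R : E →L[ℂ] E), R.toLinearMap.HasFiniteRange ∧ 1 + K = u + R := by
  obtain ⟨R, hR, hKR⟩ := hK (1 / 2) (by norm_num)
  have h : ‖R - K‖ < 1 := by rw [norm_sub_rev]; linarith
  refine ⟨Units.oneSub (R - K) h, R, hR, ?_⟩
  rw [Units.val_oneSub]; abel

/-- Atkinson's criterion: an operator invertible modulo limits of finite-rank operators is
Fredholm. -/
theorem isFredholm_of_parametrix {F G : E →L[ℂ] E} (h₁ : IsFiniteRankLimit (G * F - 1))
    (h₂ : IsFiniteRankLimit (F * G - 1)) : F.IsFredholm := by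
  obtain ⟨u, R, hR, hu⟩ := h₁.exists_isUnit
  obtain ⟨v, S, hS, hv⟩ := h₂.exists_isUnit
  rw [add_sub_cancel] at hu hv
  have hR' : (↑u⁻¹ * R : E →L[ℂ] E).toLinearMap.HasFiniteRange := hR.comp_left _
  have hS' : (S * ↑v⁻¹ : E →L[ℂ] E).toLinearMap.HasFiniteRange := hS.comp_right _
  refine isFredholm_of_mul_eq_one_add (A := ↑u⁻¹ * G) (B := G * ↑v⁻¹) hR' hS' ?_ ?_
  · rw [mul_assoc, hu, mul_add, Units.inv_mul]
  · rw [← mul_assoc, hv, add_mul, Units.mul_inv]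

theorem IsFiniteRankLimit.isFredholm_add {F K : E →L[ℂ] E} (hK : IsFiniteRankLimit K)
    (hF : F.IsFredholm) : (F + K).IsFredholm := by
  obtain ⟨G, h₁, h₂⟩ := exists_parametrix hF
  refine isFredholm_of_parametrix (G := G) ?_ ?_
  · rw [mul_add, add_sub_right_comm]
    exact (IsFiniteRankLimit.of_hasFiniteRange h₁).add (hK.mul_left G)
  · rw [add_mul, add_sub_right_comm]
    exact (IsFiniteRankLimit.of_hasFiniteRange h₂).add (hK.mul_right G)

/-- The Moore–Penrose inverse `G` of a Fredholm operator `F`: it vanishes on the kernel of `F*` and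
its range is orthogonal to the kernel of `F`. -/
theorem exists_pseudoinverse {F : E →L[ℂ] E} (hF : F.IsFredholm) :
    ∃ V W : Submodule ℂ E, ∃ _ : FiniteDimensional ℂ V, ∃ _ : FiniteDimensional ℂ W,
      V = F.ker ∧ W = (F†).ker ∧ ∃ G : E →L[ℂ] E,
      G * F = 1 - V.starProjection ∧ F * G = 1 - W.starProjection ∧
      V.starProjection * G = 0 ∧ G * W.starProjection = 0 := by
  have hV : FiniteDimensional ℂ F.ker := hF.finite_ker
  have hrc : CompleteSpace F.range := hF.isClosed_range.completeSpace_coe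
  have hdom : Submodule.IsTopCompl F.ker F.kerᗮ := Submodule.isTopCompl_orthogonal _
  have hcod : Submodule.IsTopCompl F.range F.rangeᗮ := Submodule.isTopCompl_orthogonal _
  let pkg := hF.fredholmPackage hdom hcod
  have hW' : FiniteDimensional ℂ F.rangeᗮ := pkg.decCodom.finite_X₀
  have hW : FiniteDimensional ℂ (F†).ker := by
    rw [← ContinuousLinearMap.orthogonal_range]; exact hW'
  set G := pkg.quasiInverse with hG
  have hGF : ∀ x ∈ F.kerᗮ, G (F x) = x := by
    intro x hx
    have h1 : F x = pkg.equiv ⟨x, hx⟩ := by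
      conv_lhs => rw [pkg.eq_equiv]
      have : pkg.decDom.proj x = ⟨x, hx⟩ :=
        Submodule.projectionOntoL_apply_left (h := pkg.decDom.isTopCompl) ⟨x, hx⟩
      simp [this]
    have h2 : pkg.decCodom.proj (pkg.equiv ⟨x, hx⟩ : E) = pkg.equiv ⟨x, hx⟩ :=
      Submodule.projectionOntoL_apply_left (h := pkg.decCodom.isTopCompl) _
    rw [h1, hG, ContinuousLinearMap.FredholmPackage.quasiInverse]
    simp [h2]
  have hGW : ∀ x ∈ F.rangeᗮ, G x = 0 := by
    intro x hx
    have h2 : pkg.decCodom.proj x = 0 :=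
      (Submodule.projectionOntoL_apply_eq_zero_iff pkg.decCodom.isTopCompl).2 hx
    rw [hG, ContinuousLinearMap.FredholmPackage.quasiInverse]
    simp [h2]
  have hGV : ∀ x, G x ∈ F.kerᗮ := by
    intro x
    exact (pkg.equiv.symm (pkg.decCodom.proj x)).2
  have hGF' : G * F = 1 - F.ker.starProjection := by
    ext x
    have h0 : F (F.ker.starProjection x) = 0 := Submodule.starProjection_apply_mem F.ker x
    have h1 := hGF _ (Submodule.sub_starProjection_mem_orthogonal (K := F.ker) x)
    rw [map_sub, h0, sub_zero] at h1
    exact h1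
  refine ⟨F.ker, (F†).ker, hV, hW, rfl, rfl, G, hGF', ?_, ?_, ?_⟩
  · ext x
    have h0 : (F†).ker.starProjection x ∈ F.rangeᗮ := by
      rw [ContinuousLinearMap.orthogonal_range]
      exact Submodule.starProjection_apply_mem _ x
    have hr : (F†).kerᗮ = F.range := by
      rw [← ContinuousLinearMap.orthogonal_range, Submodule.orthogonal_orthogonal]
    obtain ⟨y, hy⟩ : x - (F†).ker.starProjection x ∈ F.range :=
      hr ▸ Submodule.sub_starProjection_mem_orthogonal (K := (F†).ker) x
    have h2 : F (G (F y)) = F y := by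
      have h3 : G (F y) = y - F.ker.starProjection y := congrArg (fun T => T y) hGF'
      have h4 : F (F.ker.starProjection y) = 0 := Submodule.starProjection_apply_mem F.ker y
      rw [h3, map_sub, h4, sub_zero]
    have h5 : F y = x - (F†).ker.starProjection x := hy
    rw [h5, map_sub, hGW _ h0, sub_zero] at h2
    exact h2
  · ext x
    exact (Submodule.starProjection_apply_eq_zero_iff _).2 (hGV x)
  · ext x
    refine hGW _ ?_
    rw [ContinuousLinearMap.orthogonal_range]
    exact Submodule.starProjection_apply_mem _ x

end FiniteRankLimit

end MobilityGap

namespace MobilityGap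

/-! ### Quaternionic structures and odd operators -/

section Odd

variable {E : Type*} [NormedAddCommGroup E] [InnerProductSpace ℂ E]

local postfix:1000 "†" => ContinuousLinearMap.adjoint

/-- An antiunitary map with square `-1`. -/
structure IsQuaternionic (Θ : E →ₗ⋆[ℂ] E) : Prop where
  inner_map : ∀ ψ φ, ⟪Θ ψ, Θ φ⟫_ℂ = ⟪φ, ψ⟫_ℂ
  sq_eq_neg : ∀ ψ, Θ (Θ ψ) = -ψ

variable {Θ : E →ₗ⋆[ℂ] E}

theorem IsQuaternionic.norm_map (hΘ : IsQuaternionic Θ) (ψ : E) : ‖Θ ψ‖ = ‖ψ‖ := by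
  have h := hΘ.inner_map ψ ψ
  rw [inner_self_eq_norm_sq_to_K, inner_self_eq_norm_sq_to_K] at h
  have h' : ‖Θ ψ‖ ^ 2 = ‖ψ‖ ^ 2 := by exact_mod_cast h
  exact (pow_left_inj₀ (norm_nonneg _) (norm_nonneg _) two_ne_zero).1 h'

theorem IsQuaternionic.injective (hΘ : IsQuaternionic Θ) : Function.Injective Θ := fun x y h => by
  have := congrArg Θ h
  rwa [hΘ.sq_eq_neg, hΘ.sq_eq_neg, neg_inj] at this

variable [CompleteSpace E]

/-- `A` and `B` are exchanged by the anti-automorphism `T ↦ -Θ T* Θ`, written without inverses as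
`A Θ = Θ B*`. -/
def IsOddPair (Θ : E →ₗ⋆[ℂ] E) (A B : E →L[ℂ] E) : Prop :=
  ∀ ψ, A (Θ ψ) = Θ ((B†) ψ)

namespace IsOddPair

variable {A A' B B' : E →L[ℂ] E}

theorem symm (hΘ : IsQuaternionic Θ) (h : IsOddPair Θ A B) : IsOddPair Θ B A := by
  intro ψ
  refine ext_inner_left ℂ fun φ => ?_
  have h1 := h φ
  calc ⟪φ, B (Θ ψ)⟫_ℂ = ⟪(B†) φ, Θ ψ⟫_ℂ := (ContinuousLinearMap.adjoint_inner_left ..).symm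
    _ = -⟪Θ (Θ ((B†) φ)), Θ ψ⟫_ℂ := by rw [hΘ.sq_eq_neg, inner_neg_left, neg_neg]
    _ = -⟪Θ (A (Θ φ)), Θ ψ⟫_ℂ := by rw [h1]
    _ = -⟪ψ, A (Θ φ)⟫_ℂ := by rw [hΘ.inner_map]
    _ = -⟪(A†) ψ, Θ φ⟫_ℂ := by rw [ContinuousLinearMap.adjoint_inner_left]
    _ = -⟪Θ (Θ φ), Θ ((A†) ψ)⟫_ℂ := by rw [hΘ.inner_map]
    _ = ⟪φ, Θ ((A†) ψ)⟫_ℂ := by rw [hΘ.sq_eq_neg, inner_neg_left, neg_neg]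

theorem mul (h : IsOddPair Θ A B) (h' : IsOddPair Θ A' B') : IsOddPair Θ (A * A') (B' * B) := by
  intro ψ
  have : (B' * B)† = B† * B'† := star_mul B' B
  rw [this]
  change A (A' (Θ ψ)) = Θ ((B†) ((B'†) ψ))
  rw [h' ψ, h]

theorem add (h : IsOddPair Θ A B) (h' : IsOddPair Θ A' B') : IsOddPair Θ (A + A') (B + B') := by
  intro ψ
  simp [h ψ, h' ψ]

theorem smul (h : IsOddPair Θ A B) (c : ℂ) : IsOddPair Θ (c • A) (c • B) := by
  intro ψ
  rw [map_smulₛₗ]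
  simp [h ψ]

theorem one : IsOddPair Θ (1 : E →L[ℂ] E) 1 := by
  intro ψ
  rw [show (1 : E →L[ℂ] E)† = 1 from star_one _]
  rfl

theorem sub (h : IsOddPair Θ A B) (h' : IsOddPair Θ A' B') : IsOddPair Θ (A - A') (B - B') := by
  simpa [sub_eq_add_neg] using h.add (h'.smul (-1))

theorem inv {u v : (E →L[ℂ] E)ˣ} (h : IsOddPair Θ (u : E →L[ℂ] E) v) :
    IsOddPair Θ (↑u⁻¹ : E →L[ℂ] E) ↑v⁻¹ := by
  intro ψ
  have h1 := h (((↑v⁻¹ : E →L[ℂ] E)†) ψ)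
  have h2 : ((v : E →L[ℂ] E)†) (((↑v⁻¹ : E →L[ℂ] E)†) ψ) = ψ := by
    have : star (v : E →L[ℂ] E) * star (↑v⁻¹ : E →L[ℂ] E) = 1 := by
      rw [← star_mul, Units.inv_mul, star_one]
    exact congrArg (fun T => T ψ) this
  rw [h2] at h1
  rw [← h1]
  exact congrArg (fun T : E →L[ℂ] E => T (Θ (((↑v⁻¹ : E →L[ℂ] E)†) ψ))) u.inv_mul

/-- Orthogonal projections onto subspaces exchanged by `Θ`. -/
theorem starProjection (hΘ : IsQuaternionic Θ) {V W : Submodule ℂ E}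
    [V.HasOrthogonalProjection] [W.HasOrthogonalProjection] (h : ∀ x, Θ x ∈ V ↔ x ∈ W) :
    IsOddPair Θ V.starProjection W.starProjection := by
  intro ψ
  have hsa : W.starProjection† = W.starProjection := (isSelfAdjoint_starProjection W).star_eq
  rw [hsa]
  refine Submodule.eq_starProjection_of_mem_orthogonal ((h _).2
    (Submodule.starProjection_apply_mem W ψ)) ?_
  rw [← map_sub, Submodule.mem_orthogonal]
  intro v hv
  have hw : Θ v ∈ W := (h _).1 (by rw [hΘ.sq_eq_neg]; exact V.neg_mem hv)
  have h1 := Submodule.sub_starProjection_mem_orthogonal (K := W) ψ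
  rw [Submodule.mem_orthogonal'] at h1
  rw [← neg_neg v, ← hΘ.sq_eq_neg, hΘ.inner_map]
  exact h1 _ (by rw [map_neg]; exact W.neg_mem hw)

end IsOddPair

/-- An odd operator of finite rank has even rank: `(ψ, φ) ↦ ⟪Θ ψ, X φ⟫` is an alternating bilinear
form whose radical is the kernel of `X`. -/
theorem IsOddPair.even_finrank_range (hΘ : IsQuaternionic Θ) {X : E →L[ℂ] E}
    (hX : IsOddPair Θ X X) (hfin : X.toLinearMap.HasFiniteRange) :
    Even (Module.finrank ℂ X.range) := by
  have hskew : ∀ x y, ⟪Θ x, X y⟫_ℂ = -⟪Θ y, X x⟫_ℂ := by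
    intro x y
    calc ⟪Θ x, X y⟫_ℂ = ⟪(X†) (Θ x), y⟫_ℂ := (ContinuousLinearMap.adjoint_inner_left ..).symm
      _ = ⟪Θ y, Θ ((X†) (Θ x))⟫_ℂ := (hΘ.inner_map ..).symm
      _ = -⟪Θ y, X x⟫_ℂ := by rw [← hX, hΘ.sq_eq_neg, map_neg, inner_neg_right]
  have hfd : FiniteDimensional ℂ X.range :=
    Submodule.fg_iff_finiteDimensional _ |>.1 (LinearMap.hasFiniteRange_iff_range.1 hfin)
  obtain ⟨n, hn⟩ : ∃ n, Module.finrank ℂ X.range = n := ⟨_, rfl⟩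
  let b := Module.finBasisOfFinrankEq ℂ X.range hn
  have hb : ∀ i, ∃ y, X y = b i := fun i => (b i).2
  choose e he using hb
  let A : Matrix (Fin n) (Fin n) ℂ := fun i j => ⟪Θ (e i), X (e j)⟫_ℂ
  have hA : A.transpose = -A := by
    ext i j
    exact hskew _ _
  rw [hn]
  by_contra hodd
  rw [Nat.not_even_iff_odd] at hodd
  have hdet : A.det = 0 := by
    have h1 := congrArg Matrix.det hA
    rw [Matrix.det_transpose, Matrix.det_neg, Fintype.card_fin, hodd.neg_one_pow] at h1
    linear_combination h1 / 2
  obtain ⟨v, hv0, hv⟩ := Matrix.exists_mulVec_eq_zero_iff.2 hdet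
  set φ : E := ∑ j, v j • e j with hφ
  have hz : ∀ i, ⟪Θ (e i), X φ⟫_ℂ = 0 := by
    intro i
    have := congrFun hv i
    rw [hφ, map_sum, inner_sum]
    simpa [Matrix.mulVec, dotProduct, A, inner_smul_right, mul_comm] using this
  -- hence `Θ φ` is orthogonal to the range of `X`
  have hXφ : X φ = 0 := by
    have h1 : ∀ y, ⟪Θ φ, X y⟫_ℂ = 0 := by
      intro y
      have hy : X y = X (∑ j, b.repr ⟨X y, LinearMap.mem_range_self _ y⟩ j • e j) := by
        have := congrArg Subtype.val (b.sum_repr ⟨X y, LinearMap.mem_range_self _ y⟩)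
        rw [map_sum]
        simp only [map_smul, he]
        exact this.symm.trans (AddSubmonoidClass.coe_finsetSum _ _)
      rw [hy, hskew, map_sum, sum_inner]
      simp [inner_smul_left, hz]
    have h2 : ⟪X φ, X φ⟫_ℂ = 0 := by
      have h3 := h1 (Θ (X φ))
      rw [hskew, hΘ.sq_eq_neg, inner_neg_left, neg_neg] at h3
      exact h3
    exact inner_self_eq_zero.1 h2
  have hlin : ∑ j, v j • b j = 0 := by
    apply Subtype.ext
    simpa [hφ, he] using hXφ
  exact hv0 (funext fun j => Fintype.linearIndependent_iff.1 b.linearIndependent v hlin j)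

end Odd

end MobilityGap

namespace MobilityGap

/-! ### Stability of the index and of the parity of the kernel -/

section Stability

variable {E : Type*} [NormedAddCommGroup E] [InnerProductSpace ℂ E]

local postfix:1000 "†" => ContinuousLinearMap.adjoint

/-- If `π_V + G S` is invertible, then the kernel of `S` is the image under the
inverse of the kernel of `X = S (π_V + G S)⁻¹ π_V` in `V`. -/
theorem finrank_ker_add_finrank_range {S G : E →L[ℂ] E} (V : Submodule ℂ E)
    [FiniteDimensional ℂ V] (u : (E →L[ℂ] E)ˣ)
    (hu : (u : E →L[ℂ] E) = V.starProjection + G * S) :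
    Module.finrank ℂ S.ker + Module.finrank ℂ (S * ↑u⁻¹ * V.starProjection).range
      = Module.finrank ℂ V := by
  set B : E →L[ℂ] E := ↑u⁻¹ with hB
  have hBu : B * u = 1 := u.inv_mul
  have huB : (u : E →L[ℂ] E) * B = 1 := u.mul_inv
  let T : V →ₗ[ℂ] E := (S * B).toLinearMap ∘ₗ V.subtype
  have hrange : (S * B * V.starProjection).range = LinearMap.range T := by
    apply le_antisymm
    · rintro _ ⟨x, rfl⟩
      exact ⟨⟨V.starProjection x, Submodule.starProjection_apply_mem _ _⟩, rfl⟩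
    · rintro _ ⟨x, rfl⟩
      refine ⟨x, ?_⟩
      change S (B (V.starProjection x)) = S (B x)
      rw [Submodule.starProjection_eq_self_iff.2 x.2]
  let R : LinearMap.ker T →ₗ[ℂ] E := B.toLinearMap ∘ₗ V.subtype ∘ₗ (LinearMap.ker T).subtype
  have hR : Function.Injective R := by
    intro x y hxy
    have h1 := congrArg (u : E →L[ℂ] E) hxy
    have h2 : ∀ z : E, (u : E →L[ℂ] E) (B z) = z := fun z => congrArg (fun T => T z) huB
    apply Subtype.ext
    apply Subtype.ext
    have h3 : (u : E →L[ℂ] E) (B x) = (u : E →L[ℂ] E) (B y) := h1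
    rwa [h2, h2] at h3
  have hker : S.ker = LinearMap.range R := by
    apply le_antisymm
    · intro x hx
      have hx : S x = 0 := hx
      have h1 : B (V.starProjection x) = x := by
        have h2 : (u : E →L[ℂ] E) x = V.starProjection x := by
          rw [hu]
          change V.starProjection x + G (S x) = _
          rw [hx, map_zero, add_zero]
        rw [← h2]
        exact congrArg (fun T => T x) hBu
      refine ⟨⟨⟨V.starProjection x, Submodule.starProjection_apply_mem _ _⟩, ?_⟩, h1⟩
      change S (B (V.starProjection x)) = 0
      rw [h1, hx]
    · rintro _ ⟨x, rfl⟩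
      exact x.2
  rw [hrange, hker, LinearMap.finrank_range_of_inj hR, add_comm]
  exact LinearMap.finrank_range_add_finrank_ker T

variable [CompleteSpace E]

theorem finrank_range_adjoint (X : E →L[ℂ] E) (hX : X.toLinearMap.HasFiniteRange) :
    Module.finrank ℂ (X†).range = Module.finrank ℂ X.range := by
  have key : ∀ Y : E →L[ℂ] E, Y.toLinearMap.HasFiniteRange →
      Module.finrank ℂ (Y†).range ≤ Module.finrank ℂ Y.range := by
    intro Y hY
    have hfd : FiniteDimensional ℂ Y.range :=
      Submodule.fg_iff_finiteDimensional _ |>.1 (LinearMap.hasFiniteRange_iff_range.1 hY)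
    have h : (Y†).range ≤ Y.range.map (Y†).toLinearMap := by
      rintro _ ⟨x, rfl⟩
      refine ⟨Y.range.starProjection x, Submodule.starProjection_apply_mem _ _, ?_⟩
      have h1 : x - Y.range.starProjection x ∈ (Y†).ker := by
        rw [← ContinuousLinearMap.orthogonal_range]
        exact Submodule.sub_starProjection_mem_orthogonal x
      have h2 : (Y†) (x - Y.range.starProjection x) = 0 := h1
      rw [map_sub, sub_eq_zero] at h2
      exact h2.symm
    exact (Submodule.finrank_mono h).trans (Submodule.finrank_map_le _ _)
  refine le_antisymm (key X hX) ?_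
  have h := key (X†) (hasFiniteRange_adjoint hX)
  rwa [ContinuousLinearMap.adjoint_adjoint] at h

theorem finrank_ker_adjoint_add_finrank_range {S G : E →L[ℂ] E} (W : Submodule ℂ E)
    [FiniteDimensional ℂ W] (v : (E →L[ℂ] E)ˣ)
    (hv : (v : E →L[ℂ] E) = W.starProjection + S * G) :
    Module.finrank ℂ (S†).ker +
      Module.finrank ℂ ((W.starProjection * ((↑v⁻¹ : E →L[ℂ] E) * S))†).range
      = Module.finrank ℂ W := by
  have hv' : (star v : (E →L[ℂ] E)ˣ) = W.starProjection + star G * star S := by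
    rw [Units.coe_star, hv, star_add, star_mul, (isSelfAdjoint_starProjection W).star_eq]
  have h := finrank_ker_add_finrank_range W (star v) hv'
  rw [← ContinuousLinearMap.star_eq_adjoint, ← ContinuousLinearMap.star_eq_adjoint, star_mul,
    star_mul, (isSelfAdjoint_starProjection W).star_eq]
  exact h

/-- The operator of the reduction below, computed from the kernel (left) and from the cokernel
(right). -/
theorem mul_inv_mul_eq_mul_inv_mul {R : Type*} [Ring R] {S G p q : R} {u v : Rˣ}
    (hpG : p * G = 0) (hGq : G * q = 0) (hu : (u : R) = p + G * S) (hv : (v : R) = q + S * G) :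
    S * ↑u⁻¹ * p = q * (↑v⁻¹ * S) := by
  have h1 : G * v = u * G := by
    rw [hu, hv, mul_add, add_mul, hGq, hpG, mul_assoc]
  have h2 : ↑u⁻¹ * G = G * ↑v⁻¹ := by
    rw [Units.inv_mul_eq_iff_eq_mul, ← mul_assoc, ← h1, mul_assoc, Units.mul_inv, mul_one]
  have h3 : S * G * ↑v⁻¹ = 1 - q * ↑v⁻¹ := by
    rw [eq_sub_iff_add_eq, ← add_mul, add_comm, ← hv, Units.mul_inv]
  have h4 : S = S * ↑u⁻¹ * p + S * (↑u⁻¹ * G) * S := by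
    conv_lhs => rw [← mul_one S, ← Units.inv_mul u, hu]
    noncomm_ring
  have h5 : S * (↑u⁻¹ * G) * S = S - q * (↑v⁻¹ * S) := by
    rw [h2, ← mul_assoc, h3, sub_mul, one_mul, mul_assoc]
  rw [h5] at h4
  have h6 : S * ↑u⁻¹ * p - q * (↑v⁻¹ * S) = 0 := by
    rw [← sub_eq_zero] at h4
    rw [← neg_eq_zero, ← h4]; abel
  exact sub_eq_zero.1 h6

/-- The Moore–Penrose inverse of an odd operator is odd. -/
theorem isOddPair_pseudoinverse {Θ : E →ₗ⋆[ℂ] E} (hΘ : IsQuaternionic Θ) {F G : E →L[ℂ] E}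
    (hFo : IsOddPair Θ F F) {V W : Submodule ℂ E} [FiniteDimensional ℂ V] [FiniteDimensional ℂ W]
    (hVF : V = F.ker) (hGF : G * F = 1 - V.starProjection) (hFG : F * G = 1 - W.starProjection)
    (hVG : V.starProjection * G = 0) (hGW : G * W.starProjection = 0)
    (hπ : IsOddPair Θ V.starProjection W.starProjection) : IsOddPair Θ G G := by
  intro x
  have h1 : F (G (Θ x) - Θ ((G†) x)) = 0 := by
    have e1 : F (G (Θ x)) = Θ x - W.starProjection (Θ x) := congrArg (fun T => T (Θ x)) hFG
    have e2 : (F†) ((G†) x) = x - V.starProjection x := by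
      have := congrArg star hGF
      rw [star_mul, star_sub, star_one, (isSelfAdjoint_starProjection V).star_eq] at this
      exact congrArg (fun T => T x) this
    have e3 := hπ.symm hΘ x
    rw [show V.starProjection† = V.starProjection from
      (isSelfAdjoint_starProjection V).star_eq] at e3
    rw [map_sub, e1, hFo, e2, map_sub, e3, sub_self]
  have h2 : V.starProjection (G (Θ x) - Θ ((G†) x)) = 0 := by
    have e1 : V.starProjection (G (Θ x)) = 0 := congrArg (fun T => T (Θ x)) hVG
    have e2 : W.starProjection ((G†) x) = 0 := by
      have := congrArg star hGW
      rw [star_mul, star_zero, (isSelfAdjoint_starProjection W).star_eq] at this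
      exact congrArg (fun T => T x) this
    rw [map_sub, e1, hπ, show W.starProjection† = W.starProjection from
      (isSelfAdjoint_starProjection W).star_eq, e2, map_zero, sub_zero]
  have h3 : G (Θ x) - Θ ((G†) x) ∈ V := by rw [hVF]; exact h1
  rw [Submodule.starProjection_eq_self_iff.2 h3] at h2
  exact sub_eq_zero.1 h2

/-- Lyapunov–Schmidt reduction: the kernels of all operators `S` near a Fredholm operator `F` and
of their adjoints are governed by one finite-rank operator `X`, which inherits oddness. -/
theorem exists_finite_rank_reduction {F : E →L[ℂ] E} (hF : F.IsFredholm) :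
    ∃ ε : ℝ, 0 < ε ∧ ∀ S : E →L[ℂ] E, ‖S - F‖ < ε → ∃ X : E →L[ℂ] E,
      X.toLinearMap.HasFiniteRange ∧
      Module.finrank ℂ S.ker + Module.finrank ℂ X.range = Module.finrank ℂ F.ker ∧
      Module.finrank ℂ (S†).ker + Module.finrank ℂ X.range = Module.finrank ℂ (F†).ker ∧
      ∀ Θ : E →ₗ⋆[ℂ] E, IsQuaternionic Θ → IsOddPair Θ F F → IsOddPair Θ S S →
        IsOddPair Θ X X := by
  obtain ⟨V, W, hV, hW, hVF, hWF, G, hGF, hFG, hVG, hGW⟩ := exists_pseudoinverse hF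
  refine ⟨1 / (‖G‖ + 1), by positivity, fun S hS => ?_⟩
  have hsmall : ‖G‖ * ‖S - F‖ < 1 := by
    rw [lt_div_iff₀ (by positivity)] at hS
    nlinarith [norm_nonneg (S - F)]
  obtain ⟨u, hu⟩ : ∃ u : (E →L[ℂ] E)ˣ, (u : E →L[ℂ] E) = V.starProjection + G * S := by
    refine ⟨Units.oneSub (G * (F - S))
      ((norm_mul_le _ _).trans_lt (by rwa [norm_sub_rev])), ?_⟩
    rw [Units.val_oneSub, mul_sub, hGF]; abel
  obtain ⟨v, hv⟩ : ∃ v : (E →L[ℂ] E)ˣ, (v : E →L[ℂ] E) = W.starProjection + S * G := by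
    refine ⟨Units.oneSub ((F - S) * G)
      ((norm_mul_le _ _).trans_lt (by rwa [norm_sub_rev, mul_comm])), ?_⟩
    rw [Units.val_oneSub, sub_mul, hFG]; abel
  have hfinV : V.starProjection.toLinearMap.HasFiniteRange := by
    refine LinearMap.hasFiniteRange_iff_range.2 ((Submodule.fg_iff_finiteDimensional _).2 ?_)
    rw [Submodule.range_starProjection]
    exact hV
  have hsym : S * ↑u⁻¹ * V.starProjection = W.starProjection * (↑v⁻¹ * S) :=
    mul_inv_mul_eq_mul_inv_mul hVG hGW hu hv
  have hXfin : (S * ↑u⁻¹ * V.starProjection).toLinearMap.HasFiniteRange :=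
    hfinV.comp_left (S * ↑u⁻¹).toLinearMap
  refine ⟨S * ↑u⁻¹ * V.starProjection, hXfin, ?_, ?_, ?_⟩
  · rw [finrank_ker_add_finrank_range V u hu, hVF]
  · have h := finrank_ker_adjoint_add_finrank_range W v hv
    rwa [← hsym, finrank_range_adjoint _ hXfin, hWF] at h
  · intro Θ hΘ hFo hSo
    have hVW : ∀ x, Θ x ∈ V ↔ x ∈ W := by
      intro x
      rw [hVF, hWF]
      change F (Θ x) = 0 ↔ (F†) x = 0
      rw [hFo, map_eq_zero_iff Θ hΘ.injective]
    have hπ : IsOddPair Θ V.starProjection W.starProjection := .starProjection hΘ hVW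
    have hGo : IsOddPair Θ G G := isOddPair_pseudoinverse hΘ hFo hVF hGF hFG hVG hGW hπ
    have huv : IsOddPair Θ (u : E →L[ℂ] E) (v : E →L[ℂ] E) := by
      rw [hu, hv]
      exact hπ.add (hGo.mul hSo)
    have := (hSo.mul huv.inv).mul hπ
    rwa [← hsym] at this

/-- A function of Fredholm operators that is locally constant takes the same value at `F` and at
`F + K`, since `F + t K` is a path of Fredholm operators. -/
theorem IsFiniteRankLimit.apply_add_eq {F K : E →L[ℂ] E} (hK : IsFiniteRankLimit K)
    (hF : F.IsFredholm) {α : Type*} (g : (E →L[ℂ] E) → α) (p : (E →L[ℂ] E) → Prop)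
    (hp : ∀ c : ℂ, p (F + c • K))
    (hg : ∀ T : E →L[ℂ] E, T.IsFredholm → p T → ∃ ε : ℝ, 0 < ε ∧
      ∀ S : E →L[ℂ] E, p S → ‖S - T‖ < ε → g S = g T) :
    g (F + K) = g F := by
  let f : ℝ → α := fun t => g (F + (t : ℂ) • K)
  have hf : IsLocallyConstant f := by
    rw [IsLocallyConstant.iff_eventually_eq]
    intro t
    obtain ⟨ε, hε, h⟩ := hg _ ((hK.smul (t : ℂ)).isFredholm_add hF) (hp _)
    have hc : Continuous fun s : ℝ => ‖F + (s : ℂ) • K - (F + (t : ℂ) • K)‖ := by fun_prop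
    have : ∀ᶠ s : ℝ in 𝓝 t, ‖F + (s : ℂ) • K - (F + (t : ℂ) • K)‖ < ε :=
      hc.continuousAt.eventually_lt continuousAt_const (by simpa using hε)
    filter_upwards [this] with s hs
    exact h _ (hp _) hs
  have := hf.apply_eq_of_isPreconnected isPreconnected_univ (Set.mem_univ 1) (Set.mem_univ 0)
  simpa [f] using this

theorem IsFiniteRankLimit.index_add {F K : E →L[ℂ] E} (hK : IsFiniteRankLimit K)
    (hF : F.IsFredholm) :
    (Module.finrank ℂ (F + K).ker : ℤ) - Module.finrank ℂ ((F + K)†).ker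
      = Module.finrank ℂ F.ker - Module.finrank ℂ (F†).ker := by
  refine hK.apply_add_eq hF
    (fun T => (Module.finrank ℂ T.ker : ℤ) - Module.finrank ℂ (T†).ker) (fun _ => True)
    (fun _ => trivial) fun T hT _ => ?_
  obtain ⟨ε, hε, h⟩ := exists_finite_rank_reduction hT
  refine ⟨ε, hε, fun S _ hS => ?_⟩
  obtain ⟨X, -, h1, h2, -⟩ := h _ hS
  omega

/-- The dimension of the kernel drops by the rank of an odd operator, which is even. -/
theorem IsFiniteRankLimit.parity_add {Θ : E →ₗ⋆[ℂ] E} (hΘ : IsQuaternionic Θ)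
    {F K : E →L[ℂ] E} (hK : IsFiniteRankLimit K)
    (hF : F.IsFredholm) (hFo : IsOddPair Θ F F) (hKo : IsOddPair Θ K K) :
    (Module.finrank ℂ (F + K).ker : ZMod 2) = Module.finrank ℂ F.ker := by
  refine hK.apply_add_eq hF (fun T => (Module.finrank ℂ T.ker : ZMod 2))
    (fun T => IsOddPair Θ T T) (fun c => hFo.add (hKo.smul c)) fun T hT hTo => ?_
  obtain ⟨ε, hε, h⟩ := exists_finite_rank_reduction hT
  refine ⟨ε, hε, fun S hSo hS => ?_⟩
  obtain ⟨X, hX, h1, -, h3⟩ := h _ hS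
  have hev := (h3 Θ hΘ hTo hSo).even_finrank_range hΘ hX
  rw [← h1, Nat.cast_add, (ZMod.natCast_eq_zero_iff_even).2 hev, add_zero]

end Stability

end MobilityGap

namespace MobilityGap

/-! ### Algebra of the Borel functional calculus -/

section BorelAlgebra

variable {E : Type*} [NormedAddCommGroup E] [InnerProductSpace ℂ E] [CompleteSpace E]

local postfix:1000 "†" => ContinuousLinearMap.adjoint

/-- Bounded Borel functions on the line. -/
structure IsBddBorel (f : ℝ → ℂ) : Prop where
  measurable : Measurable f
  bdd : ∃ C, ∀ t, ‖f t‖ ≤ C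

namespace IsBddBorel

variable {f g : ℝ → ℂ}

theorem integrable (hf : IsBddBorel f) (μ : Measure ℝ) [IsFiniteMeasure μ] : Integrable f μ := by
  obtain ⟨C, hC⟩ := hf.bdd
  exact Integrable.of_bound hf.measurable.aestronglyMeasurable C (Eventually.of_forall hC)

theorem add (hf : IsBddBorel f) (hg : IsBddBorel g) : IsBddBorel (f + g) := by
  obtain ⟨C, hC⟩ := hf.bdd
  obtain ⟨D, hD⟩ := hg.bdd
  exact ⟨hf.measurable.add hg.measurable, C + D, fun t =>
    (norm_add_le _ _).trans (add_le_add (hC t) (hD t))⟩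

theorem mul (hf : IsBddBorel f) (hg : IsBddBorel g) : IsBddBorel (f * g) := by
  obtain ⟨C, hC⟩ := hf.bdd
  obtain ⟨D, hD⟩ := hg.bdd
  exact ⟨hf.measurable.mul hg.measurable, C * D, fun t => by
    rw [Pi.mul_apply, norm_mul]
    exact mul_le_mul (hC t) (hD t) (norm_nonneg _) ((norm_nonneg _).trans (hC t))⟩

theorem const (c : ℂ) : IsBddBorel fun _ => c := ⟨measurable_const, ‖c‖, fun _ => le_rfl⟩

theorem one : IsBddBorel 1 := const 1

theorem smul (hf : IsBddBorel f) (c : ℂ) : IsBddBorel (c • f) := (const c).mul hf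

theorem neg (hf : IsBddBorel f) : IsBddBorel (-f) := by simpa using hf.smul (-1)

theorem sub (hf : IsBddBorel f) (hg : IsBddBorel g) : IsBddBorel (f - g) := by
  simpa [sub_eq_add_neg] using hf.add hg.neg

theorem star (hf : IsBddBorel f) : IsBddBorel (star f) := by
  obtain ⟨C, hC⟩ := hf.bdd
  exact ⟨Complex.continuous_conj.measurable.comp hf.measurable, C, fun t => by
    simpa using hC t⟩

theorem indicator_one {s : Set ℝ} (hs : MeasurableSet s) : IsBddBorel (s.indicator 1) :=
  ⟨measurable_one.indicator hs, 1, fun t => by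
    by_cases h : t ∈ s <;> simp [h]⟩

theorem of_hasCompactSupport (hg : Continuous g) (hc : HasCompactSupport g) : IsBddBorel g :=
  ⟨hg.measurable, hg.bounded_above_of_compact_support hc⟩

end IsBddBorel

variable {H : E →L[ℂ] E} {f g : ℝ → ℂ}

theorem inner_borelCalculus_self (hf : IsBddBorel f) (ψ : E) :
    ⟪ψ, borelCalculus H f ψ⟫_ℂ = ∫ t, f t ∂(spectralMeasure H ψ) := by
  obtain ⟨C, hC⟩ := hf.bdd
  exact inner_borelCalculus H hf.measurable hC ψ

theorem borelCalculus_eq_of_inner (hf : IsBddBorel f) {T : E →L[ℂ] E}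
    (hT : ∀ ψ, ⟪ψ, T ψ⟫_ℂ = ∫ t, f t ∂(spectralMeasure H ψ)) : borelCalculus H f = T := by
  obtain ⟨C, hC⟩ := hf.bdd
  exact (existsUnique_borelCalculus H hf.measurable hC).unique
    (inner_borelCalculus_self hf) hT

theorem borelCalculus_add (hf : IsBddBorel f) (hg : IsBddBorel g) :
    borelCalculus H (f + g) = borelCalculus H f + borelCalculus H g :=
  borelCalculus_eq_of_inner (hf.add hg) fun ψ => by
    rw [add_apply, inner_add_right, inner_borelCalculus_self hf,
      inner_borelCalculus_self hg, ← integral_add (hf.integrable _) (hg.integrable _)]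
    rfl

theorem borelCalculus_smul (hf : IsBddBorel f) (c : ℂ) :
    borelCalculus H (c • f) = c • borelCalculus H f :=
  borelCalculus_eq_of_inner (hf.smul c) fun ψ => by
    rw [smul_apply, inner_smul_right, inner_borelCalculus_self hf, ← integral_const_mul]
    rfl

theorem borelCalculus_sub (hf : IsBddBorel f) (hg : IsBddBorel g) :
    borelCalculus H (f - g) = borelCalculus H f - borelCalculus H g := by
  have h := borelCalculus_add (H := H) hf (hg.smul (-1))
  rw [borelCalculus_smul hg, neg_one_smul, neg_one_smul, ← sub_eq_add_neg, ← sub_eq_add_neg] at h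
  exact h

theorem borelCalculus_star (hf : IsBddBorel f) :
    borelCalculus H (star f) = star (borelCalculus H f) :=
  borelCalculus_eq_of_inner hf.star fun ψ => by
    rw [ContinuousLinearMap.star_eq_adjoint, ContinuousLinearMap.adjoint_inner_right,
      ← inner_conj_symm, inner_borelCalculus_self hf, ← integral_conj]
    rfl

/-- The sum of the spectral measures at the four vectors of the polarization identity for
`⟪x, · y⟫`. -/
noncomputable def polarMeasure (H : E →L[ℂ] E) (x y : E) : Measure ℝ :=
  spectralMeasure H (x + y) + spectralMeasure H (x - y) +
    spectralMeasure H (x + Complex.I • y) + spectralMeasure H (x - Complex.I • y)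

instance (x y : E) : IsFiniteMeasure (polarMeasure H x y) := by
  unfold polarMeasure; infer_instance

/-- A bound by polarization; the factor `1/4` is dropped. -/
theorem norm_inner_borelCalculus_le (hf : IsBddBorel f) (x y : E) :
    ‖⟪x, borelCalculus H f y⟫_ℂ‖ ≤ ∫ t, ‖f t‖ ∂(polarMeasure H x y) := by
  set T := borelCalculus H f with hT
  have hpol : 4 * ⟪x, T y⟫_ℂ = ⟪x + y, T (x + y)⟫_ℂ - ⟪x - y, T (x - y)⟫_ℂ
      - Complex.I * ⟪x + Complex.I • y, T (x + Complex.I • y)⟫_ℂ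
      + Complex.I * ⟪x - Complex.I • y, T (x - Complex.I • y)⟫_ℂ := by
    simp only [map_add, map_sub, map_smul, inner_add_left, inner_add_right, inner_sub_left,
      inner_sub_right, inner_smul_left, inner_smul_right, Complex.conj_I]
    ring_nf
    simp only [Complex.I_sq]
    ring
  have hq : ∀ ψ, ‖⟪ψ, T ψ⟫_ℂ‖ ≤ ∫ t, ‖f t‖ ∂(spectralMeasure H ψ) := fun ψ => by
    rw [hT, inner_borelCalculus_self hf]
    exact norm_integral_le_integral_norm _
  have hsum : ∫ t, ‖f t‖ ∂(polarMeasure H x y) =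
      ∫ t, ‖f t‖ ∂(spectralMeasure H (x + y)) + ∫ t, ‖f t‖ ∂(spectralMeasure H (x - y)) +
      ∫ t, ‖f t‖ ∂(spectralMeasure H (x + Complex.I • y)) +
      ∫ t, ‖f t‖ ∂(spectralMeasure H (x - Complex.I • y)) := by
    unfold polarMeasure
    rw [integral_add_measure, integral_add_measure, integral_add_measure]
    all_goals exact (hf.integrable _).norm
  have h4 : 4 * ‖⟪x, T y⟫_ℂ‖ ≤ ∫ t, ‖f t‖ ∂(polarMeasure H x y) := by
    calc 4 * ‖⟪x, T y⟫_ℂ‖ = ‖4 * ⟪x, T y⟫_ℂ‖ := by simp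
      _ ≤ _ := by
        rw [hpol, hsum]
        refine (norm_add_le _ _).trans (add_le_add ?_ ?_)
        · refine (norm_sub_le _ _).trans (add_le_add ((norm_sub_le _ _).trans
            (add_le_add (hq _) (hq _))) ?_)
          simpa using hq (x + Complex.I • y)
        · simpa using hq (x - Complex.I • y)
  linarith [norm_nonneg ⟪x, T y⟫_ℂ]

theorem exists_continuous_approx (hf : IsBddBorel f) (μ : Measure ℝ) [IsFiniteMeasure μ]
    {ε : ℝ} (hε : 0 < ε) : ∃ g : ℝ → ℂ, Continuous g ∧ HasCompactSupport g ∧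
      ∫ t, ‖(f - g) t‖ ∂μ ≤ ε := by
  obtain ⟨g, hg1, hg2, hg3, -⟩ :=
    (hf.integrable μ).exists_hasCompactSupport_integral_sub_le hε
  exact ⟨g, hg3, hg1, hg2⟩

theorem borelCalculus_eq_cfc (hg : Continuous g) (hc : HasCompactSupport g) :
    borelCalculus H g = cfc (fun t => (g t).re) H + Complex.I • cfc (fun t => (g t).im) H := by
  refine borelCalculus_eq_of_inner (.of_hasCompactSupport hg hc) fun ψ => ?_
  let gr : C_c(ℝ, ℝ) := ⟨⟨fun t => (g t).re, Complex.continuous_re.comp hg⟩,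
    hc.comp_left (g := Complex.re) rfl⟩
  let gi : C_c(ℝ, ℝ) := ⟨⟨fun t => (g t).im, Complex.continuous_im.comp hg⟩,
    hc.comp_left (g := Complex.im) rfl⟩
  have h1 := integral_spectralMeasure H ψ gr
  have h2 := integral_spectralMeasure H ψ gi
  have h1' : ⟪ψ, cfc (fun t => (g t).re) H ψ⟫_ℂ =
    ((∫ t, (g t).re ∂(spectralMeasure H ψ) : ℝ) : ℂ) := h1.symm
  have h2' : ⟪ψ, cfc (fun t => (g t).im) H ψ⟫_ℂ =
    ((∫ t, (g t).im ∂(spectralMeasure H ψ) : ℝ) : ℂ) := h2.symm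
  rw [add_apply, inner_add_right, smul_apply, inner_smul_right, h1', h2',
    ← integral_re_add_im ((IsBddBorel.of_hasCompactSupport hg hc).integrable _), mul_comm]
  rfl

theorem borelCalculus_mul_of_continuous (hf : Continuous f) (hfc : HasCompactSupport f)
    (hg : Continuous g) (hgc : HasCompactSupport g) :
    borelCalculus H (f * g) = borelCalculus H f * borelCalculus H g := by
  rw [borelCalculus_eq_cfc (hf.mul hg) hfc.mul_right, borelCalculus_eq_cfc hf hfc,
    borelCalculus_eq_cfc hg hgc]
  have hr : cfc (fun t => ((f * g) t).re) H =
      cfc (fun t => (f t).re) H * cfc (fun t => (g t).re) H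
        - cfc (fun t => (f t).im) H * cfc (fun t => (g t).im) H := by
    rw [← cfc_mul .., ← cfc_mul .., ← cfc_sub ..]
    rfl
  have hi : cfc (fun t => ((f * g) t).im) H =
      cfc (fun t => (f t).re) H * cfc (fun t => (g t).im) H
        + cfc (fun t => (f t).im) H * cfc (fun t => (g t).re) H := by
    rw [← cfc_mul .., ← cfc_mul .., ← cfc_add ..]
    rfl
  rw [hr, hi, add_mul, mul_add, mul_add, smul_mul_smul_comm, Complex.I_mul_I, smul_mul_assoc,
    mul_smul_comm, smul_add, neg_one_smul]
  abel

/-- Multiplicativity extends from continuous compactly supported second factors to all bounded Borel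
ones, by approximation in `L¹` of finitely many spectral measures. -/
theorem borelCalculus_mul_of_approx (hf : IsBddBorel f) (hg : IsBddBorel g)
    (h : ∀ k : ℝ → ℂ, Continuous k → HasCompactSupport k →
      borelCalculus H (f * k) = borelCalculus H f * borelCalculus H k) :
    borelCalculus H (f * g) = borelCalculus H f * borelCalculus H g := by
  obtain ⟨C, hC⟩ := hf.bdd
  have hC0 : 0 ≤ C := (norm_nonneg _).trans (hC 0)
  refine ContinuousLinearMap.ext fun y => ext_inner_left ℂ fun x => ?_
  rw [← sub_eq_zero, ← norm_le_zero_iff]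
  refine le_of_forall_pos_le_add fun ε hε => ?_
  set μ := polarMeasure H x y + polarMeasure H (((borelCalculus H f)†) x) y with hμ
  obtain ⟨k, hk, hkc, hkμ⟩ := exists_continuous_approx hg μ (ε := ε / (C + 1)) (by positivity)
  have hkb := IsBddBorel.of_hasCompactSupport hk hkc
  have hgk := hg.sub hkb
  have e1 : borelCalculus H (f * g) = borelCalculus H (f * (g - k)) + borelCalculus H (f * k) := by
    rw [← borelCalculus_add (hf.mul hgk) (hf.mul hkb), ← mul_add, sub_add_cancel]
  have e2 : borelCalculus H g = borelCalculus H (g - k) + borelCalculus H k := by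
    rw [← borelCalculus_add hgk hkb, sub_add_cancel]
  have e3 : ⟪x, borelCalculus H (f * g) y⟫_ℂ - ⟪x, (borelCalculus H f * borelCalculus H g) y⟫_ℂ =
      ⟪x, borelCalculus H (f * (g - k)) y⟫_ℂ -
        ⟪((borelCalculus H f)†) x, borelCalculus H (g - k) y⟫_ℂ := by
    rw [e1, e2, h k hk hkc, mul_add, add_apply, add_apply, inner_add_right, inner_add_right,
      ContinuousLinearMap.adjoint_inner_left]
    have e4 : ∀ T : E →L[ℂ] E, (borelCalculus H f * T) y = borelCalculus H f (T y) := fun _ => rfl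
    rw [e4, e4]
    ring
  have hi1 : Integrable (fun t => ‖(g - k) t‖) (polarMeasure H x y) := (hgk.integrable _).norm
  have hi2 : Integrable (fun t => ‖(g - k) t‖) (polarMeasure H (((borelCalculus H f)†) x) y) :=
    (hgk.integrable _).norm
  rw [e3, zero_add]
  calc _ ≤ ∫ t, ‖(f * (g - k)) t‖ ∂(polarMeasure H x y) +
        ∫ t, ‖(g - k) t‖ ∂(polarMeasure H (((borelCalculus H f)†) x) y) :=
      (norm_sub_le _ _).trans (add_le_add (norm_inner_borelCalculus_le (hf.mul hgk) _ _)
        (norm_inner_borelCalculus_le hgk _ _))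
    _ ≤ (C + 1) * ∫ t, ‖(g - k) t‖ ∂(polarMeasure H x y) +
        (C + 1) * ∫ t, ‖(g - k) t‖ ∂(polarMeasure H (((borelCalculus H f)†) x) y) := by
      have h0 : 0 ≤ ∫ t, ‖(g - k) t‖ ∂(polarMeasure H (((borelCalculus H f)†) x) y) :=
        integral_nonneg fun _ => norm_nonneg _
      refine add_le_add ?_ (by nlinarith)
      rw [← integral_const_mul]
      refine integral_mono ((hf.mul hgk).integrable _).norm (hi1.const_mul _) fun t => ?_
      simp only [Pi.mul_apply, norm_mul]
      gcongr
      linarith [hC t]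
    _ = (C + 1) * ∫ t, ‖(g - k) t‖ ∂μ := by
      rw [hμ, integral_add_measure hi1 hi2, mul_add]
    _ ≤ (C + 1) * (ε / (C + 1)) := by gcongr
    _ = ε := by field_simp

theorem borelCalculus_mul (hf : IsBddBorel f) (hg : IsBddBorel g) :
    borelCalculus H (f * g) = borelCalculus H f * borelCalculus H g := by
  refine borelCalculus_mul_of_approx hf hg fun k hk hkc => ?_
  have hkb := IsBddBorel.of_hasCompactSupport hk hkc
  -- the case of a continuous second factor follows by taking adjoints
  have h := borelCalculus_mul_of_approx (H := H) hkb.star hf.star fun l hl hlc =>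
    borelCalculus_mul_of_continuous (Complex.continuous_conj.comp hk)
      (hkc.comp_left (g := starRingEnd ℂ) (map_zero _)) hl hlc
  rw [← star_mul, borelCalculus_star (hf.mul hkb), borelCalculus_star hf, borelCalculus_star hkb,
    ← star_mul] at h
  exact star_injective h

theorem borelCalculus_commute (hf : IsBddBorel f) (hg : IsBddBorel g) :
    borelCalculus H f * borelCalculus H g = borelCalculus H g * borelCalculus H f := by
  rw [← borelCalculus_mul hf hg, ← borelCalculus_mul hg hf, mul_comm]

theorem norm_borelCalculus_apply_sq (hf : IsBddBorel f) (ψ : E) :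
    ‖borelCalculus H f ψ‖ ^ 2 = ∫ t, ‖f t‖ ^ 2 ∂(spectralMeasure H ψ) := by
  have h1 : ⟪ψ, borelCalculus H (star f * f) ψ⟫_ℂ = (‖borelCalculus H f ψ‖ : ℂ) ^ 2 := by
    rw [borelCalculus_mul hf.star hf, borelCalculus_star hf]
    change ⟪ψ, ((borelCalculus H f)†) (borelCalculus H f ψ)⟫_ℂ = _
    rw [ContinuousLinearMap.adjoint_inner_right, inner_self_eq_norm_sq_to_K]
    rfl
  rw [inner_borelCalculus_self (hf.star.mul hf)] at h1
  have h2 : ∀ t, (star f * f) t = ((‖f t‖ ^ 2 : ℝ) : ℂ) := fun t => by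
    have := Complex.conj_mul' (f t)
    push_cast
    exact this
  simp_rw [h2] at h1
  rw [integral_complex_ofReal] at h1
  exact_mod_cast h1.symm

theorem norm_borelCalculus_le_one (hf : Measurable f) (h1 : ∀ t, ‖f t‖ ≤ 1) :
    ‖borelCalculus H f‖ ≤ 1 := by
  refine ContinuousLinearMap.opNorm_le_bound _ zero_le_one fun ψ => ?_
  have hb : IsBddBorel f := ⟨hf, 1, h1⟩
  rw [one_mul, ← pow_le_pow_iff_left₀ (norm_nonneg _) (norm_nonneg _) two_ne_zero,
    norm_borelCalculus_apply_sq hb]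
  refine (le_abs_self _).trans ?_
  have := norm_integral_spectralMeasure_le H ψ (f := fun t => ((‖f t‖ ^ 2 : ℝ) : ℂ)) (C := 1)
    fun t => by
      rw [Complex.norm_real, Real.norm_eq_abs, abs_of_nonneg (by positivity)]
      exact pow_le_one₀ (norm_nonneg _) (h1 t)
  rw [integral_complex_ofReal, Complex.norm_real, one_mul] at this
  exact this

end BorelAlgebra

end MobilityGap

namespace MobilityGap

/-! ### Conjugation by a quaternionic structure -/

section Conjugation

variable {E : Type*} [NormedAddCommGroup E] [InnerProductSpace ℂ E]

variable {Θ : E →ₗ⋆[ℂ] E}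

theorem IsQuaternionic.map_real_smul (r : ℝ) (ψ : E) : Θ (r • ψ) = r • Θ ψ := by
  rw [← Complex.coe_smul, map_smulₛₗ, Complex.conj_ofReal, Complex.coe_smul]

/-- The conjugation `A ↦ Θ⁻¹ A Θ = -Θ A Θ` as a bounded operator. -/
noncomputable def IsQuaternionic.conj (hΘ : IsQuaternionic Θ) (A : E →L[ℂ] E) : E →L[ℂ] E :=
  LinearMap.mkContinuous
    { toFun := fun ψ => -Θ (A (Θ ψ))
      map_add' := fun x y => by simp only [map_add, neg_add]
      map_smul' := fun c x => by simp }
    ‖A‖ fun ψ => by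
      change ‖-Θ (A (Θ ψ))‖ ≤ _
      rw [norm_neg, hΘ.norm_map]
      exact (A.le_opNorm _).trans (by rw [hΘ.norm_map])

theorem IsQuaternionic.conj_apply (hΘ : IsQuaternionic Θ) (A : E →L[ℂ] E) (ψ : E) :
    hΘ.conj A ψ = -Θ (A (Θ ψ)) := rfl

theorem IsQuaternionic.inner_conj (hΘ : IsQuaternionic Θ) (A : E →L[ℂ] E) (ψ φ : E) :
    ⟪ψ, hΘ.conj A φ⟫_ℂ = ⟪A (Θ φ), Θ ψ⟫_ℂ := by
  rw [hΘ.conj_apply, inner_neg_right, ← hΘ.inner_map, hΘ.sq_eq_neg, inner_neg_left, neg_neg]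

end Conjugation

/-! ### Spectral calculus of a self-adjoint operator -/

section SpectralCalculus

variable {E : Type*} [NormedAddCommGroup E] [InnerProductSpace ℂ E] [CompleteSpace E]

local postfix:1000 "†" => ContinuousLinearMap.adjoint

variable {H : E →L[ℂ] E} {f g : ℝ → ℂ}

/-- A cutoff function `c`, equal to `1` on the spectrum and at a given point, turns the unbounded
function `t` into the bounded function `t c(t)` representing `H`. -/
theorem exists_cutoff (hH : IsSelfAdjoint H) (a : ℝ) : ∃ c : ℝ → ℂ, IsBddBorel c ∧
    IsBddBorel (fun t => (t : ℂ) * c t) ∧ c a = 1 ∧ borelCalculus H c = 1 ∧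
    borelCalculus H (fun t => (t : ℂ) * c t) = H := by
  have hK : IsCompact (spectrum ℝ H ∪ {a}) :=
    (ContinuousFunctionalCalculus.isCompact_spectrum (R := ℝ) H).union isCompact_singleton
  obtain ⟨k, hk1, -, hk3, -⟩ := exists_continuous_one_zero_of_isCompact
    hK (isClosed_empty (X := ℝ)) (Set.disjoint_empty _)
  have hks : ∀ t ∈ spectrum ℝ H, k t = 1 := fun t ht => hk1 (Or.inl ht)
  have hcc : Continuous fun t => (k t : ℂ) := Complex.continuous_ofReal.comp k.continuous
  have hcs : HasCompactSupport fun t => (k t : ℂ) :=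
    hk3.comp_left (g := fun x : ℝ => (x : ℂ)) rfl
  have htc : Continuous fun t : ℝ => (t : ℂ) * (k t : ℂ) := Complex.continuous_ofReal.mul hcc
  have hts : HasCompactSupport fun t : ℝ => (t : ℂ) * (k t : ℂ) := hcs.mul_left
  refine ⟨fun t => (k t : ℂ), .of_hasCompactSupport hcc hcs, .of_hasCompactSupport htc hts, ?_,
    ?_, ?_⟩
  · have : k a = 1 := hk1 (Or.inr rfl)
    simp [this]
  · rw [borelCalculus_eq_cfc hcc hcs]
    simp only [Complex.ofReal_re, Complex.ofReal_im]
    rw [cfc_congr (g := fun _ => (1 : ℝ)) fun t ht => hks t ht]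
    simp [cfc_const_one ℝ H]
  · rw [borelCalculus_eq_cfc htc hts]
    simp only [← Complex.ofReal_mul, Complex.ofReal_re, Complex.ofReal_im]
    rw [cfc_congr (g := fun t => t) fun t ht => by simp [hks t ht]]
    simp [cfc_id' ℝ H]

theorem borelCalculus_one (hH : IsSelfAdjoint H) : borelCalculus H 1 = 1 := by
  obtain ⟨c, hc, -, -, h, -⟩ := exists_cutoff hH 0
  calc borelCalculus H 1 = borelCalculus H 1 * borelCalculus H c := by rw [h, mul_one]
    _ = 1 := by rw [← borelCalculus_mul .one hc, one_mul, h]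

theorem borelCalculus_commute_self (hH : IsSelfAdjoint H) (hf : IsBddBorel f) :
    borelCalculus H f * H = H * borelCalculus H f := by
  obtain ⟨c, -, htc, -, -, h⟩ := exists_cutoff hH 0
  have h1 := borelCalculus_commute (H := H) hf htc
  rwa [h] at h1

/-- The range of the spectral projection of a point consists of eigenvectors. -/
theorem apply_borelCalculus_singleton (hH : IsSelfAdjoint H) (a : ℝ) (ψ : E) :
    H (borelCalculus H (({a} : Set ℝ).indicator 1) ψ) =
      (a : ℂ) • borelCalculus H (({a} : Set ℝ).indicator 1) ψ := by
  obtain ⟨c, -, htc, hca, -, h⟩ := exists_cutoff hH a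
  have hb := IsBddBorel.indicator_one (measurableSet_singleton a)
  have h1 : H * borelCalculus H (({a} : Set ℝ).indicator 1) =
      (a : ℂ) • borelCalculus H (({a} : Set ℝ).indicator 1) := by
    rw [← borelCalculus_smul hb]
    conv_lhs => enter [1]; rw [← h]
    rw [← borelCalculus_mul htc hb]
    congr 1
    ext t
    by_cases ht : t = a
    · simp [ht, hca]
    · simp [ht]
  exact congrArg (fun T => T ψ) h1

/-- The spectral measure of an eigenvector is carried by the eigenvalue. -/
theorem borelCalculus_apply_eq_zero (hH : IsSelfAdjoint H) (hf : IsBddBorel f) {a : ℝ} {ψ : E}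
    (hψ : H ψ = (a : ℂ) • ψ) (hfa : f a = 0) : borelCalculus H f ψ = 0 := by
  have hnull : ∀ n : ℕ, spectralMeasure H ψ {t | 1 / ((n : ℝ) + 1) ≤ |t - a|} = 0 := by
    intro n
    set s : Set ℝ := {t | 1 / ((n : ℝ) + 1) ≤ |t - a|} with hs
    have hsm : MeasurableSet s := measurableSet_le measurable_const (by fun_prop)
    have hb := IsBddBorel.indicator_one hsm
    obtain ⟨c, hc, htc, -, hc1, h⟩ := exists_cutoff hH a
    have hk : IsBddBorel (s.indicator fun t => ((t : ℂ) - a)⁻¹) := by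
      refine ⟨Measurable.indicator (by fun_prop) hsm, (n : ℝ) + 1, fun t => ?_⟩
      by_cases ht : t ∈ s
      · rw [Set.indicator_of_mem ht, norm_inv, ← Complex.ofReal_sub, Complex.norm_real,
          Real.norm_eq_abs]
        refine inv_le_of_inv_le₀ (by positivity) ?_
        rw [← one_div]; exact ht
      · rw [Set.indicator_of_notMem ht, norm_zero]; positivity
    have h0 : (H - (a : ℂ) • (1 : E →L[ℂ] E)) ψ = 0 := by
      simp [hψ]
    have h1 : borelCalculus H (s.indicator 1) =
        borelCalculus H (s.indicator fun t => ((t : ℂ) - a)⁻¹) * (H - (a : ℂ) • 1) := by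
      rw [← mul_one (borelCalculus H (s.indicator 1))]
      conv_lhs => rw [← hc1]
      conv_rhs => enter [2]; rw [← h, ← hc1]
      rw [← borelCalculus_smul hc, ← borelCalculus_sub htc (hc.smul _),
        ← borelCalculus_mul hb hc, ← borelCalculus_mul hk (htc.sub (hc.smul _))]
      congr 1
      ext t
      by_cases ht : t ∈ s
      · have hta : (t : ℂ) - a ≠ 0 := by
          intro h0
          have h0' : t - a = 0 := by exact_mod_cast h0
          have h2 : 1 / ((n : ℝ) + 1) ≤ |t - a| := ht
          rw [h0', abs_zero] at h2
          have : (0 : ℝ) < 1 / ((n : ℝ) + 1) := by positivity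
          linarith
        simp only [Pi.mul_apply, Set.indicator_of_mem ht, Pi.one_apply, Pi.sub_apply,
          Pi.smul_apply, smul_eq_mul]
        field_simp
      · simp [Set.indicator_of_notMem ht]
    have h2 : borelCalculus H (s.indicator 1) ψ = 0 := by
      rw [h1]
      change borelCalculus H _ ((H - (a : ℂ) • (1 : E →L[ℂ] E)) ψ) = 0
      rw [h0, map_zero]
    have h3 := norm_borelCalculus_apply_sq (H := H) hb ψ
    rw [h2] at h3
    have h4 : ∀ t, ‖s.indicator (1 : ℝ → ℂ) t‖ ^ 2 = s.indicator 1 t := by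
      intro t
      by_cases ht : t ∈ s <;> simp [ht]
    simp_rw [h4] at h3
    rw [integral_indicator_one hsm] at h3
    simpa [Measure.real, ENNReal.toReal_eq_zero_iff] using h3.symm
  have hae : ∀ᵐ t ∂(spectralMeasure H ψ), t = a := by
    have h1 : spectralMeasure H ψ (⋃ n : ℕ, {t | 1 / ((n : ℝ) + 1) ≤ |t - a|}) = 0 :=
      measure_iUnion_null hnull
    refine measure_mono_null (fun t ht => ?_) h1
    have hpos : 0 < |t - a| := abs_pos.2 (sub_ne_zero.2 ht)
    obtain ⟨n, hn⟩ := exists_nat_one_div_lt hpos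
    exact Set.mem_iUnion.2 ⟨n, hn.le⟩
  have h5 := norm_borelCalculus_apply_sq (H := H) hf ψ
  have h6 : ∫ t, ‖f t‖ ^ 2 ∂(spectralMeasure H ψ) = 0 := by
    refine integral_eq_zero_of_ae ?_
    filter_upwards [hae] with t ht
    simp [ht, hfa]
  rw [h6] at h5
  exact norm_eq_zero.1 (pow_eq_zero_iff two_ne_zero |>.1 h5)

/-! ### Time reversal and the functional calculus -/

variable {Θ : E →ₗ⋆[ℂ] E}

/-- Conjugation by `Θ` as a real `*`-algebra homomorphism. -/
noncomputable def IsQuaternionic.conjHom (hΘ : IsQuaternionic Θ) :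
    (E →L[ℂ] E) →⋆ₐ[ℝ] (E →L[ℂ] E) where
  toFun := hΘ.conj
  map_one' := by ext ψ; simp [hΘ.conj_apply, hΘ.sq_eq_neg]
  map_mul' A B := by
    ext ψ
    change -Θ (A (B (Θ ψ))) = -Θ (A (Θ (-Θ (B (Θ ψ)))))
    rw [map_neg, hΘ.sq_eq_neg, neg_neg]
  map_zero' := by ext ψ; simp [hΘ.conj_apply]
  map_add' A B := by
    ext ψ
    simp only [hΘ.conj_apply, add_apply, map_add, neg_add]
  commutes' r := by
    ext ψ
    simp [hΘ.conj_apply, Algebra.algebraMap_eq_smul_one, IsQuaternionic.map_real_smul,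
      hΘ.sq_eq_neg]
  map_star' A := by
    refine ContinuousLinearMap.ext fun φ => ext_inner_left ℂ fun ψ => ?_
    rw [hΘ.inner_conj, ContinuousLinearMap.star_eq_adjoint, ContinuousLinearMap.star_eq_adjoint,
      ContinuousLinearMap.adjoint_inner_left, ContinuousLinearMap.adjoint_inner_right,
      ← inner_conj_symm, ← inner_conj_symm (hΘ.conj A ψ), hΘ.inner_conj]

theorem IsQuaternionic.conj_cfc (hΘ : IsQuaternionic Θ) (hH : IsSelfAdjoint H)
    (hHΘ : ∀ ψ, H (Θ ψ) = Θ (H ψ)) {k : ℝ → ℝ} (hk : Continuous k) :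
    hΘ.conj (cfc k H) = cfc k H := by
  have hHH : hΘ.conjHom H = H := by
    ext ψ
    change -Θ (H (Θ ψ)) = H ψ
    rw [hHΘ, hΘ.sq_eq_neg, neg_neg]
  have hcont : Continuous hΘ.conjHom := by
    refine AddMonoidHomClass.continuous_of_bound hΘ.conjHom 1 fun A => ?_
    rw [one_mul]
    refine ContinuousLinearMap.opNorm_le_bound _ (norm_nonneg _) fun ψ => ?_
    change ‖-Θ (A (Θ ψ))‖ ≤ _
    rw [norm_neg, hΘ.norm_map]
    exact (A.le_opNorm _).trans (by rw [hΘ.norm_map])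
  have h := StarAlgHom.map_cfc (p := IsSelfAdjoint) (q := IsSelfAdjoint) hΘ.conjHom k H
    hk.continuousOn hcont hH (by rwa [hHH])
  rw [hHH] at h
  exact h

theorem spectralMeasure_timeReversal (hΘ : IsQuaternionic Θ) (hH : IsSelfAdjoint H)
    (hHΘ : ∀ ψ, H (Θ ψ) = Θ (H ψ)) (ψ : E) : spectralMeasure H (Θ ψ) = spectralMeasure H ψ := by
  have : spectralFunctional H (Θ ψ) = spectralFunctional H ψ := by
    ext k
    change (⟪Θ ψ, cfc (k : ℝ → ℝ) H (Θ ψ)⟫_ℂ).re = (⟪ψ, cfc (k : ℝ → ℝ) H ψ⟫_ℂ).re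
    conv_rhs => rw [← hΘ.conj_cfc hH hHΘ (map_continuous k), hΘ.inner_conj]
    rw [← inner_conj_symm, Complex.conj_re]
  unfold spectralMeasure
  rw [this]

/-- `Θ` exchanges `f(H)` with its adjoint. -/
theorem isOddPair_borelCalculus (hΘ : IsQuaternionic Θ) (hH : IsSelfAdjoint H)
    (hHΘ : ∀ ψ, H (Θ ψ) = Θ (H ψ)) (hf : IsBddBorel f) :
    IsOddPair Θ (borelCalculus H f) (borelCalculus H f) := by
  have h : hΘ.conj (borelCalculus H f) = (borelCalculus H f)† := by
    rw [← ContinuousLinearMap.star_eq_adjoint, ← borelCalculus_star hf]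
    refine (borelCalculus_eq_of_inner hf.star fun ψ => ?_).symm
    rw [hΘ.inner_conj, ← inner_conj_symm, inner_borelCalculus_self hf,
      spectralMeasure_timeReversal hΘ hH hHΘ, ← integral_conj]
    rfl
  intro ψ
  rw [← h, hΘ.conj_apply, map_neg, hΘ.sq_eq_neg, neg_neg]

end SpectralCalculus

end MobilityGap

namespace MobilityGap

/-! ### Weak limits along an ultrafilter -/

section WeakLimit

variable {E : Type*} [NormedAddCommGroup E] [InnerProductSpace ℂ E]

local postfix:1000 "†" => ContinuousLinearMap.adjoint

/-- `D` is the limit of `T n` in the weak operator topology along a fixed free ultrafilter. -/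
def IsWeakLimit (T : ℕ → E →L[ℂ] E) (D : E →L[ℂ] E) : Prop :=
  ∀ x y, Tendsto (fun n => ⟪x, T n y⟫_ℂ) (hyperfilter ℕ) (𝓝 ⟪x, D y⟫_ℂ)

namespace IsWeakLimit

variable {T T' : ℕ → E →L[ℂ] E} {D D' : E →L[ℂ] E}

theorem unique (h : IsWeakLimit T D) (h' : IsWeakLimit T D') : D = D' :=
  ContinuousLinearMap.ext fun y => ext_inner_left ℂ fun x => tendsto_nhds_unique (h x y) (h' x y)

theorem mul_right (h : IsWeakLimit T D) (A : E →L[ℂ] E) :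
    IsWeakLimit (fun n => T n * A) (D * A) := fun x y => h x (A y)

theorem sub (h : IsWeakLimit T D) (h' : IsWeakLimit T' D') :
    IsWeakLimit (fun n => T n - T' n) (D - D') := fun x y => by
  simpa only [sub_apply, inner_sub_right] using (h x y).sub (h' x y)

theorem const (A : E →L[ℂ] E) : IsWeakLimit (fun _ => A) A := fun _ _ => tendsto_const_nhds

theorem norm_le (h : IsWeakLimit T D) {C : ℝ} (hC : ∀ n, ‖T n‖ ≤ C) : ‖D‖ ≤ C := by
  have hC0 : 0 ≤ C := (norm_nonneg _).trans (hC 0)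
  refine ContinuousLinearMap.opNorm_le_bound _ hC0 fun y => ?_
  have h1 : ‖⟪D y, D y⟫_ℂ‖ ≤ ‖D y‖ * (C * ‖y‖) := by
    refine le_of_tendsto (h (D y) y).norm (Eventually.of_forall fun n => ?_)
    exact (norm_inner_le_norm _ _).trans
      (mul_le_mul_of_nonneg_left ((T n).le_of_opNorm_le (hC n) y) (norm_nonneg _))
  rw [inner_self_eq_norm_sq_to_K, norm_pow, RCLike.norm_ofReal, abs_norm, sq] at h1
  by_cases h0 : ‖D y‖ = 0
  · rw [h0]; positivity
  · exact le_of_mul_le_mul_left h1 (lt_of_le_of_ne (norm_nonneg _) (Ne.symm h0))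

theorem eq_zero_of_norm_tendsto (h : IsWeakLimit T D)
    (hT : Tendsto (fun n => ‖T n‖) atTop (𝓝 0)) : D = 0 := by
  refine h.unique fun x y => ?_
  rw [zero_apply, inner_zero_right]
  refine Tendsto.mono_left ?_ Nat.hyperfilter_le_atTop
  refine squeeze_zero_norm (a := fun n => ‖x‖ * (‖T n‖ * ‖y‖)) (fun n => ?_) ?_
  · exact (norm_inner_le_norm _ _).trans
      (mul_le_mul_of_nonneg_left ((T n).le_opNorm y) (norm_nonneg _))
  · simpa using (hT.mul_const ‖y‖).const_mul ‖x‖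

variable [CompleteSpace E]

theorem mul_left (h : IsWeakLimit T D) (A : E →L[ℂ] E) :
    IsWeakLimit (fun n => A * T n) (A * D) := fun x y => by
  have := h ((A†) x) y
  simp only [ContinuousLinearMap.adjoint_inner_left] at this
  exact this

theorem isOddPair {Θ : E →ₗ⋆[ℂ] E} (hΘ : IsQuaternionic Θ) (h : IsWeakLimit T D)
    (hT : ∀ n, IsOddPair Θ (T n) (T n)) : IsOddPair Θ D D := by
  have hflip : ∀ x z, ⟪x, Θ z⟫_ℂ = -⟪z, Θ x⟫_ℂ := fun x z => by
    rw [← hΘ.inner_map (Θ x), hΘ.sq_eq_neg, inner_neg_left, neg_neg]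
  intro y
  refine ext_inner_left ℂ fun x => ?_
  rw [hflip x, ContinuousLinearMap.adjoint_inner_left]
  refine tendsto_nhds_unique (h x (Θ y)) ((h y (Θ x)).neg.congr fun n => ?_)
  rw [hT n y, hflip x, ContinuousLinearMap.adjoint_inner_left]

end IsWeakLimit

variable [CompleteSpace E]

theorem exists_isWeakLimit {T : ℕ → E →L[ℂ] E} {C : ℝ} (hT : ∀ n, ‖T n‖ ≤ C) :
    ∃ D, IsWeakLimit T D := by
  have hbd' : ∀ x y n, ‖⟪x, T n y⟫_ℂ‖ ≤ C * ‖x‖ * ‖y‖ := fun x y n => by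
    calc ‖⟪x, T n y⟫_ℂ‖ ≤ ‖x‖ * ‖T n y‖ := norm_inner_le_norm _ _
      _ ≤ ‖x‖ * (C * ‖y‖) := by gcongr; exact (T n).le_of_opNorm_le (hT n) y
      _ = C * ‖x‖ * ‖y‖ := by ring
  have hlim : ∀ x y, ∃ z ∈ Metric.closedBall (0 : ℂ) (C * ‖x‖ * ‖y‖),
      Tendsto (fun n => ⟪x, T n y⟫_ℂ) (hyperfilter ℕ) (𝓝 z) := fun x y =>
    (isCompact_closedBall (0 : ℂ) (C * ‖x‖ * ‖y‖)).ultrafilter_le_nhds'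
      ((hyperfilter ℕ).map fun n => ⟪x, T n y⟫_ℂ)
      (Filter.mem_map.2 (Filter.univ_mem' fun n => by
        simpa using hbd' x y n))
  choose B hBmem hB using hlim
  have hadd : ∀ x y z, B x (y + z) = B x y + B x z := fun x y z =>
    tendsto_nhds_unique (hB x (y + z))
      (((hB x y).add (hB x z)).congr fun i => by rw [map_add, inner_add_right])
  have hsmul : ∀ (c : ℂ) x y, B x (c • y) = c * B x y := fun c x y =>
    tendsto_nhds_unique (hB x (c • y))
      (((hB x y).const_mul c).congr fun i => by rw [map_smul, inner_smul_right])
  have hadd' : ∀ x y z, B (x + y) z = B x z + B y z := fun x y z =>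
    tendsto_nhds_unique (hB (x + y) z)
      (((hB x z).add (hB y z)).congr fun i => by rw [inner_add_left])
  have hsmul' : ∀ (c : ℂ) x y, B (c • x) y = (starRingEnd ℂ) c * B x y := fun c x y =>
    tendsto_nhds_unique (hB (c • x) y)
      (((hB x y).const_mul _).congr fun i => by rw [inner_smul_left])
  let L : E →ₗ⋆[ℂ] E →ₗ[ℂ] ℂ := LinearMap.mk₂'ₛₗ (starRingEnd ℂ) (RingHom.id ℂ) B
    hadd' hsmul' hadd hsmul
  let S := InnerProductSpace.continuousLinearMapOfBilin
    (L.mkContinuous₂ C fun x y => mem_closedBall_zero_iff.1 (hBmem x y))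
  have hS : ∀ x y, ⟪x, (S†) y⟫_ℂ = B x y := fun x y => by
    rw [ContinuousLinearMap.adjoint_inner_right]
    exact InnerProductSpace.continuousLinearMapOfBilin_apply _ x y
  exact ⟨S†, fun x y => by rw [hS]; exact hB x y⟩

end WeakLimit

/-! ### Averaging over the unitary group of the Hamiltonian -/

section Averaging

variable {E : Type*} [NormedAddCommGroup E] [InnerProductSpace ℂ E] [CompleteSpace E]

/-- The Cayley transform of the real line onto the unit circle. -/
noncomputable def cayley (t : ℝ) : ℂ := ((t : ℂ) - Complex.I) / ((t : ℂ) + Complex.I)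

theorem ofReal_add_I_ne_zero (t : ℝ) : (t : ℂ) + Complex.I ≠ 0 := fun h => by
  simpa using congrArg Complex.im h

theorem norm_cayley (t : ℝ) : ‖cayley t‖ = 1 := by
  have h : (starRingEnd ℂ) ((t : ℂ) + Complex.I) = (t : ℂ) - Complex.I := by
    simp [← sub_eq_add_neg]
  rw [cayley, norm_div, ← h, RCLike.norm_conj, div_self]
  exact norm_ne_zero_iff.2 (ofReal_add_I_ne_zero t)

theorem cayley_ne_zero (t : ℝ) : cayley t ≠ 0 := by
  rw [← norm_ne_zero_iff, norm_cayley]; exact one_ne_zero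

theorem measurable_cayley : Measurable cayley := by
  unfold cayley; fun_prop

theorem isBddBorel_cayley : IsBddBorel cayley :=
  ⟨measurable_cayley, 1, fun t => (norm_cayley t).le⟩

variable {H : E →L[ℂ] E}

/-- An operator commuting with the Cayley transform of `H` commutes with `H`. -/
theorem commute_of_commute_cayley (hH : IsSelfAdjoint H) {D : E →L[ℂ] E}
    (h : borelCalculus H cayley * D = D * borelCalculus H cayley) : H * D = D * H := by
  obtain ⟨c, hc, htc, -, hc1, hH'⟩ := exists_cutoff hH 0
  let r : ℝ → ℂ := fun t => ((t : ℂ) + Complex.I)⁻¹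
  have hr' : r = (2 * Complex.I)⁻¹ • (1 - cayley) := by
    ext t
    have h0 := ofReal_add_I_ne_zero t
    have h1 : (1 - cayley) t = 1 - cayley t := rfl
    rw [Pi.smul_apply, h1, cayley, smul_eq_mul]
    simp only [r]
    field_simp
    ring
  have hr : IsBddBorel r := by
    rw [hr']; exact (IsBddBorel.one.sub isBddBorel_cayley).smul _
  set R := borelCalculus H r with hRdef
  have hRD : R * D = D * R := by
    rw [hRdef, hr', borelCalculus_smul (IsBddBorel.one.sub isBddBorel_cayley),
      borelCalculus_sub .one isBddBorel_cayley, borelCalculus_one hH, smul_mul_assoc,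
      mul_smul_comm, sub_mul, mul_sub, h, one_mul, mul_one]
  have hHi : borelCalculus H ((fun t : ℝ => (t : ℂ) * c t) + Complex.I • c) =
      H + Complex.I • 1 := by
    rw [borelCalculus_add htc (hc.smul _), borelCalculus_smul hc, hH', hc1]
  have hb := htc.add (hc.smul Complex.I)
  have hprod : r * ((fun t : ℝ => (t : ℂ) * c t) + Complex.I • c) = c := by
    ext t
    have h0 := ofReal_add_I_ne_zero t
    simp only [Pi.mul_apply, Pi.add_apply, Pi.smul_apply, smul_eq_mul, r]
    field_simp
  have h1 : R * (H + Complex.I • 1) = 1 := by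
    rw [← hHi, hRdef, ← borelCalculus_mul hr hb, hprod, hc1]
  have h2 : (H + Complex.I • 1) * R = 1 := by
    rw [← hHi, hRdef, ← borelCalculus_mul hb hr, mul_comm, hprod, hc1]
  have h3 : (H + Complex.I • 1) * D = D * (H + Complex.I • 1) := by
    calc (H + Complex.I • 1) * D = (H + Complex.I • 1) * (D * R) * (H + Complex.I • 1) := by
          rw [mul_assoc, mul_assoc, h1, mul_one]
      _ = D * (H + Complex.I • 1) := by rw [← hRD, ← mul_assoc, h2, one_mul]
  rw [add_mul, mul_add, smul_mul_assoc, mul_smul_comm, one_mul, mul_one] at h3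
  exact add_right_cancel h3

/-- The `j`-th power of the Cayley transform, cut off to the set `s`. -/
noncomputable def cayleyPow (s : Set ℝ) (j : ℤ) : ℝ → ℂ := s.indicator fun t => cayley t ^ j

variable {s : Set ℝ}

theorem norm_cayleyPow_le (s : Set ℝ) (j : ℤ) (t : ℝ) : ‖cayleyPow s j t‖ ≤ 1 := by
  by_cases ht : t ∈ s
  · rw [cayleyPow, Set.indicator_of_mem ht, norm_zpow, norm_cayley, one_zpow]
  · rw [cayleyPow, Set.indicator_of_notMem ht, norm_zero]; exact zero_le_one

theorem measurable_cayleyPow (hs : MeasurableSet s) (j : ℤ) : Measurable (cayleyPow s j) :=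
  (measurable_cayley.pow_const j).indicator hs

theorem isBddBorel_cayleyPow (hs : MeasurableSet s) (j : ℤ) : IsBddBorel (cayleyPow s j) :=
  ⟨measurable_cayleyPow hs j, 1, norm_cayleyPow_le s j⟩

theorem cayleyPow_mul (i j : ℤ) : cayleyPow s i * cayleyPow s j = cayleyPow s (i + j) := by
  ext t
  by_cases ht : t ∈ s
  · simp [cayleyPow, ht, zpow_add₀ (cayley_ne_zero t)]
  · simp [cayleyPow, ht]

theorem cayley_mul_cayleyPow (j : ℤ) : cayley * cayleyPow s j = cayleyPow s (j + 1) := by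
  ext t
  by_cases ht : t ∈ s
  · simp [cayleyPow, ht, zpow_add₀ (cayley_ne_zero t), mul_comm]
  · simp [cayleyPow, ht]

theorem cayleyPow_zero : cayleyPow s 0 = s.indicator 1 := by
  ext t
  by_cases ht : t ∈ s <;> simp [cayleyPow, ht]

/-- `W_j = χ_s(H) V^j` for the Cayley transform `V` of `H`. -/
noncomputable def cayleyOp (H : E →L[ℂ] E) (s : Set ℝ) (j : ℤ) : E →L[ℂ] E :=
  borelCalculus H (cayleyPow s j)

theorem norm_cayleyOp_le (hs : MeasurableSet s) (j : ℤ) : ‖cayleyOp H s j‖ ≤ 1 :=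
  norm_borelCalculus_le_one (measurable_cayleyPow hs j) (norm_cayleyPow_le s j)

theorem cayleyOp_mul (hs : MeasurableSet s) (i j : ℤ) :
    cayleyOp H s i * cayleyOp H s j = cayleyOp H s (i + j) := by
  rw [cayleyOp, cayleyOp, ← borelCalculus_mul (isBddBorel_cayleyPow hs i)
    (isBddBorel_cayleyPow hs j), cayleyPow_mul, cayleyOp]

theorem cayley_mul_cayleyOp (hs : MeasurableSet s) (j : ℤ) :
    borelCalculus H cayley * cayleyOp H s j = cayleyOp H s (j + 1) := by
  rw [cayleyOp, ← borelCalculus_mul isBddBorel_cayley (isBddBorel_cayleyPow hs j),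
    cayley_mul_cayleyPow, cayleyOp]

theorem cayleyOp_mul_cayley (hs : MeasurableSet s) (j : ℤ) :
    cayleyOp H s j * borelCalculus H cayley = cayleyOp H s (j + 1) := by
  rw [← cayley_mul_cayleyOp hs, cayleyOp,
    borelCalculus_commute (isBddBorel_cayleyPow hs j) isBddBorel_cayley]

/-- The conjugate `W_j A W_j*`. -/
noncomputable def cayleyConj (H : E →L[ℂ] E) (s : Set ℝ) (A : E →L[ℂ] E) (j : ℤ) : E →L[ℂ] E :=
  cayleyOp H s j * A * cayleyOp H s (-j)

theorem cayley_mul_cayleyConj (hs : MeasurableSet s) (A : E →L[ℂ] E) (j : ℤ) :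
    borelCalculus H cayley * cayleyConj H s A j =
      cayleyConj H s A (j + 1) * borelCalculus H cayley := by
  rw [cayleyConj, cayleyConj, mul_assoc _ (cayleyOp H s (-(j + 1))), cayleyOp_mul_cayley hs,
    ← mul_assoc, ← mul_assoc, cayley_mul_cayleyOp hs]
  congr 2
  ring

/-- The mean of `W_j A W_j*` over `-n ≤ j ≤ n`, the term `j = 0` being counted twice. The mean is
symmetric in `j` so as to be odd whenever `A` is odd. -/
noncomputable def cayleyMean (H : E →L[ℂ] E) (s : Set ℝ) (A : E →L[ℂ] E) (n : ℕ) : E →L[ℂ] E :=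
  (2 * ((n : ℂ) + 1))⁻¹ • ∑ j ∈ Finset.range (n + 1),
    (cayleyConj H s A j + cayleyConj H s A (-j))

theorem norm_sum_div_le {F : ℕ → E →L[ℂ] E} {C : ℝ} (hF : ∀ j, ‖F j‖ ≤ 2 * C) (n : ℕ) :
    ‖(2 * ((n : ℂ) + 1))⁻¹ • ∑ j ∈ Finset.range (n + 1), F j‖ ≤ C := by
  have h1 : ‖(2 * ((n : ℂ) + 1))‖ = 2 * ((n : ℝ) + 1) := by
    rw [norm_mul]
    norm_cast
  rw [norm_smul, norm_inv, h1]
  have h2 : ‖∑ j ∈ Finset.range (n + 1), F j‖ ≤ ∑ j ∈ Finset.range (n + 1), 2 * C :=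
    norm_sum_le_of_le _ fun j _ => hF j
  rw [Finset.sum_const, Finset.card_range, nsmul_eq_mul] at h2
  rw [inv_mul_le_iff₀ (by positivity)]
  push_cast at h2
  linarith

theorem norm_cayleyConj_le (hs : MeasurableSet s) (A : E →L[ℂ] E) (j : ℤ) :
    ‖cayleyConj H s A j‖ ≤ ‖A‖ := by
  calc _ ≤ ‖cayleyOp H s j‖ * ‖A‖ * ‖cayleyOp H s (-j)‖ :=
        (norm_mul_le _ _).trans (mul_le_mul_of_nonneg_right (norm_mul_le _ _) (norm_nonneg _))
    _ ≤ 1 * ‖A‖ * 1 := by gcongr <;> exact norm_cayleyOp_le hs _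
    _ = ‖A‖ := by ring

theorem cayley_mul_cayleyMean_sub (hs : MeasurableSet s) (A : E →L[ℂ] E) (n : ℕ) :
    borelCalculus H cayley * cayleyMean H s A n - cayleyMean H s A n * borelCalculus H cayley =
      (2 * ((n : ℂ) + 1))⁻¹ • ((cayleyConj H s A ((n : ℤ) + 1) - cayleyConj H s A 0 +
        (cayleyConj H s A 1 - cayleyConj H s A (-(n : ℤ)))) * borelCalculus H cayley) := by
  have h1 : ∑ j ∈ Finset.range (n + 1), (cayleyConj H s A ((j : ℤ) + 1) - cayleyConj H s A j) =
      cayleyConj H s A ((n : ℤ) + 1) - cayleyConj H s A 0 := by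
    have := Finset.sum_range_sub (fun j : ℕ => cayleyConj H s A (j : ℤ)) (n + 1)
    push_cast at this
    exact this
  have h2 : ∑ j ∈ Finset.range (n + 1),
      (cayleyConj H s A (-(j : ℤ) + 1) - cayleyConj H s A (-(j : ℤ))) =
      cayleyConj H s A 1 - cayleyConj H s A (-(n : ℤ)) := by
    have := Finset.sum_range_sub' (fun j : ℕ => cayleyConj H s A (-(j : ℤ) + 1)) (n + 1)
    push_cast at this
    rw [show -((n : ℤ) + 1) + 1 = -(n : ℤ) by ring] at this
    rw [← this]
    refine Finset.sum_congr rfl fun j _ => ?_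
    rw [show -((j : ℤ) + 1) + 1 = -(j : ℤ) by ring]
  rw [cayleyMean, mul_smul_comm, smul_mul_assoc, ← smul_sub, ← h1, ← h2,
    ← Finset.sum_add_distrib, Finset.mul_sum, Finset.sum_mul, Finset.sum_mul,
    ← Finset.sum_sub_distrib]
  congr 1
  refine Finset.sum_congr rfl fun j _ => ?_
  rw [mul_add, cayley_mul_cayleyConj hs, cayley_mul_cayleyConj hs]
  simp only [add_mul, sub_mul]
  abel

theorem tendsto_cayley_mul_cayleyMean_sub (hs : MeasurableSet s) (A : E →L[ℂ] E) :
    Tendsto (fun n => ‖borelCalculus H cayley * cayleyMean H s A n -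
      cayleyMean H s A n * borelCalculus H cayley‖) atTop (𝓝 0) := by
  have hlim : Tendsto (fun n : ℕ => 2 * ‖A‖ * (1 / ((n : ℝ) + 1))) atTop (𝓝 0) := by
    simpa using tendsto_one_div_add_atTop_nhds_zero_nat.const_mul (2 * ‖A‖)
  refine squeeze_zero (fun _ => norm_nonneg _) (fun n => ?_) hlim
  have h1 : ‖(2 * ((n : ℂ) + 1))‖ = 2 * ((n : ℝ) + 1) := by
    rw [norm_mul]
    norm_cast
  have hV : ‖borelCalculus H cayley‖ ≤ 1 :=
    norm_borelCalculus_le_one measurable_cayley fun t => (norm_cayley t).le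
  have hb := fun j => norm_cayleyConj_le (H := H) hs A j
  rw [cayley_mul_cayleyMean_sub hs, norm_smul, norm_inv, h1]
  have h2 : ‖(cayleyConj H s A ((n : ℤ) + 1) - cayleyConj H s A 0 +
        (cayleyConj H s A 1 - cayleyConj H s A (-(n : ℤ)))) * borelCalculus H cayley‖
      ≤ ((‖A‖ + ‖A‖) + (‖A‖ + ‖A‖)) * 1 := by
    refine (norm_mul_le _ _).trans (mul_le_mul ?_ hV (norm_nonneg _) (by positivity))
    exact (norm_add_le _ _).trans (add_le_add
      ((norm_sub_le _ _).trans (add_le_add (hb _) (hb _)))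
      ((norm_sub_le _ _).trans (add_le_add (hb _) (hb _))))
  calc _ ≤ (2 * ((n : ℝ) + 1))⁻¹ * (((‖A‖ + ‖A‖) + (‖A‖ + ‖A‖)) * 1) := by gcongr
    _ = 2 * ‖A‖ * (1 / ((n : ℝ) + 1)) := by field_simp; ring

theorem isOddPair_cayleyConj {Θ : E →ₗ⋆[ℂ] E} (hΘ : IsQuaternionic Θ) (hH : IsSelfAdjoint H)
    (hHΘ : ∀ ψ, H (Θ ψ) = Θ (H ψ)) (hs : MeasurableSet s) {A : E →L[ℂ] E}
    (hA : IsOddPair Θ A A) (j : ℤ) :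
    IsOddPair Θ (cayleyConj H s A j) (cayleyConj H s A (-j)) := by
  have hW := fun i => isOddPair_borelCalculus hΘ hH hHΘ (isBddBorel_cayleyPow hs i)
  have := ((hW j).mul hA).mul (hW (-j))
  rw [← mul_assoc] at this
  rw [cayleyConj, cayleyConj, neg_neg]
  exact this

theorem isOddPair_cayleyMean {Θ : E →ₗ⋆[ℂ] E} (hΘ : IsQuaternionic Θ) (hH : IsSelfAdjoint H)
    (hHΘ : ∀ ψ, H (Θ ψ) = Θ (H ψ)) (hs : MeasurableSet s) {A : E →L[ℂ] E}
    (hA : IsOddPair Θ A A) (n : ℕ) :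
    IsOddPair Θ (cayleyMean H s A n) (cayleyMean H s A n) := by
  refine IsOddPair.smul ?_ _
  have h : ∀ t : Finset ℕ, IsOddPair Θ
      (∑ j ∈ t, (cayleyConj H s A (j : ℤ) + cayleyConj H s A (-(j : ℤ))))
      (∑ j ∈ t, (cayleyConj H s A (j : ℤ) + cayleyConj H s A (-(j : ℤ)))) := by
    intro t
    induction t using Finset.induction_on with
    | empty => intro ψ; simp
    | insert j t hj ih =>
      rw [Finset.sum_insert hj]
      refine IsOddPair.add ?_ ih
      have h1 := isOddPair_cayleyConj hΘ hH hHΘ hs hA (j : ℤ)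
      have h2 := isOddPair_cayleyConj hΘ hH hHΘ hs hA (-(j : ℤ))
      rw [neg_neg] at h2
      have := h1.add h2
      rwa [add_comm (cayleyConj H s A (-(j : ℤ)))] at this
  exact h _

/-- If the commutators `[f(H), U]`, for `f` supported in `s` with `|f| ≤ 1`, are small after
multiplication by `1 - p` for a common finite-rank operator `p`, then the compression of `U` to the
spectral subspace of `s` agrees up to a limit of finite-rank operators with an operator `D` commuting
with `H`: a weak limit of means of the conjugates of `U` under powers of the Cayley transform of
`H`. The estimate survives the weak limit because `p` does not depend on `f`. -/
theorem exists_commuting_mean (hH : IsSelfAdjoint H) (hs : MeasurableSet s) (U : E →L[ℂ] E)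
    (hU : ∀ ε : ℝ, 0 < ε → ∃ p : E →L[ℂ] E, p.toLinearMap.HasFiniteRange ∧
      ∀ f : ℝ → ℂ, Measurable f → (∀ t, ‖f t‖ ≤ 1) → (∀ t ∉ s, f t = 0) →
        ‖(borelCalculus H f * U - U * borelCalculus H f) * (1 - p)‖ ≤ ε) :
    ∃ D : E →L[ℂ] E, H * D = D * H ∧ borelCalculus H (s.indicator 1) * D = D ∧
      D * borelCalculus H (s.indicator 1) = D ∧
      IsFiniteRankLimit
        (borelCalculus H (s.indicator 1) * U * borelCalculus H (s.indicator 1) - D) ∧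
      ∀ Θ : E →ₗ⋆[ℂ] E, IsQuaternionic Θ → (∀ ψ, H (Θ ψ) = Θ (H ψ)) → IsOddPair Θ U U →
        IsOddPair Θ D D := by
  set Q := borelCalculus H (s.indicator 1) with hQ
  have hQ0 : Q = cayleyOp H s 0 := by rw [cayleyOp, cayleyPow_zero]
  obtain ⟨D, hD⟩ := exists_isWeakLimit (T := cayleyMean H s U) (C := ‖U‖) fun n =>
    norm_sum_div_le (fun j => (norm_add_le _ _).trans (by
      linarith [norm_cayleyConj_le (H := H) hs U j, norm_cayleyConj_le (H := H) hs U (-j)])) n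
  have hQb : ∀ j, Q * cayleyConj H s U j = cayleyConj H s U j := fun j => by
    rw [hQ0, cayleyConj, ← mul_assoc, ← mul_assoc, cayleyOp_mul hs, zero_add]
  have hbQ : ∀ j, cayleyConj H s U j * Q = cayleyConj H s U j := fun j => by
    rw [hQ0, cayleyConj, mul_assoc, cayleyOp_mul hs, add_zero]
  have hQD : Q * D = D := by
    refine (hD.mul_left Q).unique ?_
    convert hD using 2 with n
    simp only [cayleyMean, mul_smul_comm, Finset.mul_sum, mul_add, hQb]
  have hDQ : D * Q = D := by
    refine (hD.mul_right Q).unique ?_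
    convert hD using 2 with n
    simp only [cayleyMean, smul_mul_assoc, Finset.sum_mul, add_mul, hbQ]
  refine ⟨D, ?_, hQD, hDQ, ?_, fun Θ hΘ hHΘ hUΘ =>
    hD.isOddPair hΘ fun n => isOddPair_cayleyMean hΘ hH hHΘ hs hUΘ n⟩
  · refine commute_of_commute_cayley hH (sub_eq_zero.1 ?_)
    exact ((hD.mul_left _).sub (hD.mul_right _)).eq_zero_of_norm_tendsto
      (tendsto_cayley_mul_cayleyMean_sub hs U)
  · have hlim : IsFiniteRankLimit (Q * U - D) := by
      intro ε hε
      obtain ⟨p, hp, hpε⟩ := hU ε hε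
      refine ⟨(Q * U - D) * p, hp.comp_left (Q * U - D).toLinearMap, ?_⟩
      rw [show Q * U - D - (Q * U - D) * p = (Q * U - D) * (1 - p) by rw [mul_sub, mul_one]]
      refine (((IsWeakLimit.const (Q * U)).sub hD).mul_right (1 - p)).norm_le fun n => ?_
      -- `QU - W_j U W_j* = W_j [W_j*, U]`
      have hj : ∀ j : ℤ, ‖(Q * U - cayleyConj H s U j) * (1 - p)‖ ≤ ε := fun j => by
        have e1 : Q * U - cayleyConj H s U j = cayleyOp H s j *
            (borelCalculus H (cayleyPow s (-j)) * U - U * borelCalculus H (cayleyPow s (-j))) := by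
          rw [mul_sub, ← mul_assoc, ← mul_assoc, ← cayleyOp, cayleyOp_mul hs, add_neg_cancel,
            ← hQ0, cayleyConj]
        rw [e1, mul_assoc]
        refine (norm_mul_le _ _).trans ?_
        calc _ ≤ 1 * ε := mul_le_mul (norm_cayleyOp_le hs j)
              (hpε _ (measurable_cayleyPow hs _) (norm_cayleyPow_le s _)
                fun t ht => Set.indicator_of_notMem ht _) (norm_nonneg _) zero_le_one
          _ = ε := one_mul ε
      have hn : (Q * U - cayleyMean H s U n) * (1 - p) = (2 * ((n : ℂ) + 1))⁻¹ •
          ∑ j ∈ Finset.range (n + 1), ((Q * U - cayleyConj H s U j) * (1 - p) +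
            (Q * U - cayleyConj H s U (-j)) * (1 - p)) := by
        have h0 : (2 * ((n : ℂ) + 1)) ≠ 0 := by norm_cast
        have e2 : Q * U = (2 * ((n : ℂ) + 1))⁻¹ •
            ∑ j ∈ Finset.range (n + 1), (Q * U + Q * U) := by
          rw [Finset.sum_const, Finset.card_range, ← two_smul ℂ (Q * U), ← Nat.cast_smul_eq_nsmul ℂ,
            smul_smul, smul_smul]
          push_cast
          rw [mul_assoc, mul_comm ((n : ℂ) + 1) 2, inv_mul_cancel₀ h0, one_smul]
        conv_lhs => rw [e2]
        rw [cayleyMean, ← smul_sub, ← Finset.sum_sub_distrib, smul_mul_assoc, Finset.sum_mul]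
        congr 1
        refine Finset.sum_congr rfl fun j _ => ?_
        rw [add_sub_add_comm, add_mul]
      rw [hn]
      exact norm_sum_div_le (fun j => (norm_add_le _ _).trans (by
        linarith [hj j, hj (-j)])) n
    have := hlim.mul_right Q
    rwa [sub_mul, hDQ] at this

end Averaging

end MobilityGap

namespace MobilityGap

/-! ### Operators commuting with a Hamiltonian of finite multiplicity -/

section BlockDiagonal

variable {E : Type*} [NormedAddCommGroup E] [InnerProductSpace ℂ E] [CompleteSpace E]

local postfix:1000 "†" => ContinuousLinearMap.adjoint

variable {H : E →L[ℂ] E}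

/-- A finite-dimensional invariant subspace of a self-adjoint operator is spanned by eigenvectors. -/
theorem exists_finset_le_sup_eigenspace (hH : IsSelfAdjoint H) (M : Submodule ℂ E)
    [FiniteDimensional ℂ M] (hM : ∀ x ∈ M, H x ∈ M) : ∃ s : Finset ℝ,
      ∀ t : Finset ℝ, s ⊆ t →
        M ≤ t.sup fun a => M ⊓ Module.End.eigenspace (H : E →ₗ[ℂ] E) (a : ℂ) := by
  let T : M →ₗ[ℂ] M := (H : E →ₗ[ℂ] E).restrict hM
  have hT : T.IsSymmetric := fun x y =>
    (ContinuousLinearMap.isSelfAdjoint_iff_isSymmetric.1 hH) x y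
  let b := hT.eigenvectorBasis rfl
  classical
  refine ⟨Finset.univ.image (hT.eigenvalues rfl), fun t ht x hx => ?_⟩
  have hxs := congrArg Subtype.val (b.sum_repr ⟨x, hx⟩)
  rw [← show _ = x from hxs, AddSubmonoidClass.coe_finsetSum]
  refine Submodule.sum_mem _ fun i _ => ?_
  refine Submodule.smul_mem _ _ ?_
  have hi : hT.eigenvalues rfl i ∈ t :=
    ht (Finset.mem_image_of_mem _ (Finset.mem_univ i))
  refine Finset.le_sup (f := fun a : ℝ => M ⊓ Module.End.eigenspace (H : E →ₗ[ℂ] E) (a : ℂ)) hi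
    ⟨(b i).2, Module.End.mem_eigenspace_iff.2 ?_⟩
  exact congrArg Subtype.val (hT.apply_eigenvectorBasis rfl i)

/-- `D` acts on the range of the projection `Q`, commutes with `H`, and `H` has finite
multiplicities on the range of `Q`. Then the kernels of `D` and `D*` in the range of `Q` lie in a
finite-dimensional subspace `N`, a sum of eigenspaces of `H` in the range of `Q`, which is invariant
under `D`, `D*` and every `Θ` commuting with `H` and `Q`. -/
theorem exists_invariant_subspace (hH : IsSelfAdjoint H) {D Q : E →L[ℂ] E}
    (hQ : IsStarProjection Q) (hHQ : H * Q = Q * H) (hHD : H * D = D * H) (hQD : Q * D = D)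
    (hDQ : D * Q = D) (hfin : ∀ a : ℝ, FiniteDimensional ℂ
      (Q.range ⊓ Module.End.eigenspace (H : E →ₗ[ℂ] E) (a : ℂ) : Submodule ℂ E))
    (hk : FiniteDimensional ℂ (D + (1 - Q)).ker) (hk' : FiniteDimensional ℂ ((D + (1 - Q))†).ker) :
    ∃ N : Submodule ℂ E, FiniteDimensional ℂ N ∧ N ≤ Q.range ∧ (D + (1 - Q)).ker ≤ N ∧
      ((D + (1 - Q))†).ker ≤ N ∧ (∀ x ∈ N, D x ∈ N) ∧ (∀ x ∈ N, (D†) x ∈ N) ∧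
      ∀ Θ : E →ₗ⋆[ℂ] E, (∀ ψ, H (Θ ψ) = Θ (H ψ)) → (∀ ψ, Q (Θ ψ) = Θ (Q ψ)) →
        ∀ x ∈ N, Θ x ∈ N := by
  have hQsa : Q† = Q := hQ.isSelfAdjoint.star_eq
  have hHD' : H * D† = D† * H := by
    have := congrArg star hHD
    rw [star_mul, star_mul, hH.star_eq] at this
    exact this.symm
  have hQD' : Q * D† = D† := by
    have := congrArg star hDQ
    rw [star_mul, hQ.isSelfAdjoint.star_eq] at this
    exact this
  have hDQ' : D† * Q = D† := by
    have := congrArg star hQD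
    rw [star_mul, hQ.isSelfAdjoint.star_eq] at this
    exact this
  have hadj : (D + (1 - Q))† = D† + (1 - Q) := by
    rw [map_add, map_sub, hQsa]
    congr 2
    exact star_one _
  have hQQ : ∀ x, Q (Q x) = Q x := fun x => congrArg (fun T => T x) hQ.isIdempotentElem.eq
  have hmemQ : ∀ x, x ∈ Q.range ↔ Q x = x :=
    fun x => ⟨by rintro ⟨y, rfl⟩; exact hQQ y, fun h => ⟨x, h⟩⟩
  -- kernels of operators of this shape are invariant subspaces of the range of `Q`
  have hker : ∀ B : E →L[ℂ] E, Q * B = B → B * Q = B → H * B = B * H →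
      (B + (1 - Q)).ker ≤ Q.range ∧ ∀ x ∈ (B + (1 - Q)).ker, H x ∈ (B + (1 - Q)).ker := by
    intro B h1 h2 h3
    constructor
    · intro x hx
      have hx : B x + (x - Q x) = 0 := hx
      have h4 : Q (B x) = B x := congrArg (fun T => T x) h1
      have h5 := congrArg Q hx
      rw [map_add, map_sub, hQQ, sub_self, add_zero, h4, map_zero] at h5
      rw [h5, zero_add, sub_eq_zero] at hx
      exact (hmemQ x).2 hx.symm
    · intro x hx
      have h4 : H * (B + (1 - Q)) = (B + (1 - Q)) * H := by
        rw [mul_add, add_mul, mul_sub, sub_mul, h3, hHQ, mul_one, one_mul]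
      have h5 : (B + (1 - Q)) (H x) = H ((B + (1 - Q)) x) := (congrArg (fun T => T x) h4).symm
      have hx : (B + (1 - Q)) x = 0 := hx
      rw [hx, map_zero] at h5
      exact h5
  obtain ⟨hM1, hM2⟩ := hker D hQD hDQ hHD
  obtain ⟨hM1', hM2'⟩ := hker (D†) hQD' hDQ' hHD'
  rw [hadj] at hk' ⊢
  obtain ⟨s, hs⟩ := exists_finset_le_sup_eigenspace hH _ hM2
  obtain ⟨s', hs'⟩ := exists_finset_le_sup_eigenspace hH _ hM2'
  classical
  let W : ℝ → Submodule ℂ E := fun a => Q.range ⊓ Module.End.eigenspace (H : E →ₗ[ℂ] E) (a : ℂ)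
  have hWfin : ∀ a, FiniteDimensional ℂ (W a) := hfin
  have hWmem : ∀ a x, x ∈ W a ↔ Q x = x ∧ H x = (a : ℂ) • x := fun a x => by
    rw [Submodule.mem_inf, hmemQ, Module.End.mem_eigenspace_iff]
    rfl
  have hinv : ∀ B : E →L[ℂ] E, Q * B = B → H * B = B * H → ∀ x ∈ (s ∪ s').sup W,
      B x ∈ (s ∪ s').sup W := by
    intro B h1 h2
    suffices h : (s ∪ s').sup W ≤ ((s ∪ s').sup W).comap (B : E →ₗ[ℂ] E) from h
    refine Finset.sup_le fun a ha x hx => ?_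
    refine Finset.le_sup (f := W) ha ((hWmem _ _).2 ⟨congrArg (fun T => T x) h1, ?_⟩)
    have h3 : H (B x) = B (H x) := congrArg (fun T => T x) h2
    change H (B x) = (a : ℂ) • B x
    rw [h3, ((hWmem _ _).1 hx).2, map_smul]
  refine ⟨(s ∪ s').sup W, inferInstance, Finset.sup_le fun a _ => inf_le_left, ?_, ?_,
    hinv D hQD hHD, hinv (D†) hQD' hHD', ?_⟩
  · exact (hs _ Finset.subset_union_left).trans
      (Finset.sup_mono_fun fun a _ => inf_le_inf_right _ hM1)
  · exact (hs' _ Finset.subset_union_right).trans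
      (Finset.sup_mono_fun fun a _ => inf_le_inf_right _ hM1')
  · intro Θ hΘ hΘQ
    suffices h : (s ∪ s').sup W ≤ ((s ∪ s').sup W).comap Θ from h
    refine Finset.sup_le fun a ha x hx => ?_
    obtain ⟨h1, h2⟩ := (hWmem _ _).1 hx
    refine Finset.le_sup (f := W) ha ((hWmem _ _).2 ⟨?_, ?_⟩)
    · rw [hΘQ, h1]
    · rw [hΘ, h2, map_smulₛₗ, Complex.conj_ofReal]

theorem commute_starProjection {D : E →L[ℂ] E} (N : Submodule ℂ E) [N.HasOrthogonalProjection]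
    (h : ∀ x ∈ N, D x ∈ N) (h' : ∀ x ∈ N, (D†) x ∈ N) :
    N.starProjection * D = D * N.starProjection := by
  ext x
  refine Submodule.eq_starProjection_of_mem_orthogonal
    (h _ (Submodule.starProjection_apply_mem N x)) ?_ |>.symm ▸ rfl
  change D x - D (N.starProjection x) ∈ Nᗮ
  rw [← map_sub, Submodule.mem_orthogonal]
  intro v hv
  rw [← ContinuousLinearMap.adjoint_inner_left]
  have h1 := Submodule.sub_starProjection_mem_orthogonal (K := N) x
  rw [Submodule.mem_orthogonal] at h1
  exact h1 _ (h' v hv)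

/-- The index of a block-diagonal operator with finite-dimensional blocks vanishes, and in the
presence of a quaternionic structure its kernel is even-dimensional. -/
theorem finrank_ker_of_commute (hH : IsSelfAdjoint H) {D Q : E →L[ℂ] E}
    (hQ : IsStarProjection Q) (hHQ : H * Q = Q * H) (hHD : H * D = D * H) (hQD : Q * D = D)
    (hDQ : D * Q = D) (hfin : ∀ a : ℝ, FiniteDimensional ℂ
      (Q.range ⊓ Module.End.eigenspace (H : E →ₗ[ℂ] E) (a : ℂ) : Submodule ℂ E))
    (hk : FiniteDimensional ℂ (D + (1 - Q)).ker) (hk' : FiniteDimensional ℂ ((D + (1 - Q))†).ker) :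
    Module.finrank ℂ (D + (1 - Q)).ker = Module.finrank ℂ ((D + (1 - Q))†).ker ∧
    ∀ Θ : E →ₗ⋆[ℂ] E, IsQuaternionic Θ → (∀ ψ, H (Θ ψ) = Θ (H ψ)) → (∀ ψ, Q (Θ ψ) = Θ (Q ψ)) →
      IsOddPair Θ D D → Even (Module.finrank ℂ (D + (1 - Q)).ker) := by
  obtain ⟨N, hN, hNQ, hkN, hkN', hDN, hDN', hΘN⟩ :=
    exists_invariant_subspace hH hQ hHQ hHD hQD hDQ hfin hk hk'
  have hπD := commute_starProjection N hDN hDN'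
  have hπD' := commute_starProjection N hDN' (by rwa [ContinuousLinearMap.adjoint_adjoint])
  have hπ2 : N.starProjection * N.starProjection = N.starProjection :=
    N.isIdempotentElem_starProjection
  have hQadj : (D + (1 - Q))† = D† + (1 - Q) := by
    rw [map_add, map_sub, show Q† = Q from hQ.isSelfAdjoint.star_eq]
    congr 2
    exact star_one _
  have hQN : ∀ x ∈ N, Q x = x := fun x hx => by
    obtain ⟨y, hy⟩ := hNQ hx
    have : Q (Q y) = Q y := congrArg (fun T => T y) hQ.isIdempotentElem.eq
    rw [← show Q y = x from hy, this]
  -- rank-nullity for the restriction of `B` to `N`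
  have key : ∀ B : E →L[ℂ] E, N.starProjection * B = B * N.starProjection →
      (B + (1 - Q)).ker ≤ N →
      Module.finrank ℂ (B + (1 - Q)).ker + Module.finrank ℂ (B * N.starProjection).range
        = Module.finrank ℂ N := by
    intro B hB hle
    have h1 : ((1 : (E →L[ℂ] E)ˣ) : E →L[ℂ] E) = N.starProjection +
        (1 - N.starProjection) * (B * N.starProjection + (1 - N.starProjection)) := by
      have h2 : N.starProjection * (B * N.starProjection) = B * N.starProjection := by
        rw [← mul_assoc, hB, mul_assoc, hπ2]
      rw [Units.val_one, mul_add, sub_mul, one_mul, h2, sub_self, zero_add,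
        N.isIdempotentElem_starProjection.one_sub.eq, add_sub_cancel]
    have h3 := finrank_ker_add_finrank_range N 1 h1
    have h4 : (B * N.starProjection + (1 - N.starProjection)) * ↑(1 : (E →L[ℂ] E)ˣ)⁻¹ *
        N.starProjection = B * N.starProjection := by
      rw [inv_one, Units.val_one, mul_one, add_mul, sub_mul, mul_assoc, hπ2, one_mul, sub_self,
        add_zero]
    have h5 : (B * N.starProjection + (1 - N.starProjection)).ker = (B + (1 - Q)).ker := by
      ext x
      change B (N.starProjection x) + (x - N.starProjection x) = 0 ↔ B x + (x - Q x) = 0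
      have hBN : ∀ y, N.starProjection (B y) = B (N.starProjection y) :=
        fun y => congrArg (fun T => T y) hB
      have hππ : N.starProjection (N.starProjection x) = N.starProjection x :=
        congrArg (fun T => T x) hπ2
      constructor
      · intro hx
        have h6 := congrArg N.starProjection hx
        rw [map_add, hBN, hππ, map_sub, hππ, sub_self, add_zero, map_zero] at h6
        rw [h6, zero_add, sub_eq_zero] at hx
        rw [← hx] at h6
        rw [h6, zero_add, hQN x (by rw [hx]; exact Submodule.starProjection_apply_mem _ _),
          sub_self]
      · intro hx
        have h6 : N.starProjection x = x := Submodule.starProjection_eq_self_iff.2 (hle hx)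
        rw [hQN x (hle hx), sub_self, add_zero] at hx
        rw [h6, hx, sub_self, add_zero]
    rwa [h4, h5] at h3
  have hfinN : N.starProjection.toLinearMap.HasFiniteRange := by
    refine LinearMap.hasFiniteRange_iff_range.2 ((Submodule.fg_iff_finiteDimensional _).2 ?_)
    rw [Submodule.range_starProjection]
    exact hN
  have hXfin : (D * N.starProjection).toLinearMap.HasFiniteRange := hfinN.comp_left D.toLinearMap
  have hadj : (D * N.starProjection)† = D† * N.starProjection := by
    rw [← hπD']
    change star _ = _
    rw [star_mul, (isSelfAdjoint_starProjection N).star_eq]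
    rfl
  constructor
  · have h1 := key D hπD hkN
    have h2 := key (D†) hπD' (hQadj ▸ hkN')
    rw [← hadj, finrank_range_adjoint _ hXfin, ← hQadj] at h2
    omega
  · intro Θ hΘ hHΘ hQΘ hDΘ
    have hNΘ : IsOddPair Θ N.starProjection N.starProjection := by
      refine .starProjection hΘ fun x => ⟨fun hx => ?_, hΘN Θ hHΘ hQΘ x⟩
      have := hΘN Θ hHΘ hQΘ _ hx
      rw [hΘ.sq_eq_neg] at this
      simpa using this
    have h1 := (hDΘ.mul hNΘ)
    rw [hπD] at h1
    have h2 := h1.even_finrank_range hΘ hXfin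
    have h3 := hNΘ.even_finrank_range hΘ hfinN
    rw [Submodule.range_starProjection] at h3
    rw [← key D hπD hkN, Nat.even_add] at h3
    exact h3.2 h2

end BlockDiagonal

/-! ### Gluing two compressions -/

section Compression

variable {E : Type*} [NormedAddCommGroup E] [InnerProductSpace ℂ E]

local postfix:1000 "†" => ContinuousLinearMap.adjoint

/-- The kernel of the direct sum of `A` on the range of `P`, `B` on the range of `Q` and the identity
elsewhere. -/
theorem finrank_ker_add_of_orthogonal {A B P Q : E →L[ℂ] E} (hP : IsIdempotentElem P)
    (hQ : IsIdempotentElem Q) (hPQ : P * Q = 0) (hQP : Q * P = 0) (hPA : P * A = A)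
    (hAP : A * P = A) (hQB : Q * B = B) (hBQ : B * Q = B)
    (hfin : FiniteDimensional ℂ (A + B + (1 - P - Q)).ker) :
    FiniteDimensional ℂ (A + (1 - P)).ker ∧ FiniteDimensional ℂ (B + (1 - Q)).ker ∧
    Module.finrank ℂ (A + B + (1 - P - Q)).ker =
      Module.finrank ℂ (A + (1 - P)).ker + Module.finrank ℂ (B + (1 - Q)).ker := by
  have hPP : ∀ x, P (P x) = P x := fun x => congrArg (fun T => T x) hP.eq
  have hQQ : ∀ x, Q (Q x) = Q x := fun x => congrArg (fun T => T x) hQ.eq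
  have hPQ' : ∀ x, P (Q x) = 0 := fun x => congrArg (fun T => T x) hPQ
  have hQP' : ∀ x, Q (P x) = 0 := fun x => congrArg (fun T => T x) hQP
  have hPA' : ∀ x, P (A x) = A x := fun x => congrArg (fun T => T x) hPA
  have hAP' : ∀ x, A (P x) = A x := fun x => congrArg (fun T => T x) hAP
  have hQB' : ∀ x, Q (B x) = B x := fun x => congrArg (fun T => T x) hQB
  have hBQ' : ∀ x, B (Q x) = B x := fun x => congrArg (fun T => T x) hBQ
  have hPB : ∀ x, P (B x) = 0 := fun x => by rw [← hQB', hPQ']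
  have hQA : ∀ x, Q (A x) = 0 := fun x => by rw [← hPA', hQP']
  have hA : ∀ x, x ∈ (A + (1 - P)).ker ↔ A x = 0 ∧ P x = x := by
    intro x
    change A x + (x - P x) = 0 ↔ _
    refine ⟨fun h => ?_, fun ⟨h1, h2⟩ => by rw [h1, h2, sub_self, add_zero]⟩
    have h1 := congrArg P h
    rw [map_add, map_sub, hPP, hPA', sub_self, add_zero, map_zero] at h1
    rw [h1, zero_add, sub_eq_zero] at h
    exact ⟨h1, h.symm⟩
  have hB : ∀ x, x ∈ (B + (1 - Q)).ker ↔ B x = 0 ∧ Q x = x := by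
    intro x
    change B x + (x - Q x) = 0 ↔ _
    refine ⟨fun h => ?_, fun ⟨h1, h2⟩ => by rw [h1, h2, sub_self, add_zero]⟩
    have h1 := congrArg Q h
    rw [map_add, map_sub, hQQ, hQB', sub_self, add_zero, map_zero] at h1
    rw [h1, zero_add, sub_eq_zero] at h
    exact ⟨h1, h.symm⟩
  have hAB : ∀ x, x ∈ (A + B + (1 - P - Q)).ker ↔ A x = 0 ∧ B x = 0 ∧ P x + Q x = x := by
    intro x
    change A x + B x + (x - P x - Q x) = 0 ↔ _
    refine ⟨fun h => ?_, fun ⟨h1, h2, h3⟩ => by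
      rw [h1, h2, sub_sub, h3, sub_self, add_zero, add_zero]⟩
    have h1 := congrArg P h
    have h2 := congrArg Q h
    simp only [map_add, map_sub, hPP, hPA', hPB, hPQ', sub_self, add_zero, map_zero] at h1
    simp only [map_add, map_sub, hQQ, hQB', hQA, hQP', sub_self, sub_zero, zero_add, add_zero,
      map_zero] at h2
    rw [h1, h2, sub_sub, zero_add, zero_add, sub_eq_zero] at h
    exact ⟨h1, h2, h.symm⟩
  have hsup : (A + (1 - P)).ker ⊔ (B + (1 - Q)).ker = (A + B + (1 - P - Q)).ker := by
    apply le_antisymm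
    · refine sup_le (fun x hx => ?_) fun x hx => ?_
      · obtain ⟨h1, h2⟩ := (hA x).1 hx
        exact (hAB x).2 ⟨h1, by rw [← hBQ', ← h2, hQP', map_zero], by
          rw [← h2, hPP, hQP', add_zero]⟩
      · obtain ⟨h1, h2⟩ := (hB x).1 hx
        exact (hAB x).2 ⟨by rw [← hAP', ← h2, hPQ', map_zero], h1, by
          rw [← h2, hQQ, hPQ', zero_add]⟩
    · intro x hx
      obtain ⟨h1, h2, h3⟩ := (hAB x).1 hx
      rw [← h3]
      exact Submodule.add_mem_sup ((hA _).2 ⟨by rw [hAP', h1], hPP x⟩)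
        ((hB _).2 ⟨by rw [hBQ', h2], hQQ x⟩)
  have hinf : (A + (1 - P)).ker ⊓ (B + (1 - Q)).ker = ⊥ := by
    refine eq_bot_iff.2 fun x hx => ?_
    have h1 := ((hA x).1 hx.1).2
    have h2 := ((hB x).1 hx.2).2
    rw [Submodule.mem_bot, ← h1, ← h2, hPQ']
  have f1 : FiniteDimensional ℂ (A + (1 - P)).ker :=
    Submodule.finiteDimensional_of_le (hsup ▸ le_sup_left)
  have f2 : FiniteDimensional ℂ (B + (1 - Q)).ker :=
    Submodule.finiteDimensional_of_le (hsup ▸ le_sup_right)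
  refine ⟨f1, f2, ?_⟩
  have h := Submodule.finrank_sup_add_finrank_inf_eq (A + (1 - P)).ker (B + (1 - Q)).ker
  rwa [hsup, hinf, finrank_bot, add_zero] at h

/-- The operator `P U P + (1 - P)`: the compression of `U` to the range of the projection `P`,
extended by the identity. -/
def compression (U P : E →L[ℂ] E) : E →L[ℂ] E := P * U * P + (1 - P)

variable [CompleteSpace E] {H : E →L[ℂ] E}

/-- The compression of `U*` is a parametrix. -/
theorem isFredholm_compression {U P : E →L[ℂ] E} (hP : IsStarProjection P) (hU : star U * U = 1)
    (hU' : U * star U = 1) (hPU : IsFiniteRankLimit (P * U - U * P)) :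
    (compression U P).IsFredholm := by
  have hPP : P * P = P := hP.isIdempotentElem.eq
  have hPU' : IsFiniteRankLimit (P * star U - star U * P) := by
    have := hPU.adjoint.neg
    rw [← ContinuousLinearMap.star_eq_adjoint, star_sub, star_mul, star_mul,
      hP.isSelfAdjoint.star_eq, neg_sub] at this
    exact this
  have key : ∀ A B : E →L[ℂ] E, B * A = 1 → IsFiniteRankLimit (P * A - A * P) →
      IsFiniteRankLimit (compression B P * compression A P - 1) := by
    intro A B h1 h2
    have h3 : compression B P * compression A P - 1 = P * B * (P * A - A * P) * P := by
      have e1 : P * B * A * P = P := by rw [mul_assoc P, h1, mul_one, hPP]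
      have e2 : P * (1 - P) = 0 := by rw [mul_sub, mul_one, hPP, sub_self]
      have e3 : (1 - P) * P = 0 := by rw [sub_mul, one_mul, hPP, sub_self]
      have e4 : (1 - P) * (1 - P) = 1 - P := hP.isIdempotentElem.one_sub.eq
      calc compression B P * compression A P - 1
          = P * B * (P * P) * A * P + P * B * (P * (1 - P)) + (1 - P) * P * A * P
            + (1 - P) * (1 - P) - 1 := by unfold compression; noncomm_ring
        _ = P * B * P * A * P - P := by rw [e2, e3, e4, hPP]; noncomm_ring
        _ = P * B * P * A * P - P * B * A * P * P := by rw [e1, hPP]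
        _ = _ := by noncomm_ring
    rw [h3]
    exact (h2.mul_left _).mul_right _
  exact isFredholm_of_parametrix (G := compression (star U) P) (key _ _ hU hPU)
    (key _ _ hU' hPU')

theorem isOddPair_compression {Θ : E →ₗ⋆[ℂ] E} {U P : E →L[ℂ] E} (hU : IsOddPair Θ U U)
    (hP : IsOddPair Θ P P) : IsOddPair Θ (compression U P) (compression U P) := by
  have := ((hP.mul hU).mul hP)
  rw [← mul_assoc] at this
  exact this.add (IsOddPair.one.sub hP)

/-- Enlarging `P` by the range of a projection `Q` on which `U` is, up to a limit of finite-rank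
operators, an operator `D` commuting with a Hamiltonian of finite multiplicities on the range of
`Q`, and by a finite-rank `R`, changes neither the index nor the parity of the kernel. -/
theorem index_compression_eq (hH : IsSelfAdjoint H) {U P Q R D : E →L[ℂ] E}
    (hP : IsStarProjection P) (hQ : IsStarProjection Q) (hR : R.toLinearMap.HasFiniteRange)
    (hPQ : P * Q = 0) (hQP : Q * P = 0) (hHQ : H * Q = Q * H)
    (hfin : ∀ a : ℝ, FiniteDimensional ℂ
      (Q.range ⊓ Module.End.eigenspace (H : E →ₗ[ℂ] E) (a : ℂ) : Submodule ℂ E))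
    (hPU : IsFiniteRankLimit (P * U - U * P)) (hF : (compression U (P + Q + R)).IsFredholm)
    (hHD : H * D = D * H) (hQD : Q * D = D) (hDQ : D * Q = D)
    (hD : IsFiniteRankLimit (Q * U * Q - D)) :
    ((Module.finrank ℂ (compression U (P + Q + R)).ker : ℤ) -
        Module.finrank ℂ ((compression U (P + Q + R))†).ker =
      Module.finrank ℂ (compression U P).ker - Module.finrank ℂ ((compression U P)†).ker) ∧
    ∀ Θ : E →ₗ⋆[ℂ] E, IsQuaternionic Θ → (∀ ψ, H (Θ ψ) = Θ (H ψ)) → IsOddPair Θ U U →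
      IsOddPair Θ P P → IsOddPair Θ Q Q → IsOddPair Θ R R → IsOddPair Θ D D →
      (Module.finrank ℂ (compression U (P + Q + R)).ker : ZMod 2) =
        Module.finrank ℂ (compression U P).ker := by
  set F := compression U (P + Q + R) with hFdef
  set G := P * U * P + D + (1 - P - Q) with hG
  have hRl := IsFiniteRankLimit.of_hasFiniteRange hR
  have hPUQ : IsFiniteRankLimit (P * U * Q) := by
    have := hPU.mul_right Q
    rwa [sub_mul, mul_assoc U, hPQ, mul_zero, sub_zero] at this
  have hQUP : IsFiniteRankLimit (Q * U * P) := by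
    have := (hPU.mul_left Q).neg
    rwa [mul_sub, ← mul_assoc, hQP, zero_mul, zero_sub, neg_neg, ← mul_assoc] at this
  have hK : IsFiniteRankLimit (G - F) := by
    have h1 : G - F = R - (Q * U * Q - D) - P * U * Q - Q * U * P - R * (U * (P + Q + R))
        - (P + Q) * U * R := by
      rw [hG, hFdef, compression]; noncomm_ring
    rw [h1]
    exact ((((hRl.sub hD).sub hPUQ).sub hQUP).sub (hRl.mul_right _)).sub (hRl.mul_left _)
  have hFG : F + (G - F) = G := by abel
  have hGF : G.IsFredholm := by
    have := hK.isFredholm_add hF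
    rwa [hFG] at this
  have hGk : FiniteDimensional ℂ G.ker := hGF.finite_ker
  have hGk' : FiniteDimensional ℂ (G†).ker := by
    obtain ⟨V, W, -, hW, -, hWe, -⟩ := exists_pseudoinverse hGF
    exact hWe ▸ hW
  have hPP : P * P = P := hP.isIdempotentElem.eq
  have hPs : star P = P := hP.isSelfAdjoint.star_eq
  have hQs : star Q = Q := hQ.isSelfAdjoint.star_eq
  have hA1 : P * (P * U * P) = P * U * P := by rw [← mul_assoc, ← mul_assoc, hPP]
  have hA2 : P * U * P * P = P * U * P := by rw [mul_assoc, hPP]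
  obtain ⟨f1, f2, f3⟩ := finrank_ker_add_of_orthogonal hP.isIdempotentElem hQ.isIdempotentElem
    hPQ hQP hA1 hA2 hQD hDQ hGk
  have hGadj : G† = star (P * U * P) + star D + (1 - P - Q) := by
    rw [← ContinuousLinearMap.star_eq_adjoint, hG, star_add, star_add, star_sub, star_sub,
      star_one, hPs, hQs]
  have hLadj : (D + (1 - Q))† = star D + (1 - Q) := by
    rw [← ContinuousLinearMap.star_eq_adjoint, star_add, star_sub, star_one, hQs]
  have hCadj : (compression U P)† = star (P * U * P) + (1 - P) := by
    rw [← ContinuousLinearMap.star_eq_adjoint, compression, star_add, star_sub, star_one, hPs]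
  obtain ⟨f1', f2', f3'⟩ := finrank_ker_add_of_orthogonal (A := star (P * U * P)) (B := star D)
    hP.isIdempotentElem hQ.isIdempotentElem hPQ hQP
    (by conv_lhs => rw [← hPs, ← star_mul, hPs, hA2])
    (by conv_lhs => rw [← hPs, ← star_mul, hPs, hA1])
    (by conv_lhs => rw [← hQs, ← star_mul, hDQ])
    (by conv_lhs => rw [← hQs, ← star_mul, hQD]) (hGadj ▸ hGk')
  rw [← hLadj] at f2' f3'
  rw [← hGadj, ← hCadj] at f3'
  obtain ⟨h0, heven⟩ := finrank_ker_of_commute hH hQ hHQ hHD hQD hDQ hfin f2 f2'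
  constructor
  · have h1 := hK.index_add hF
    rw [hFG] at h1
    rw [← h1, f3, f3', h0, ← compression]
    push_cast
    ring
  · intro Θ hΘ hHΘ hU hPΘ hQΘ hRΘ hDΘ
    have hFo : IsOddPair Θ F F := isOddPair_compression hU ((hPΘ.add hQΘ).add hRΘ)
    have hGo : IsOddPair Θ G G := by
      have := (hPΘ.mul hU).mul hPΘ
      rw [← mul_assoc] at this
      exact (this.add hDΘ).add ((IsOddPair.one.sub hPΘ).sub hQΘ)
    have h1 := hK.parity_add hΘ hF hFo (hGo.sub hFo)
    rw [hFG] at h1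
    have h2 := heven Θ hΘ hHΘ (fun ψ => by
      have := hQΘ ψ
      rwa [← ContinuousLinearMap.star_eq_adjoint, hQs] at this) hDΘ
    rw [← h1, f3, ← compression, Nat.cast_add, (ZMod.natCast_eq_zero_iff_even).2 h2, add_zero]

end Compression

end MobilityGap

namespace MobilityGap

/-! ### Matrix elements and the Schur test -/

section Lattice

variable {N : ℕ}

local postfix:1000 "†" => ContinuousLinearMap.adjoint

theorem matrixElement_apply (A : BulkSpace N →L[ℂ] BulkSpace N) (x y : ℤ × ℤ)
    (v : EuclideanSpace ℂ (Fin N)) : matrixElement A x y v = A (lp.single 2 y v) x := rfl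

theorem hasSum_single_bulkSpace (ψ : BulkSpace N) :
    HasSum (fun x => (lp.single 2 x (ψ x) : BulkSpace N)) ψ :=
  lp.hasSum_single ENNReal.ofNat_ne_top ψ

theorem norm_matrixElement_le (A : BulkSpace N →L[ℂ] BulkSpace N) (x y : ℤ × ℤ) :
    ‖matrixElement A x y‖ ≤ ‖A‖ := by
  refine ContinuousLinearMap.opNorm_le_bound _ (norm_nonneg _) fun v => ?_
  rw [matrixElement_apply]
  refine (lp.norm_apply_le_norm two_ne_zero _ x).trans ((A.le_opNorm _).trans_eq ?_)
  rw [lp.norm_single (by norm_num)]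

/-- The Schur test for a kernel dominated by a summable convolution kernel. -/
theorem norm_le_of_norm_matrixElement_le {A : BulkSpace N →L[ℂ] BulkSpace N} {g : ℤ × ℤ → ℝ}
    (hg : Summable g) (hg0 : ∀ z, 0 ≤ g z) (hgs : ∀ z, g (-z) = g z)
    (hA : ∀ x y, ‖matrixElement A x y‖ ≤ g (x - y)) {S : ℝ} (hS0 : 0 < S) (hS : ∑' z, g z ≤ S) :
    ‖A‖ ≤ S := by
  have hsum : ∀ (s : Finset (ℤ × ℤ)) (x : ℤ × ℤ), ∑ y ∈ s, g (x - y) ≤ S := fun s x => by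
    have h1 : Summable fun y => g (x - y) := (Equiv.subLeft x).summable_iff.2 hg
    have h2 : ∑' y, g (x - y) = ∑' z, g z := (Equiv.subLeft x).tsum_eq g
    exact (h1.sum_le_tsum s fun y _ => hg0 _).trans (h2.trans_le hS)
  -- the quadratic estimate for finitely supported vectors, by `2 a b ≤ a² + b²`
  have hfin : ∀ (φ ψ : BulkSpace N) (s : Finset (ℤ × ℤ)),
      ‖⟪∑ x ∈ s, (lp.single 2 x (φ x) : BulkSpace N),
        A (∑ y ∈ s, (lp.single 2 y (ψ y) : BulkSpace N))⟫_ℂ‖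
        ≤ S / 2 * (‖φ‖ ^ 2 + ‖ψ‖ ^ 2) := by
    intro φ ψ s
    have hn : ∀ χ : BulkSpace N, ∑ x ∈ s, ‖χ x‖ ^ 2 ≤ ‖χ‖ ^ 2 := fun χ => by
      have := lp.sum_rpow_le_norm_rpow (p := 2) (by norm_num) χ s
      simpa using this
    have hterm : ∀ x y, ‖⟪φ x, matrixElement A x y (ψ y)⟫_ℂ‖
        ≤ g (x - y) / 2 * ‖φ x‖ ^ 2 + g (x - y) / 2 * ‖ψ y‖ ^ 2 := fun x y => by
      have h1 : ‖matrixElement A x y (ψ y)‖ ≤ g (x - y) * ‖ψ y‖ :=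
        ContinuousLinearMap.le_of_opNorm_le _ (hA x y) _
      have h2 := (norm_inner_le_norm (𝕜 := ℂ) (φ x) (matrixElement A x y (ψ y))).trans
        (mul_le_mul_of_nonneg_left h1 (norm_nonneg _))
      nlinarith [mul_nonneg (hg0 (x - y)) (sq_nonneg (‖φ x‖ - ‖ψ y‖))]
    rw [map_sum, sum_inner]
    simp_rw [inner_sum, lp.inner_single_left, ← matrixElement_apply]
    calc ‖∑ x ∈ s, ∑ y ∈ s, ⟪φ x, matrixElement A x y (ψ y)⟫_ℂ‖
        ≤ ∑ x ∈ s, ∑ y ∈ s, (g (x - y) / 2 * ‖φ x‖ ^ 2 + g (x - y) / 2 * ‖ψ y‖ ^ 2) :=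
          (norm_sum_le _ _).trans (Finset.sum_le_sum fun x _ =>
            (norm_sum_le _ _).trans (Finset.sum_le_sum fun y _ => hterm x y))
      _ = ∑ x ∈ s, (∑ y ∈ s, g (x - y)) / 2 * ‖φ x‖ ^ 2 +
          ∑ y ∈ s, (∑ x ∈ s, g (y - x)) / 2 * ‖ψ y‖ ^ 2 := by
          simp_rw [Finset.sum_add_distrib]
          congr 1
          · simp_rw [Finset.sum_div, Finset.sum_mul]
          · rw [Finset.sum_comm]
            simp_rw [Finset.sum_div, Finset.sum_mul]
            refine Finset.sum_congr rfl fun y _ => Finset.sum_congr rfl fun x _ => ?_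
            rw [← hgs, neg_sub]
      _ ≤ ∑ x ∈ s, S / 2 * ‖φ x‖ ^ 2 + ∑ y ∈ s, S / 2 * ‖ψ y‖ ^ 2 := by
          gcongr with x hx y hy
          · exact hsum s x
          · exact hsum s y
      _ ≤ S / 2 * (‖φ‖ ^ 2 + ‖ψ‖ ^ 2) := by
          rw [← Finset.mul_sum, ← Finset.mul_sum, mul_add]
          gcongr
          · exact hn φ
          · exact hn ψ
  have hall : ∀ φ ψ : BulkSpace N, ‖⟪φ, A ψ⟫_ℂ‖ ≤ S / 2 * (‖φ‖ ^ 2 + ‖ψ‖ ^ 2) := by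
    intro φ ψ
    have h1 : Tendsto (fun s : Finset (ℤ × ℤ) => ∑ x ∈ s, (lp.single 2 x (φ x) : BulkSpace N))
      atTop (𝓝 φ) := hasSum_single_bulkSpace φ
    have h2 : Tendsto (fun s : Finset (ℤ × ℤ) => ∑ x ∈ s, (lp.single 2 x (ψ x) : BulkSpace N))
      atTop (𝓝 ψ) := hasSum_single_bulkSpace ψ
    exact le_of_tendsto (h1.inner ((A.continuous.tendsto _).comp h2)).norm
      (Eventually.of_forall (hfin φ ψ))
  refine ContinuousLinearMap.opNorm_le_bound _ hS0.le fun ψ => ?_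
  have h1 := hall (((S⁻¹ : ℝ) : ℂ) • A ψ) ψ
  rw [inner_smul_left, inner_self_eq_norm_sq_to_K, norm_smul, Complex.conj_ofReal] at h1
  have h2 : ‖((S⁻¹ : ℝ) : ℂ) * ((‖A ψ‖ : ℂ)) ^ 2‖ = S⁻¹ * ‖A ψ‖ ^ 2 := by
    simp [abs_of_pos hS0]
  have h3 : ‖((S⁻¹ : ℝ) : ℂ)‖ = S⁻¹ := by simp [abs_of_pos hS0]
  rw [h3] at h1
  have h1 : S⁻¹ * ‖A ψ‖ ^ 2 ≤ S / 2 * ((S⁻¹ * ‖A ψ‖) ^ 2 + ‖ψ‖ ^ 2) := h2 ▸ h1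
  have h4 : ‖A ψ‖ ^ 2 ≤ (S * ‖ψ‖) ^ 2 := by
    have h5 := mul_le_mul_of_nonneg_left h1 (by positivity : (0 : ℝ) ≤ 2 * S)
    have h6 : 2 * S * (S⁻¹ * ‖A ψ‖ ^ 2) = 2 * ‖A ψ‖ ^ 2 := by field_simp
    have h7 : 2 * S * (S / 2 * ((S⁻¹ * ‖A ψ‖) ^ 2 + ‖ψ‖ ^ 2)) = ‖A ψ‖ ^ 2 + (S * ‖ψ‖) ^ 2 := by
      field_simp
    linarith
  exact (pow_le_pow_iff_left₀ (norm_nonneg _) (by positivity) two_ne_zero).1 h4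

/-- The summable convolution kernel used in the Schur test. -/
theorem summable_inv_one_add_norm_pow_four :
    Summable fun z : ℤ × ℤ => ((1 + ‖z‖) ^ 4)⁻¹ := by
  have h1 : Summable fun n : ℤ => ((1 + ‖n‖) ^ 2)⁻¹ := by
    have h : Summable fun n : ℕ => (((1 : ℝ) + n) ^ 2)⁻¹ := by
      have := (summable_nat_add_iff 1).2 (Real.summable_nat_pow_inv (p := 2).2 one_lt_two)
      refine this.congr fun n => ?_
      push_cast
      rw [add_comm]
    refine summable_int_iff_summable_nat_and_neg.2 ⟨?_, ?_⟩ <;>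
    · refine h.congr fun n => ?_
      simp
  refine Summable.of_nonneg_of_le (fun z => by positivity) (fun z => ?_)
    (h1.mul_of_nonneg h1 (fun n => by positivity) fun n => by positivity)
  rw [← mul_inv]
  gcongr
  have e1 : ‖z.1‖ ≤ ‖z‖ := norm_fst_le z
  have e2 : ‖z.2‖ ≤ ‖z‖ := norm_snd_le z
  calc (1 + ‖z.1‖) ^ 2 * (1 + ‖z.2‖) ^ 2 ≤ (1 + ‖z‖) ^ 2 * (1 + ‖z‖) ^ 2 := by gcongr
    _ = (1 + ‖z‖) ^ 4 := by ring

/-- The projection onto the vectors supported in the finite set `s`. -/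
noncomputable def siteProjection (N : ℕ) (s : Finset (ℤ × ℤ)) : BulkSpace N →L[ℂ] BulkSpace N :=
  ∑ y ∈ s, lp.singleContinuousLinearMap ℂ (fun _ : ℤ × ℤ => EuclideanSpace ℂ (Fin N)) 2 y ∘L
    lp.evalCLM ℂ (fun _ : ℤ × ℤ => EuclideanSpace ℂ (Fin N)) 2 y

theorem siteProjection_apply (s : Finset (ℤ × ℤ)) (ψ : BulkSpace N) :
    siteProjection N s ψ = ∑ y ∈ s, (lp.single 2 y (ψ y) : BulkSpace N) := by
  rw [siteProjection, sum_apply]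
  rfl

theorem hasFiniteRange_siteProjection (s : Finset (ℤ × ℤ)) :
    (siteProjection N s).toLinearMap.HasFiniteRange := by
  classical
  induction s using Finset.induction_on with
  | empty => exact LinearMap.HasFiniteRange.zero
  | insert y s hy ih =>
    rw [siteProjection, Finset.sum_insert hy]
    exact (LinearMap.HasFiniteRange.comp_right
      (LinearMap.HasFiniteRange.of_finite_dom
        (f := (lp.singleContinuousLinearMap ℂ
          (fun _ : ℤ × ℤ => EuclideanSpace ℂ (Fin N)) 2 y).toLinearMap)) _).add ih

open Classical in
theorem matrixElement_mul_one_sub_siteProjection (A : BulkSpace N →L[ℂ] BulkSpace N)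
    (s : Finset (ℤ × ℤ)) (x y : ℤ × ℤ) :
    matrixElement (A * (1 - siteProjection N s)) x y =
      if y ∈ s then 0 else matrixElement A x y := by
  ext1 v
  rw [matrixElement_apply]
  have h : siteProjection N s (lp.single 2 y v) = if y ∈ s then lp.single 2 y v else 0 := by
    rw [siteProjection_apply]
    have : ∀ z ∈ s, (lp.single 2 z ((lp.single 2 y v : BulkSpace N) z) : BulkSpace N)
        = if z = y then lp.single 2 y v else 0 := fun z _ => by
      split_ifs with hz
      · rw [hz, lp.single_apply_self]
      · rw [lp.single_apply_ne _ _ _ hz, lp.single_zero]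
    rw [Finset.sum_congr rfl this, Finset.sum_ite_eq']
  have h2 : (A * (1 - siteProjection N s)) (lp.single 2 y v)
      = A (lp.single 2 y v - siteProjection N s (lp.single 2 y v)) := rfl
  rw [h2, h]
  split_ifs with hy
  · rw [sub_self, map_zero]; rfl
  · rw [sub_zero]; rfl

/-! ### Flux insertion -/

/-- The value of `exp(i arg(X₁ + i X₂))` at a site. -/
noncomputable def fluxPhase (x : ℤ × ℤ) : ℂ :=
  Complex.exp (Complex.I * (Complex.arg ((x.1 : ℂ) + Complex.I * (x.2 : ℂ)) : ℂ))

theorem norm_fluxPhase (x : ℤ × ℤ) : ‖fluxPhase x‖ = 1 := by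
  rw [fluxPhase, mul_comm Complex.I, Complex.norm_exp_ofReal_mul_I]

theorem fluxInsertion_apply (ψ : BulkSpace N) (x : ℤ × ℤ) :
    fluxInsertion N ψ x = fluxPhase x • ψ x := rfl

theorem fluxInsertion_single (x : ℤ × ℤ) (v : EuclideanSpace ℂ (Fin N)) :
    fluxInsertion N (lp.single 2 x v) = fluxPhase x • lp.single 2 x v := by
  ext1
  funext y
  rw [fluxInsertion_apply, lp.coeFn_smul, Pi.smul_apply]
  rcases eq_or_ne y x with rfl | h
  · rfl
  · rw [lp.single_apply_ne _ _ _ h, smul_zero, smul_zero]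

theorem star_fluxInsertion_apply (ψ : BulkSpace N) (x : ℤ × ℤ) :
    (star (fluxInsertion N)) ψ x = (starRingEnd ℂ) (fluxPhase x) • ψ x := by
  refine ext_inner_left ℂ fun v => ?_
  have h : ⟪(lp.single 2 x v : BulkSpace N), star (fluxInsertion N) ψ⟫_ℂ
      = (starRingEnd ℂ) (fluxPhase x) * ⟪(lp.single 2 x v : BulkSpace N), ψ⟫_ℂ := by
    rw [ContinuousLinearMap.star_eq_adjoint, ContinuousLinearMap.adjoint_inner_right,
      fluxInsertion_single, inner_smul_left]
  rw [lp.inner_single_left, lp.inner_single_left] at h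
  rw [inner_smul_right]
  exact h

theorem star_fluxInsertion_mul : star (fluxInsertion N) * fluxInsertion N = 1 := by
  ext1 ψ
  ext1
  funext x
  change star (fluxInsertion N) (fluxInsertion N ψ) x = ψ x
  rw [star_fluxInsertion_apply, fluxInsertion_apply, smul_smul, mul_comm, Complex.mul_conj,
    Complex.normSq_eq_norm_sq, norm_fluxPhase]
  simp

theorem fluxInsertion_mul_star : fluxInsertion N * star (fluxInsertion N) = 1 := by
  ext1 ψ
  ext1
  funext x
  change fluxInsertion N (star (fluxInsertion N) ψ) x = ψ x
  rw [fluxInsertion_apply, star_fluxInsertion_apply, smul_smul, Complex.mul_conj,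
    Complex.normSq_eq_norm_sq, norm_fluxPhase]
  simp

theorem matrixElement_commutator_fluxInsertion (A : BulkSpace N →L[ℂ] BulkSpace N)
    (x y : ℤ × ℤ) : matrixElement (A * fluxInsertion N - fluxInsertion N * A) x y =
      (fluxPhase y - fluxPhase x) • matrixElement A x y := by
  ext1 v
  rw [matrixElement_apply, smul_apply, matrixElement_apply]
  change (A (fluxInsertion N (lp.single 2 y v)) - fluxInsertion N (A (lp.single 2 y v))) x = _
  rw [fluxInsertion_single, map_smul, lp.coeFn_sub, Pi.sub_apply, fluxInsertion_apply,
    lp.coeFn_smul, Pi.smul_apply, sub_smul]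

/-- The phase varies by `O(‖x - y‖ / ‖y‖)`. The summand `1` covers the origin and uses that distinct
sites have distance at least `1`. -/
theorem norm_fluxPhase_sub_le (x y : ℤ × ℤ) :
    (1 + ‖y‖) * ‖fluxPhase y - fluxPhase x‖ ≤ 6 * ‖x - y‖ := by
  set z : ℤ × ℤ → ℂ := fun x => (x.1 : ℂ) + Complex.I * (x.2 : ℂ) with hz
  have hre : ∀ x, (z x).re = x.1 := fun x => by simp [hz]
  have him : ∀ x, (z x).im = x.2 := fun x => by simp [hz]
  have hpol : ∀ x, (‖z x‖ : ℂ) * fluxPhase x = z x := fun x => by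
    rw [fluxPhase, mul_comm Complex.I]
    exact Complex.norm_mul_exp_arg_mul_I _
  have hlow : ‖y‖ ≤ ‖z y‖ := by
    refine max_le ?_ ?_
    · have := Complex.abs_re_le_norm (z y)
      rwa [hre, ← Real.norm_eq_abs, Int.norm_cast_real] at this
    · have := Complex.abs_im_le_norm (z y)
      rwa [him, ← Real.norm_eq_abs, Int.norm_cast_real] at this
  have hup : ‖z x - z y‖ ≤ 2 * ‖x - y‖ := by
    have h := Complex.norm_le_abs_re_add_abs_im (z x - z y)
    have h1 : ‖(x - y).1‖ ≤ ‖x - y‖ := norm_fst_le _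
    have h2 : ‖(x - y).2‖ ≤ ‖x - y‖ := norm_snd_le _
    rw [Complex.sub_re, Complex.sub_im, hre, hre, him, him] at h
    rw [Int.norm_eq_abs, Prod.fst_sub] at h1
    rw [Int.norm_eq_abs, Prod.snd_sub] at h2
    push_cast at h1 h2
    linarith
  -- `z = |z| U` holds also at the origin
  have hfar : ‖z y‖ * ‖fluxPhase y - fluxPhase x‖ ≤ 2 * ‖z x - z y‖ := by
    have h1 : (‖z y‖ : ℂ) * (fluxPhase y - fluxPhase x)
        = (z y - z x) + ((‖z x‖ - ‖z y‖ : ℝ) : ℂ) * fluxPhase x := by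
      rw [mul_sub, hpol, Complex.ofReal_sub, sub_mul, hpol]; ring
    have h2 := congrArg norm h1
    rw [norm_mul, Complex.norm_real, norm_norm] at h2
    rw [h2]
    refine (norm_add_le _ _).trans ?_
    rw [norm_mul, norm_fluxPhase, Complex.norm_real, Real.norm_eq_abs, norm_sub_rev (z y)]
    linarith [abs_norm_sub_norm_le (z x) (z y)]
  have hnear : ‖fluxPhase y - fluxPhase x‖ ≤ 2 * ‖x - y‖ := by
    rcases eq_or_ne x y with rfl | hxy
    · simp
    have h1 : (1 : ℝ) ≤ ‖x - y‖ := by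
      have hint : ∀ n : ℤ, n ≠ 0 → (1 : ℝ) ≤ ‖n‖ := fun n hn => by
        rw [Int.norm_eq_abs]
        exact_mod_cast Int.one_le_abs hn
      by_cases h : (x - y).1 = 0
      · refine (hint _ fun h' => hxy ?_).trans (norm_snd_le (x - y))
        exact sub_eq_zero.1 (Prod.ext h h')
      · exact (hint _ h).trans (norm_fst_le (x - y))
    have h2 := norm_sub_le (fluxPhase y) (fluxPhase x)
    rw [norm_fluxPhase, norm_fluxPhase] at h2
    linarith
  have := mul_le_mul_of_nonneg_right hlow (norm_nonneg (fluxPhase y - fluxPhase x))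
  rw [add_mul, one_mul]
  linarith

/-- A uniformly weakly local family of contractions commutes with the flux insertion up to
operators that are small away from a common finite set of sites. The contraction property provides
the bound `1` for the matrix elements, which is what makes it possible to pay for the factor
`(1 + ‖x‖) ^ ν` by a power of the decaying phase difference. -/
theorem IsUniformlyWeaklyLocal.exists_commutator_le {𝒮 : Set (BulkSpace N →L[ℂ] BulkSpace N)}
    (h𝒮 : IsUniformlyWeaklyLocal 𝒮) (h1 : ∀ A ∈ 𝒮, ‖A‖ ≤ 1) {ε : ℝ} (hε : 0 < ε) :
    ∃ p : BulkSpace N →L[ℂ] BulkSpace N, p.toLinearMap.HasFiniteRange ∧ ∀ A ∈ 𝒮,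
      ‖(A * fluxInsertion N - fluxInsertion N * A) * (1 - p)‖ ≤ ε := by
  obtain ⟨ν, hν⟩ := h𝒮
  obtain ⟨m, ⟨C, hC⟩, hm⟩ := (hν.and (eventually_ge_atTop (ν + 5 * (ν + 1)))).exists
  set g : ℤ × ℤ → ℝ := fun z => ((1 + ‖z‖) ^ 4)⁻¹ with hg
  have hgs : Summable g := summable_inv_one_add_norm_pow_four
  have hg0 : ∀ z, 0 ≤ g z := fun z => by positivity
  set S : ℝ := ∑' z, g z + 1 with hS
  have hS0 : 0 < S := by
    have : 0 ≤ ∑' z, g z := tsum_nonneg hg0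
    linarith
  set δ : ℝ := ε / S with hδ
  have hδ0 : 0 < δ := by positivity
  set C' : ℝ := |C| * 6 ^ (ν + 1) with hC'
  obtain ⟨L, hL⟩ : ∃ L : ℝ, 0 ≤ L ∧ C' ≤ δ ^ (ν + 1) * L :=
    ⟨C' / δ ^ (ν + 1), by positivity, by rw [mul_div_cancel₀ _ (by positivity)]⟩
  have hbox : {y : ℤ × ℤ | ‖y‖ ≤ L}.Finite := by
    have := (isCompact_closedBall (0 : ℤ × ℤ) L).finite_of_discrete
    simpa [Metric.closedBall] using this
  refine ⟨siteProjection N hbox.toFinset, hasFiniteRange_siteProjection _, fun A hA => ?_⟩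
  refine norm_le_of_norm_matrixElement_le (g := fun z => δ * g z) (hgs.mul_left δ)
    (fun z => mul_nonneg hδ0.le (hg0 z)) (fun z => by simp [hg]) (fun x y => ?_) hε ?_
  swap
  · rw [tsum_mul_left, hδ, div_mul_eq_mul_div, div_le_iff₀ hS0]
    exact mul_le_mul_of_nonneg_left (by linarith) hε.le
  rw [matrixElement_mul_one_sub_siteProjection]
  split_ifs with hy
  · rw [norm_zero]
    exact mul_nonneg hδ0.le (hg0 _)
  have hy : L < ‖y‖ := by simpa using hy
  rw [matrixElement_commutator_fluxInsertion, norm_smul]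
  set a : ℝ := ‖matrixElement A x y‖ with ha
  set d : ℝ := ‖fluxPhase y - fluxPhase x‖ with hd
  set r : ℝ := 1 + ‖x - y‖ with hr
  set t : ℝ := 1 + ‖y‖ with ht
  have hr1 : 1 ≤ r := by linarith [norm_nonneg (x - y)]
  have ht1 : 1 ≤ t := by linarith [norm_nonneg y]
  have ha0 : 0 ≤ a := norm_nonneg _
  have hd0 : 0 ≤ d := norm_nonneg _
  have ha1 : a ≤ 1 := (norm_matrixElement_le A x y).trans (h1 A hA)
  have hdt : d * t ≤ 6 * r := by
    have := norm_fluxPhase_sub_le x y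
    rw [mul_comm]
    exact this.trans (by linarith)
  have hx : 1 + ‖x‖ ≤ r * t := by
    have : ‖x‖ ≤ ‖x - y‖ + ‖y‖ := by simpa using norm_add_le (x - y) y
    rw [hr, ht]
    nlinarith [norm_nonneg (x - y), norm_nonneg y]
  have ha2 : a * r ^ m ≤ |C| * (r * t) ^ ν := by
    have h2 := hC A hA x y
    have h3 : a ≤ |C| * (r ^ m)⁻¹ * (r * t) ^ ν := by
      refine h2.trans ?_
      gcongr
      exact le_abs_self C
    calc a * r ^ m ≤ |C| * (r ^ m)⁻¹ * (r * t) ^ ν * r ^ m := by gcongr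
      _ = |C| * (r * t) ^ ν := by field_simp
  -- the decay exceeds the growth `ν` only after paying with a power `ν + 1` of the small phase
  -- difference, so the bound is obtained for the power `ν + 1` of the matrix element
  suffices h : (d * a) ^ (ν + 1) ≤ (δ * g (x - y)) ^ (ν + 1) from
    (pow_le_pow_iff_left₀ (by positivity) (by positivity) (Nat.succ_ne_zero ν)).1 h
  have hgr : g (x - y) = (r ^ 4)⁻¹ := rfl
  have hkey : (d * a) ^ (ν + 1) * (r ^ (ν + 5 * (ν + 1)) * t ^ (ν + 1))
      ≤ C' * r ^ (ν + (ν + 1)) * t ^ ν := by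
    calc (d * a) ^ (ν + 1) * (r ^ (ν + 5 * (ν + 1)) * t ^ (ν + 1))
        = a ^ (ν + 1) * r ^ (ν + 5 * (ν + 1)) * (d * t) ^ (ν + 1) := by ring_nf
      _ ≤ a * r ^ m * (6 * r) ^ (ν + 1) := by
          gcongr
          exact pow_le_of_le_one ha0 ha1 (Nat.succ_ne_zero ν)
      _ ≤ |C| * (r * t) ^ ν * (6 * r) ^ (ν + 1) := by gcongr
      _ = C' * r ^ (ν + (ν + 1)) * t ^ ν := by rw [hC']; ring_nf
  have hC'' : C' ≤ δ ^ (ν + 1) * t := hL.2.trans (by gcongr; linarith)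
  have h2 : (d * a) ^ (ν + 1) * (r ^ (ν + 5 * (ν + 1)) * t ^ (ν + 1))
      ≤ (δ * g (x - y)) ^ (ν + 1) * (r ^ (ν + 5 * (ν + 1)) * t ^ (ν + 1)) := by
    refine hkey.trans ?_
    calc C' * r ^ (ν + (ν + 1)) * t ^ ν
        ≤ δ ^ (ν + 1) * t * r ^ (ν + (ν + 1)) * t ^ ν := by gcongr
      _ = (δ * g (x - y)) ^ (ν + 1) * (r ^ (ν + 5 * (ν + 1)) * t ^ (ν + 1)) := by
          rw [hgr]
          have h3 : r ^ (ν + 5 * (ν + 1)) = r ^ (ν + (ν + 1)) * (r ^ 4) ^ (ν + 1) := by ring_nf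
          rw [h3, mul_pow, inv_pow]
          field_simp
          rw [pow_succ']
  exact le_of_mul_le_mul_right h2 (by positivity)

/-! ### Time reversal on the lattice -/

theorem IsTimeReversal.isQuaternionic {Θ : BulkSpace N →ₗ⋆[ℂ] BulkSpace N}
    (hΘ : IsTimeReversal Θ) : IsQuaternionic Θ := ⟨hΘ.inner_map, hΘ.sq_eq_neg⟩

/-- Time reversal maps vectors supported at a single site to such vectors. -/
theorem IsTimeReversal.map_single_apply {Θ : BulkSpace N →ₗ⋆[ℂ] BulkSpace N}
    (hΘ : IsTimeReversal Θ) {x y : ℤ × ℤ} (hxy : y ≠ x) (v : EuclideanSpace ℂ (Fin N)) :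
    Θ (lp.single 2 x v) y = 0 := by
  have hs : ∀ (n : ℤ × ℤ → ℤ) (y : ℤ × ℤ), ((n x : ℂ) • (lp.single 2 x v : BulkSpace N)) y
      = (n y : ℂ) • (lp.single 2 x v : BulkSpace N) y := fun n y => by
    rw [lp.coeFn_smul, Pi.smul_apply]
    rcases eq_or_ne y x with rfl | h
    · rfl
    · rw [lp.single_apply_ne _ _ _ h, smul_zero, smul_zero]
  have hmap : ∀ n : ℤ × ℤ → ℤ, Θ ((n x : ℂ) • (lp.single 2 x v : BulkSpace N)) y
      = (n x : ℂ) • Θ (lp.single 2 x v) y := fun n => by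
    rw [map_smulₛₗ, map_intCast]; rfl
  have h1 := (hmap Prod.fst).symm.trans (hΘ.comm_position_one _ _ (hs Prod.fst) y)
  have h2 := (hmap Prod.snd).symm.trans (hΘ.comm_position_two _ _ (hs Prod.snd) y)
  rw [← sub_eq_zero, ← sub_smul, smul_eq_zero, sub_eq_zero, Int.cast_inj] at h1 h2
  by_contra h0
  exact hxy (Prod.ext (h1.resolve_right h0).symm (h2.resolve_right h0).symm)

/-- The flux insertion is odd: `U Θ = Θ U*`. -/
theorem IsTimeReversal.isOddPair_fluxInsertion {Θ : BulkSpace N →ₗ⋆[ℂ] BulkSpace N}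
    (hΘ : IsTimeReversal Θ) : IsOddPair Θ (fluxInsertion N) (fluxInsertion N) := by
  intro ψ
  have hc : Continuous Θ :=
    (AddMonoidHomClass.isometry_of_norm Θ hΘ.isQuaternionic.norm_map).continuous
  have hterm : ∀ x, fluxInsertion N (Θ (lp.single 2 x (ψ x)))
      = Θ (((fluxInsertion N)†) (lp.single 2 x (ψ x))) := fun x => by
    have h1 : ((fluxInsertion N)†) (lp.single 2 x (ψ x))
        = (starRingEnd ℂ) (fluxPhase x) • lp.single 2 x (ψ x) := by
      ext1
      funext y
      rw [← ContinuousLinearMap.star_eq_adjoint, star_fluxInsertion_apply, lp.coeFn_smul,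
        Pi.smul_apply]
      rcases eq_or_ne y x with rfl | h
      · rfl
      · rw [lp.single_apply_ne _ _ _ h, smul_zero, smul_zero]
    rw [h1, map_smulₛₗ, Complex.conj_conj]
    ext1
    funext y
    rw [fluxInsertion_apply, lp.coeFn_smul, Pi.smul_apply]
    rcases eq_or_ne y x with rfl | h
    · rfl
    · rw [hΘ.map_single_apply h, smul_zero, smul_zero]
  have hl := ((hasSum_single_bulkSpace ψ).map Θ hc).mapL (fluxInsertion N)
  have hr := ((hasSum_single_bulkSpace ψ).mapL ((fluxInsertion N)†)).map Θ hc
  exact hl.unique (hr.congr_fun hterm)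

end Lattice

end MobilityGap

namespace MobilityGap

/-! ### Spectral projections of a mobility-gapped Hamiltonian -/

section SpectralProjection

variable {E : Type*} [NormedAddCommGroup E] [InnerProductSpace ℂ E] [CompleteSpace E]

theorem isStarProjection_borelCalculus (H : E →L[ℂ] E) {s : Set ℝ} (hs : MeasurableSet s) :
    IsStarProjection (borelCalculus H (s.indicator 1)) where
  isIdempotentElem := by
    rw [IsIdempotentElem, ← borelCalculus_mul (.indicator_one hs) (.indicator_one hs),
      ← Set.inter_indicator_one, Set.inter_self]
  isSelfAdjoint := by
    rw [IsSelfAdjoint, ← borelCalculus_star (.indicator_one hs)]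
    congr 1
    funext t
    by_cases ht : t ∈ s <;> simp [ht]

theorem borelCalculus_mul_eq_zero (H : E →L[ℂ] E) {s t : Set ℝ} (hs : MeasurableSet s)
    (ht : MeasurableSet t) (hst : Disjoint s t) :
    borelCalculus H (s.indicator 1) * borelCalculus H (t.indicator 1) = 0 := by
  rw [← borelCalculus_mul (.indicator_one hs) (.indicator_one ht), ← Set.inter_indicator_one,
    hst.inter_eq, Set.indicator_empty]
  rw [show (fun _ => 0 : ℝ → ℂ) = (0 : ℂ) • (1 : ℝ → ℂ) by funext; simp,
    borelCalculus_smul .one, zero_smul]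

theorem borelCalculus_union (H : E →L[ℂ] E) {s t : Set ℝ} (hs : MeasurableSet s)
    (ht : MeasurableSet t) (hst : Disjoint s t) :
    borelCalculus H ((s ∪ t).indicator 1) =
      borelCalculus H (s.indicator 1) + borelCalculus H (t.indicator 1) := by
  rw [← borelCalculus_add (.indicator_one hs) (.indicator_one ht)]
  congr 1
  exact Set.indicator_union_of_disjoint hst _

theorem hasFiniteRange_borelCalculus_singleton {H : E →L[ℂ] E} (hH : IsSelfAdjoint H) {a : ℝ}
    (ha : FiniteDimensional ℂ (Module.End.eigenspace (H : E →ₗ[ℂ] E) (a : ℂ))) :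
    (borelCalculus H (({a} : Set ℝ).indicator 1)).toLinearMap.HasFiniteRange := by
  refine LinearMap.hasFiniteRange_iff_range.2 ((Submodule.fg_iff_finiteDimensional _).2 ?_)
  refine Submodule.finiteDimensional_of_le
    (S₂ := Module.End.eigenspace (H : E →ₗ[ℂ] E) (a : ℂ)) ?_
  rintro _ ⟨ψ, rfl⟩
  exact Module.End.mem_eigenspace_iff.2 (apply_borelCalculus_singleton hH a ψ)

end SpectralProjection

section MobilityGapped

variable {N : ℕ} {H : BulkSpace N →L[ℂ] BulkSpace N} {Δ : Set ℝ} {μ μ' : ℝ}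

theorem bulkOperator_eq_compression (H : BulkSpace N →L[ℂ] BulkSpace N) (μ : ℝ) :
    bulkOperator H μ = compression (fluxInsertion N) (fermiProjection H μ) := by
  rw [compression, mul_assoc]
  rfl

namespace IsMobilityGapped

theorem isSelfAdjoint (hH : IsMobilityGapped H Δ) : IsSelfAdjoint H :=
  hH.isHamiltonian.isSelfAdjoint

theorem exists_commutator_le (hH : IsMobilityGapped H Δ) {ε : ℝ} (hε : 0 < ε) :
    ∃ p : BulkSpace N →L[ℂ] BulkSpace N, p.toLinearMap.HasFiniteRange ∧ ∀ f ∈ borelUnit Δ,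
      ‖(borelCalculus H f * fluxInsertion N - fluxInsertion N * borelCalculus H f) * (1 - p)‖
        ≤ ε := by
  obtain ⟨p, hp, h⟩ := hH.uniformlyWeaklyLocal.exists_commutator_le (by
    rintro _ ⟨f, hf, rfl⟩
    exact norm_borelCalculus_le_one hf.1 hf.2.1) hε
  exact ⟨p, hp, fun f hf => h _ ⟨f, hf, rfl⟩⟩

theorem isFiniteRankLimit_commutator (hH : IsMobilityGapped H Δ) {f : ℝ → ℂ}
    (hf : f ∈ borelUnit Δ) :
    IsFiniteRankLimit
      (borelCalculus H f * fluxInsertion N - fluxInsertion N * borelCalculus H f) := by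
  intro ε hε
  obtain ⟨p, hp, h⟩ := hH.exists_commutator_le hε
  refine ⟨(borelCalculus H f * fluxInsertion N - fluxInsertion N * borelCalculus H f) * p,
    hp.comp_left _, ?_⟩
  have := h f hf
  rwa [mul_sub, mul_one] at this

/-- At the lower endpoint of `Δ` the function `χ_{(-∞,μ)}` is not among the test functions, but
`χ_{(-∞,μ]}` is, and the two projections differ by the finite-rank projection on an eigenspace. -/
theorem isFiniteRankLimit_commutator_fermiProjection (hΔ : Δ.Nontrivial)
    (hH : IsMobilityGapped H Δ) (hμ : μ ∈ Δ) :
    IsFiniteRankLimit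
      (fermiProjection H μ * fluxInsertion N - fluxInsertion N * fermiProjection H μ) := by
  have hnorm : ∀ (s : Set ℝ) (t : ℝ), ‖s.indicator (1 : ℝ → ℂ) t‖ ≤ 1 := fun s t =>
    (norm_indicator_le_norm_self _ _).trans (by simp)
  by_cases h : μ ∈ lowerBounds Δ
  · obtain ⟨b, hb, hbμ⟩ := hΔ.exists_ne μ
    have hμb : μ < b := lt_of_le_of_ne (h hb) hbμ.symm
    have hmem : (Set.Iic μ).indicator (1 : ℝ → ℂ) ∈ borelUnit Δ := by
      refine ⟨measurable_one.indicator measurableSet_Iic, hnorm _, fun s hs t ht => ?_,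
        fun s hs t ht => ?_⟩
      · rw [Set.indicator_of_mem (Set.mem_Iic.2 (hs hμ)),
          Set.indicator_of_mem (Set.mem_Iic.2 (ht hμ))]
        rfl
      · rw [Set.indicator_of_notMem (by simpa using hμb.trans_le (hs hb)),
          Set.indicator_of_notMem (by simpa using hμb.trans_le (ht hb))]
    have hsum : borelCalculus H ((Set.Iic μ).indicator 1) = fermiProjection H μ +
        borelCalculus H (({μ} : Set ℝ).indicator 1) := by
      rw [fermiProjection, ← borelCalculus_union H measurableSet_Iio (measurableSet_singleton μ)
        (by simp), Set.Iio_union_right]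
    have hR := IsFiniteRankLimit.of_hasFiniteRange
      (hasFiniteRange_borelCalculus_singleton hH.isSelfAdjoint (hH.finite_multiplicity μ hμ))
    have h1 := hH.isFiniteRankLimit_commutator hmem
    rw [hsum] at h1
    have h2 := (h1.sub (hR.mul_right (fluxInsertion N))).add (hR.mul_left (fluxInsertion N))
    convert h2 using 1
    noncomm_ring
  · obtain ⟨b, hb, hbμ⟩ : ∃ b ∈ Δ, b < μ := by
      simpa [mem_lowerBounds] using h
    refine hH.isFiniteRankLimit_commutator ⟨measurable_one.indicator measurableSet_Iio, hnorm _,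
      fun s hs t ht => ?_, fun s hs t ht => ?_⟩
    · rw [Set.indicator_of_mem (Set.mem_Iio.2 ((hs hb).trans_lt hbμ)),
        Set.indicator_of_mem (Set.mem_Iio.2 ((ht hb).trans_lt hbμ))]
      rfl
    · rw [Set.indicator_of_notMem (by simpa using hs hμ),
        Set.indicator_of_notMem (by simpa using ht hμ)]

theorem isFredholm_bulkOperator (hΔ : Δ.Nontrivial) (hH : IsMobilityGapped H Δ) (hμ : μ ∈ Δ) :
    (bulkOperator H μ).IsFredholm := by
  rw [bulkOperator_eq_compression]
  exact isFredholm_compression (isStarProjection_borelCalculus H measurableSet_Iio)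
    star_fluxInsertion_mul fluxInsertion_mul_star
    (hH.isFiniteRankLimit_commutator_fermiProjection hΔ hμ)

end IsMobilityGapped

theorem IsTimeReversal.isOddPair_bulkOperator {Θ : BulkSpace N →ₗ⋆[ℂ] BulkSpace N}
    (hΘ : IsTimeReversal Θ) (hHΘ : IsTimeReversalInvariant Θ H) (hH : IsSelfAdjoint H) (μ : ℝ) :
    IsOddPair Θ (bulkOperator H μ) (bulkOperator H μ) := by
  rw [bulkOperator_eq_compression]
  exact isOddPair_compression hΘ.isOddPair_fluxInsertion
    (isOddPair_borelCalculus hΘ.isQuaternionic hH hHΘ (.indicator_one measurableSet_Iio))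

theorem IsTimeReversal.isThetaOdd_bulkOperator {Θ : BulkSpace N →ₗ⋆[ℂ] BulkSpace N}
    (hΘ : IsTimeReversal Θ) (hHΘ : IsTimeReversalInvariant Θ H) (hH : IsSelfAdjoint H) (μ : ℝ) :
    IsThetaOdd Θ (bulkOperator H μ) := fun ψ => by
  rw [← hΘ.isOddPair_bulkOperator hHΘ hH μ (Θ ψ), hΘ.sq_eq_neg, map_neg, neg_neg]

/-- Moving `μ` to `μ'` adds to the Fermi projection the spectral projections of `(μ,μ')`, where
the spectrum in `Δ` has finite multiplicities, and of `{μ}`. -/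
theorem IsMobilityGapped.index_bulkOperator_eq_of_lt (hΔ : Δ.OrdConnected) (hΔ₂ : Δ.Nontrivial)
    (hH : IsMobilityGapped H Δ) (hμ : μ ∈ Δ) (hμ' : μ' ∈ Δ) (hlt : μ < μ') :
    fredholmIndex (bulkOperator H μ') = fredholmIndex (bulkOperator H μ) ∧
    ∀ Θ : BulkSpace N →ₗ⋆[ℂ] BulkSpace N, IsTimeReversal Θ → IsTimeReversalInvariant Θ H →
      fredholmIndexTwo (bulkOperator H μ') = fredholmIndexTwo (bulkOperator H μ) := by
  have hsa := hH.isSelfAdjoint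
  set Q := borelCalculus H ((Set.Ioo μ μ').indicator 1) with hQ
  set R := borelCalculus H (({μ} : Set ℝ).indicator 1) with hR
  have hdisj : Disjoint (Set.Iio μ) (Set.Ioo μ μ') :=
    Set.disjoint_left.2 fun t ht ht' => lt_asymm ht ht'.1
  have hP' : fermiProjection H μ' = fermiProjection H μ + Q + R := by
    have h1 : Set.Iio μ' = Set.Iio μ ∪ Set.Ioo μ μ' ∪ {μ} := by
      ext t
      simp only [Set.mem_Iio, Set.mem_union, Set.mem_Ioo, Set.mem_singleton_iff]
      rcases lt_trichotomy t μ with h | h | h <;> constructor <;> intro h' <;> grind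
    rw [fermiProjection, h1, borelCalculus_union H (measurableSet_Iio.union measurableSet_Ioo)
      (measurableSet_singleton μ) (by simp), borelCalculus_union H measurableSet_Iio
      measurableSet_Ioo hdisj, fermiProjection]
  obtain ⟨D, hHD, hQD, hDQ, hD, hDΘ⟩ := exists_commuting_mean (s := Set.Ioo μ μ') hsa
    measurableSet_Ioo (fluxInsertion N) fun ε hε => by
      obtain ⟨p, hp, h⟩ := hH.exists_commutator_le hε
      refine ⟨p, hp, fun f hf hf1 hf0 => h f ⟨hf, hf1, fun s hs t ht => ?_, fun s hs t ht => ?_⟩⟩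
      · rw [hf0 s fun h => h.1.not_ge (hs hμ), hf0 t fun h => h.1.not_ge (ht hμ)]
      · rw [hf0 s fun h => h.2.not_ge (hs hμ'), hf0 t fun h => h.2.not_ge (ht hμ')]
  have hQs : IsStarProjection Q := isStarProjection_borelCalculus H measurableSet_Ioo
  have hfin : ∀ a : ℝ, FiniteDimensional ℂ (Q.range ⊓
      Module.End.eigenspace (H : BulkSpace N →ₗ[ℂ] BulkSpace N) (a : ℂ) :
        Submodule ℂ (BulkSpace N)) := by
    intro a
    by_cases ha : a ∈ Set.Ioo μ μ'
    · have := hH.finite_multiplicity a (hΔ.out hμ hμ' (Set.Ioo_subset_Icc_self ha))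
      exact Submodule.finiteDimensional_of_le inf_le_right
    · -- eigenvectors with eigenvalue outside of `(μ,μ')` are annihilated by `Q`
      have hbot : (Q.range ⊓ Module.End.eigenspace (H : BulkSpace N →ₗ[ℂ] BulkSpace N) (a : ℂ) :
          Submodule ℂ (BulkSpace N)) = ⊥ := by
        refine eq_bot_iff.2 ?_
        rintro _ ⟨⟨ψ, rfl⟩, hψ⟩
        have h1 : Q (Q ψ) = 0 := borelCalculus_apply_eq_zero hsa
          (.indicator_one measurableSet_Ioo) (Module.End.mem_eigenspace_iff.1 hψ)
          (Set.indicator_of_notMem ha _)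
        have h2 : Q (Q ψ) = Q ψ := congrArg (fun T => T ψ) hQs.isIdempotentElem.eq
        exact (Submodule.mem_bot ℂ).2 (h2.symm.trans h1)
      rw [hbot]
      infer_instance
  have hF := hH.isFredholm_bulkOperator hΔ₂ hμ'
  rw [bulkOperator_eq_compression, hP'] at hF
  obtain ⟨h1, h2⟩ := index_compression_eq hsa
    (isStarProjection_borelCalculus H measurableSet_Iio) hQs
    (hasFiniteRange_borelCalculus_singleton hsa (hH.finite_multiplicity μ hμ))
    (borelCalculus_mul_eq_zero H measurableSet_Iio measurableSet_Ioo hdisj)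
    (borelCalculus_mul_eq_zero H measurableSet_Ioo measurableSet_Iio hdisj.symm)
    (borelCalculus_commute_self hsa (.indicator_one measurableSet_Ioo)).symm hfin
    (hH.isFiniteRankLimit_commutator_fermiProjection hΔ₂ hμ) hF hHD hQD hDQ hD
  refine ⟨?_, fun Θ hΘ hHΘ => ?_⟩
  · rw [fredholmIndex, fredholmIndex, bulkOperator_eq_compression, bulkOperator_eq_compression, hP']
    exact h1
  · have hodd : ∀ {s : Set ℝ}, MeasurableSet s → IsOddPair Θ (borelCalculus H (s.indicator 1))
        (borelCalculus H (s.indicator 1)) := fun hs =>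
      isOddPair_borelCalculus hΘ.isQuaternionic hsa hHΘ (.indicator_one hs)
    rw [fredholmIndexTwo, fredholmIndexTwo, bulkOperator_eq_compression,
      bulkOperator_eq_compression, hP']
    exact h2 Θ hΘ.isQuaternionic hHΘ hΘ.isOddPair_fluxInsertion (hodd measurableSet_Iio)
      (hodd measurableSet_Ioo) (hodd (measurableSet_singleton μ))
      (hDΘ Θ hΘ.isQuaternionic hHΘ hΘ.isOddPair_fluxInsertion)

end MobilityGapped

end MobilityGap

theorem mainTheorem1 (N : ℕ) (H : MobilityGap.BulkSpace N →L[ℂ] MobilityGap.BulkSpace N)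
    (Δ : Set ℝ) (hΔ : Δ.OrdConnected) (hΔ₂ : Δ.Nontrivial)
    (hH : MobilityGap.IsMobilityGapped H Δ) :
    (∀ μ ∈ Δ, (MobilityGap.bulkOperator H μ).IsFredholm) ∧
    (∀ μ ∈ Δ, ∀ μ' ∈ Δ,
      MobilityGap.fredholmIndex (MobilityGap.bulkOperator H μ) =
        MobilityGap.fredholmIndex (MobilityGap.bulkOperator H μ')) ∧
    (∀ Θ : MobilityGap.BulkSpace N →ₗ⋆[ℂ] MobilityGap.BulkSpace N,
      MobilityGap.IsTimeReversal Θ → MobilityGap.IsTimeReversalInvariant Θ H →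
        (∀ μ ∈ Δ, MobilityGap.IsThetaOdd Θ (MobilityGap.bulkOperator H μ)) ∧
        (∀ μ ∈ Δ, ∀ μ' ∈ Δ,
          MobilityGap.fredholmIndexTwo (MobilityGap.bulkOperator H μ) =
            MobilityGap.fredholmIndexTwo (MobilityGap.bulkOperator H μ'))) := by
  refine ⟨fun μ hμ => hH.isFredholm_bulkOperator hΔ₂ hμ, fun μ hμ μ' hμ' => ?_,
    fun Θ hΘ hHΘ => ⟨fun μ _ => hΘ.isThetaOdd_bulkOperator hHΘ hH.isSelfAdjoint μ,
      fun μ hμ μ' hμ' => ?_⟩⟩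
  · rcases lt_trichotomy μ μ' with h | rfl | h
    · exact (hH.index_bulkOperator_eq_of_lt hΔ hΔ₂ hμ hμ' h).1.symm
    · rfl
    · exact (hH.index_bulkOperator_eq_of_lt hΔ hΔ₂ hμ' hμ h).1
  · rcases lt_trichotomy μ μ' with h | rfl | h
    · exact ((hH.index_bulkOperator_eq_of_lt hΔ hΔ₂ hμ hμ' h).2 Θ hΘ hHΘ).symm
    · rfl
    · exact (hH.index_bulkOperator_eq_of_lt hΔ hΔ₂ hμ' hμ h).2 Θ hΘ hHΘ
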